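/- **Proposition.** Let $U$ be a finite set. For sets $A,B$ write $A\uplus B$ for their union, where $A$ and $B$ are required to be disjoint. For $\mathcal H\subseteq 2^U$ let $$\mathcal B(\mathcal H)=\{H_1\uplus\dots\uplus H_i \mid i\in\mathbb N,\ H_1,\dots,H_i\in\mathcal H\},$$ which contains $\emptyset$ (the case $i=0$). A function $\mathbf w\colon\mathcal B(\mathcal H)\to\mathbb R$ is *inductive union maximizing* with *generating function* $\mathbf g\colon\mathbb R\times\mathcal H\to\mathbb R$ if $\mathbf g$ is non-decreasing in its first argument and, for each nonempty $X\in\mathcal B(\mathcal H)$, $$\mathbf w(X)=\max\{\mathbf g(\mathbf w(S),H)\mid H\in\mathcal H,\ S\in\mathcal B(\mathcal H),\ S\uplus H=X\}.$$ For a matroid $M=(U,\mathcal I)$, a family $\mathcal S\subseteq 2^U$ and a function $\mathbf w$ to $\mathbb R$ that is defined on $\mathcal S$, a subfamily $\widehat{\mathcal S}\subseteq\mathcal S$ is a *max $q$-representative* of $\mathcal S$ with respect to $\mathbf w$ if, for each $Y\subseteq U$ with $|Y|\le q$ and each $X\in\mathcal S$ with $X\uplus Y\in\mathcal I$, there is $\widehat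 X\in\widehat{\mathcal S}$ with $\widehat X\uplus Y\in\mathcal I$ and $\mathbf w(\widehat X)\ge\mathbf w(X)$. There are a constant $c$ and a single algorithm (a fixed program for a random access machine with unit-cost addition, subtraction and comparison of natural numbers, with unit-cost operations over a field, with copying and comparison of real weights, and with an oracle for $\mathbf g$) for which the following holds. Let $\alpha,\beta,\gamma\in\mathbb N$, let $\mathbb F$ be a field, and let $M=(U,\mathcal I)$ be a matroid of rank $r=(\alpha+\beta)\gamma\ge 1$ that is represented over $\mathbb F$ by a matrix $A$ with $r$ rows and with columns labeled by $U$. Let $\mathcal H\subseteq 2^U$ be a family of $t$ sets, each of cardinality exactly $\gamma$, and let $\mathbf w\colon\mathcal B(\mathcal H)\to\mathbb R$ be inductive union maximizing with generating function $\mathbf g$. Given $\alpha,\beta,\gamma,r,t,|U|$, the matrix $A$, a list of the sets in $\mathcal H$, the value $\mathbf w(\emptyset)$, and access to $\mathbf g$ as an oracle, the algorithm halts and outputs a max $\beta\gamma$-representative $\widehat{\mathcal S}$ of size at most $\binom{r}{\alpha\gamma}$ for the family $$\mathcal S=\{S=H_1\uplus\dots\uplus H_\alpha\mid S\in\mathcal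 I\text{ and }H_j\in\mathcal H\text{ for }j\in\{1,\dots,\alpha\}\}$$ with respect to $\mathbf w$. It performs at most $2^{cr}\cdot t$ operations over $\mathbb F$ and calls to $\mathbf g$, and at most $2^{cr}\cdot(t+1)$ elementary steps of any kind in total. -/

import Mathlib

universe u v

namespace RepFamilies

/-! ### Set families over a universe `U` -/

section Families

variable {U : Type v}

/-- `ℋ` is a `γ`-family: each of its members has exactly `γ` elements (`U` is finite in all uses). -/
def IsUniformFamily (γ : ℕ) (ℋ : Set (Set U)) : Prop :=
  ∀ H ∈ ℋ, H.ncard = γ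

/-- `X = H₁ ⊎ ⋯ ⊎ H_i`: the sets `H j` are pairwise disjoint and `X` is their union. -/
def IsDisjointUnion {i : ℕ} (H : Fin i → Set U) (X : Set U) : Prop :=
  Pairwise (fun j k => Disjoint (H j) (H k)) ∧ X = ⋃ j, H j

/-- The family `B(ℋ)` of all disjoint unions of finitely many (possibly zero) members of `ℋ`. -/
def disjointUnions (ℋ : Set (Set U)) : Set (Set U) :=
  {X | ∃ (i : ℕ) (H : Fin i → Set U), (∀ j, H j ∈ ℋ) ∧ IsDisjointUnion H X}

/-- The family `𝒮` of the independent sets that are disjoint unions of exactly `α` members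
of `ℋ`. -/
def independentUnions (M : Matroid U) (α : ℕ) (ℋ : Set (Set U)) : Set (Set U) :=
  {S | M.Indep S ∧ ∃ H : Fin α → Set U, (∀ j, H j ∈ ℋ) ∧ IsDisjointUnion H S}

/-- `w : B(ℋ) → ℝ` is an inductive union maximizing function with generating function
`g : ℝ × ℋ → ℝ`.  The functions are written as total functions; their values outside of
`B(ℋ)` and `ℝ × ℋ` are unconstrained and never used. -/
structure IsInductiveUnionMaximizing (ℋ : Set (Set U)) (w : Set U → ℝ) (g : ℝ → Set U → ℝ) :
    Prop where
  monotone_left : ∀ H ∈ ℋ, Monotone fun x => g x H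
  isGreatest : ∀ X ∈ disjointUnions ℋ, X ≠ ∅ →
    IsGreatest {y | ∃ H ∈ ℋ, ∃ S ∈ disjointUnions ℋ, Disjoint S H ∧ S ∪ H = X ∧ y = g (w S) H}
      (w X)

/-- `R` is a max `q`-representative family of `𝒮` with respect to `w`. -/
structure IsMaxRepresentative (M : Matroid U) (q : ℕ) (𝒮 : Set (Set U)) (w : Set U → ℝ)
    (R : Set (Set U)) : Prop where
  subset : R ⊆ 𝒮
  exists_ge : ∀ Y : Set U, Y.ncard ≤ q → ∀ X ∈ 𝒮, Disjoint X Y → M.Indep (X ∪ Y) →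
    ∃ X' ∈ R, Disjoint X' Y ∧ M.Indep (X' ∪ Y) ∧ w X ≤ w X'

/-- The matrix `A`, with columns labelled by `U`, is a linear representation of `M`: the ground
set of `M` is `U`, and a set is independent iff the columns it labels are linearly
independent. -/
structure IsRepresentation {F : Type u} [Field F] {r : ℕ} (A : Matrix (Fin r) U F)
    (M : Matroid U) : Prop where
  ground_eq : M.E = Set.univ
  indep_iff : ∀ S : Set U, M.Indep S ↔ LinearIndepOn F (fun u => A.col u) S

end Families

/-! ### Random access programs over a field, with weights and an oracle

A machine has three kinds of arrays: of natural numbers, of elements of a field `F`, and of real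
weights.  Cells are addressed indirectly, by expressions in natural numbers.  A program is a fixed
finite text, which does not depend on the field or on the instance.  Natural numbers can be added,
subtracted (with truncation at zero) and compared, but not multiplied.  Weights can only be copied,
compared, and passed to the oracle. -/

/-- The contents of the memory: `nat a i` is the cell `i` of the array `a` of natural numbers,
and likewise for the arrays of field elements and of weights. -/
structure Memory (F : Type u) where
  nat : ℕ → ℕ → ℕ
  fld : ℕ → ℕ → F
  wgt : ℕ → ℕ → ℝ

/-- Overwrite one cell of an array. -/
def setCell {V : Type u} (m : ℕ → ℕ → V) (a i : ℕ) (x : V) : ℕ → ℕ → V :=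
  Function.update m a (Function.update (m a) i x)

/-- Expressions for natural numbers. -/
inductive Expr : Type
  | const (k : ℕ) : Expr
  | cell (a : ℕ) (i : Expr) : Expr
  | add (e₁ e₂ : Expr) : Expr
  | sub (e₁ e₂ : Expr) : Expr

/-- The value of an expression. -/
def Expr.val {F : Type u} (s : Memory F) : Expr → ℕ
  | .const k => k
  | .cell a i => s.nat a (i.val s)
  | .add e₁ e₂ => e₁.val s + e₂.val s
  | .sub e₁ e₂ => e₁.val s - e₂.val s

/-- The binary field operations. -/
inductive FieldOp : Type
  | add | sub | mul | div

/-- The result of a binary field operation. -/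
def FieldOp.val {F : Type u} [Field F] : FieldOp → F → F → F
  | .add, x, y => x + y
  | .sub, x, y => x - y
  | .mul, x, y => x * y
  | .div, x, y => x / y

/-- Programs.  A pair `a i` stands for the cell of the array `a` whose index is the value
of `i`. -/
inductive Program : Type
  /-- do nothing -/
  | skip : Program
  /-- `N[a][i] := e` -/
  | natSet (a : ℕ) (i e : Expr) : Program
  /-- `F[a][i] := 0` -/
  | fldZero (a : ℕ) (i : Expr) : Program
  /-- `F[a][i] := 1` -/
  | fldOne (a : ℕ) (i : Expr) : Program
  /-- `F[a][i] := F[b][j]` -/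
  | fldCopy (a : ℕ) (i : Expr) (b : ℕ) (j : Expr) : Program
  /-- `F[a][i] := F[b][j] ∘ F[c][k]` for a field operation `∘` -/
  | fldOp (o : FieldOp) (a : ℕ) (i : Expr) (b : ℕ) (j : Expr) (c : ℕ) (k : Expr) : Program
  /-- `W[a][i] := W[b][j]` -/
  | wgtCopy (a : ℕ) (i : Expr) (b : ℕ) (j : Expr) : Program
  /-- `W[a][i] := oracle (W[b][j], h)` -/
  | call (a : ℕ) (i : Expr) (b : ℕ) (j : Expr) (h : Expr) : Program
  /-- run `p`, then `q` -/
  | seq (p q : Program) : Program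
  /-- if `e₁ < e₂` then `p` else `q` -/
  | ifLt (e₁ e₂ : Expr) (p q : Program) : Program
  /-- if `F[a][i] = 0` then `p` else `q` -/
  | ifZero (a : ℕ) (i : Expr) (p q : Program) : Program
  /-- if `W[a][i] ≤ W[b][j]` then `p` else `q` -/
  | ifLe (a : ℕ) (i : Expr) (b : ℕ) (j : Expr) (p q : Program) : Program
  /-- while `e₁ < e₂` do `p` -/
  | whileLt (e₁ e₂ : Expr) (p : Program) : Program

/-- `Runs G p s s' T N`: with the oracle `G`, the program `p` started on the memory `s` halts with
the memory `s'`; it executes `T` elementary steps (instructions and tests of any kind) in total,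
and `N` of them are operations over the field (arithmetic, constants, tests for zero) or calls to
the oracle.  The expressions in an instruction are part of the fixed program text, so they
contribute no more than a constant factor. -/
inductive Runs {F : Type u} [Field F] (G : ℝ → ℕ → ℝ) :
    Program → Memory F → Memory F → ℕ → ℕ → Prop
  | skip (s : Memory F) : Runs G .skip s s 1 0
  | natSet (a : ℕ) (i e : Expr) (s : Memory F) :
      Runs G (.natSet a i e) s { s with nat := setCell s.nat a (i.val s) (e.val s) } 1 0
  | fldZero (a : ℕ) (i : Expr) (s : Memory F) :
      Runs G (.fldZero a i) s { s with fld := setCell s.fld a (i.val s) 0 } 1 1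
  | fldOne (a : ℕ) (i : Expr) (s : Memory F) :
      Runs G (.fldOne a i) s { s with fld := setCell s.fld a (i.val s) 1 } 1 1
  | fldCopy (a : ℕ) (i : Expr) (b : ℕ) (j : Expr) (s : Memory F) :
      Runs G (.fldCopy a i b j) s
        { s with fld := setCell s.fld a (i.val s) (s.fld b (j.val s)) } 1 0
  | fldOp (o : FieldOp) (a : ℕ) (i : Expr) (b : ℕ) (j : Expr) (c : ℕ) (k : Expr) (s : Memory F) :
      Runs G (.fldOp o a i b j c k) s
        { s with
          fld := setCell s.fld a (i.val s) (o.val (s.fld b (j.val s)) (s.fld c (k.val s))) } 1 1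
  | wgtCopy (a : ℕ) (i : Expr) (b : ℕ) (j : Expr) (s : Memory F) :
      Runs G (.wgtCopy a i b j) s
        { s with wgt := setCell s.wgt a (i.val s) (s.wgt b (j.val s)) } 1 0
  | call (a : ℕ) (i : Expr) (b : ℕ) (j : Expr) (h : Expr) (s : Memory F) :
      Runs G (.call a i b j h) s
        { s with wgt := setCell s.wgt a (i.val s) (G (s.wgt b (j.val s)) (h.val s)) } 1 1
  | seq {p q : Program} {s₁ s₂ s₃ : Memory F} {T₁ N₁ T₂ N₂ : ℕ} :
      Runs G p s₁ s₂ T₁ N₁ → Runs G q s₂ s₃ T₂ N₂ →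
      Runs G (.seq p q) s₁ s₃ (T₁ + T₂) (N₁ + N₂)
  | ifLt_true {e₁ e₂ : Expr} {p q : Program} {s s' : Memory F} {T N : ℕ} :
      e₁.val s < e₂.val s → Runs G p s s' T N → Runs G (.ifLt e₁ e₂ p q) s s' (T + 1) N
  | ifLt_false {e₁ e₂ : Expr} {p q : Program} {s s' : Memory F} {T N : ℕ} :
      ¬ e₁.val s < e₂.val s → Runs G q s s' T N → Runs G (.ifLt e₁ e₂ p q) s s' (T + 1) N
  | ifZero_true {a : ℕ} {i : Expr} {p q : Program} {s s' : Memory F} {T N : ℕ} :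
      s.fld a (i.val s) = 0 → Runs G p s s' T N →
      Runs G (.ifZero a i p q) s s' (T + 1) (N + 1)
  | ifZero_false {a : ℕ} {i : Expr} {p q : Program} {s s' : Memory F} {T N : ℕ} :
      s.fld a (i.val s) ≠ 0 → Runs G q s s' T N →
      Runs G (.ifZero a i p q) s s' (T + 1) (N + 1)
  | ifLe_true {a : ℕ} {i : Expr} {b : ℕ} {j : Expr} {p q : Program} {s s' : Memory F} {T N : ℕ} :
      s.wgt a (i.val s) ≤ s.wgt b (j.val s) → Runs G p s s' T N →
      Runs G (.ifLe a i b j p q) s s' (T + 1) N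
  | ifLe_false {a : ℕ} {i : Expr} {b : ℕ} {j : Expr} {p q : Program} {s s' : Memory F}
      {T N : ℕ} :
      ¬ s.wgt a (i.val s) ≤ s.wgt b (j.val s) → Runs G q s s' T N →
      Runs G (.ifLe a i b j p q) s s' (T + 1) N
  | while_true {e₁ e₂ : Expr} {p : Program} {s₁ s₂ s₃ : Memory F} {T₁ N₁ T₂ N₂ : ℕ} :
      e₁.val s₁ < e₂.val s₁ → Runs G p s₁ s₂ T₁ N₁ → Runs G (.whileLt e₁ e₂ p) s₂ s₃ T₂ N₂ →
      Runs G (.whileLt e₁ e₂ p) s₁ s₃ (T₁ + T₂ + 1) (N₁ + N₂)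
  | while_false {e₁ e₂ : Expr} {p : Program} {s : Memory F} :
      ¬ e₁.val s < e₂.val s → Runs G (.whileLt e₁ e₂ p) s s 1 0

/-! ### Input and output -/

/-- The array `m` lists the sets `H 0, H 1, …`, one after the other, each one by the labels of its
elements in `d` consecutive cells, in an arbitrary order. -/
def ListsFamily {U : Type v} {n k : ℕ} (label : U ≃ Fin n) (m : ℕ → ℕ) (d : ℕ)
    (H : Fin k → Set U) : Prop :=
  ∀ h : Fin k, ∃ x : Fin d → U, Set.range x = H h ∧
    ∀ j : Fin d, m ((h : ℕ) * d + j) = (label (x j) : ℕ)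

/-- The memory `s` holds the input: the numbers `n, α, β, γ, r, t`, the sets of the family, the
matrix `A` column by column, and the value `w₀ = w(∅)`.  All other cells are arbitrary. -/
structure IsInput {F : Type u} {U : Type v} {n r t : ℕ} (label : U ≃ Fin n) (α β γ : ℕ)
    (A : Matrix (Fin r) U F) (H : Fin t → Set U) (w₀ : ℝ) (s : Memory F) : Prop where
  size : s.nat 0 0 = n
  alpha : s.nat 0 1 = α
  beta : s.nat 0 2 = β
  gamma : s.nat 0 3 = γ
  rank : s.nat 0 4 = r
  card : s.nat 0 5 = t
  family : ListsFamily label (s.nat 1) γ H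
  matrix : ∀ (i : Fin r) (x : U), s.fld 0 ((label x : ℕ) * r + i) = A i x
  weight : s.wgt 0 0 = w₀

/-- The memory `s` holds the output: the number `k`, followed by `k` sets of `d` elements. -/
structure IsOutput {F : Type u} {U : Type v} {n k : ℕ} (label : U ≃ Fin n) (d : ℕ)
    (R : Fin k → Set U) (s : Memory F) : Prop where
  count : s.nat 2 0 = k
  family : ListsFamily label (s.nat 3) d R

end RepFamilies

namespace RepFamilies

section Wedge

/-! ### Exterior multiplication in bitmask coordinates -/

/-! Attach to a list of labels the exterior product of the corresponding columns of $A$. If this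
product is nonzero, the labels are distinct and the columns independent; conversely, $r$ independent
columns have a product with nonzero top coordinate. Now let $X\uplus Y$ be independent, enlarge it
to a base $B$, and consider the linear functional that multiplies by the columns of $B\setminus X$
and reads off the top coordinate. It does not vanish at the product of $X$. So if that product lies
in the span of the products of other lists, the functional is nonzero at one of them, and this list
is disjoint from $Y$ and independent together with it (`exists_exchange`). A basis of the span of
all products is therefore representative, and the weights are respected if every candidate is
spanned by basis members at least as good as itself (`IsWeightedBasis`).

The families are built level by level. The candidates for $i+1$ sets are the concatenations of a
representative for $i$ sets with a member of $\mathcal H$; concatenations that overlap or are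
dependent have product zero and disappear in the elimination. For $X$ at level $i+1$, the recursion
for $w$ provides an optimal splitting $X=S\uplus H$. One replaces $S$ relative to $H\uplus Y$, uses
that $g$ is monotone, and then exchanges the resulting candidate for a basis member
(`IsLevel.succ`). The algorithm knows only lower bounds for the weights, from one oracle call per
candidate; monotonicity makes this enough.

The basis comes from Gaussian elimination in which a row is only ever reduced by a better one: when
two rows compete for a pivot, the worse one is carried on (`IsCarrying`, `insertProgram_spec`).
Pivots of products of $d$ columns are bitmasks with $d$ bits, which gives the binomial bound
(`IsPivotTable.card_le`). Vectors are stored with all $2^r$ coordinates. A candidate costs at most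
$64\cdot 8^r$ steps, and each of at most $r$ levels has at most $2^r t$ candidates. -/

theorem testBit_sub_two_pow {T i : ℕ} (h : T.testBit i = true) (j : ℕ) :
    (T - 2 ^ i).testBit j = (T.testBit j && decide (j ≠ i)) := by
  -- Bit `i` being set means that the quotient `a` is odd, so subtracting `2 ^ i` lowers `a` by one
  -- without a borrow.
  obtain ⟨a, b, hb, rfl⟩ : ∃ a b, b < 2 ^ i ∧ T = 2 ^ i * a + b :=
    ⟨T / 2 ^ i, T % 2 ^ i, Nat.mod_lt _ (by positivity), (Nat.div_add_mod _ _).symm⟩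
  rw [Nat.testBit_two_pow_mul_add _ hb] at h
  simp only [lt_irrefl, if_false, Nat.sub_self, Nat.testBit_zero, decide_eq_true_eq] at h
  obtain ⟨a, rfl⟩ : ∃ a', a = a' + 1 := ⟨a - 1, by omega⟩
  have e : 2 ^ i * (a + 1) + b - 2 ^ i = 2 ^ i * a + b := by
    rw [Nat.mul_add, Nat.mul_one]; omega
  rw [e, Nat.testBit_two_pow_mul_add _ hb, Nat.testBit_two_pow_mul_add _ hb]
  rcases lt_trichotomy j i with hj | rfl | hj
  · simp [hj, hj.ne]
  · simp; omega
  · obtain ⟨k, rfl⟩ := Nat.exists_eq_add_of_lt hj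
    have : i + k + 1 - i = k + 1 := by omega
    simp only [show ¬ i + k + 1 < i by omega, if_false, this, Nat.testBit_succ,
      show i + k + 1 ≠ i by omega, ne_eq, not_false_eq_true, decide_true, Bool.and_true]
    congr 1; omega

theorem two_pow_le_of_testBit {T i : ℕ} (h : T.testBit i = true) : 2 ^ i ≤ T :=
  Nat.ge_two_pow_of_testBit h

variable {F : Type u} [Field F]

/-- The factor `-1` for each bit that is set. -/
def bitSign (F : Type u) [Field F] (T j : ℕ) : F := if T.testBit j then -1 else 1

/-- Exterior multiplication by the `i`-th basis vector. -/
def creation (F : Type u) [Field F] (i : ℕ) : Module.End F (ℕ → F) where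
  toFun v T := if T.testBit i then (∏ j ∈ Finset.range i, bitSign F T j) * v (T - 2 ^ i) else 0
  map_add' v w := by ext T; dsimp; split_ifs <;> ring
  map_smul' c v := by ext T; simp only [Pi.smul_apply, smul_eq_mul, RingHom.id_apply]; split_ifs <;> ring

theorem creation_apply (i : ℕ) (v : ℕ → F) (T : ℕ) : creation F i v T =
    if T.testBit i then (∏ j ∈ Finset.range i, bitSign F T j) * v (T - 2 ^ i) else 0 := rfl

theorem prod_bitSign_sub_of_le {T i k : ℕ} (h : T.testBit i = true) (hk : k ≤ i) :
    ∏ j ∈ Finset.range k, bitSign F (T - 2 ^ i) j = ∏ j ∈ Finset.range k, bitSign F T j := by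
  refine Finset.prod_congr rfl fun j hj => ?_
  have : j ≠ i := by have := Finset.mem_range.1 hj; omega
  simp [bitSign, testBit_sub_two_pow h, this]

theorem prod_bitSign_sub_of_lt {T i k : ℕ} (h : T.testBit i = true) (hk : i < k) :
    ∏ j ∈ Finset.range k, bitSign F (T - 2 ^ i) j = - ∏ j ∈ Finset.range k, bitSign F T j := by
  rw [← Finset.mul_prod_erase _ _ (Finset.mem_range.2 hk),
    ← Finset.mul_prod_erase _ (bitSign F T) (Finset.mem_range.2 hk)]
  have : ∏ j ∈ (Finset.range k).erase i, bitSign F (T - 2 ^ i) j =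
      ∏ j ∈ (Finset.range k).erase i, bitSign F T j := by
    refine Finset.prod_congr rfl fun j hj => ?_
    simp [bitSign, testBit_sub_two_pow h, (Finset.mem_erase.1 hj).1]
  rw [this]
  simp [bitSign, testBit_sub_two_pow h, h]

theorem creation_mul_self (i : ℕ) : creation F i * creation F i = 0 := by
  ext v T
  simp only [Module.End.mul_apply, creation_apply, LinearMap.zero_apply, Pi.zero_apply]
  split_ifs with h1 h2
  · simp [testBit_sub_two_pow h1] at h2
  · simp
  · rfl

/-- Clearing the lower bit `i` first flips the sign attached to position `j`, while clearing `j`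
first does not affect the sign attached to `i`. -/
theorem creation_mul_of_lt {i j : ℕ} (hij : i < j) :
    creation F i * creation F j = -(creation F j * creation F i) := by
  ext v T
  simp only [Module.End.mul_apply, creation_apply, LinearMap.neg_apply, Pi.neg_apply]
  by_cases hi : T.testBit i = true
  · by_cases hj : T.testBit j = true
    · simp only [hi, hj, testBit_sub_two_pow hi, testBit_sub_two_pow hj, hij.ne, hij.ne', if_true,
        ne_eq, not_false_eq_true, decide_true, Bool.and_true]
      rw [prod_bitSign_sub_of_lt hi hij, prod_bitSign_sub_of_le hj hij.le, Nat.sub_right_comm]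
      ring
    · simp [hi, hj, testBit_sub_two_pow hi]
  · by_cases hj : T.testBit j = true
    · simp [hi, hj, testBit_sub_two_pow hj]
    · simp [hi, hj]

theorem creation_anticomm {i j : ℕ} (hij : i ≠ j) :
    creation F i * creation F j = -(creation F j * creation F i) := by
  rcases hij.lt_or_gt with h | h
  · exact creation_mul_of_lt h
  · rw [creation_mul_of_lt h, neg_neg]

/-- Exterior multiplication by a vector. -/
def wedge (F : Type u) [Field F] (r : ℕ) : (Fin r → F) →ₗ[F] Module.End F (ℕ → F) where
  toFun a := ∑ i : Fin r, a i • creation F i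
  map_add' a b := by simp [add_smul, Finset.sum_add_distrib]
  map_smul' c a := by simp [mul_smul, Finset.smul_sum]

theorem wedge_def {r : ℕ} (a : Fin r → F) : wedge F r a = ∑ i : Fin r, a i • creation F i := rfl

/-- The terms for `(i, j)` and `(j, i)` cancel. The diagonal terms vanish by `creation_mul_self`,
which anticommutation would not give in characteristic two. -/
theorem wedge_mul_self {r : ℕ} (a : Fin r → F) : wedge F r a * wedge F r a = 0 := by
  rw [wedge_def, Finset.sum_mul_sum, ← Finset.sum_product']
  refine Finset.sum_involution (fun p _ => (p.2, p.1)) ?_ ?_ (by simp) (by simp)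
  · rintro ⟨i, j⟩ -
    by_cases h : i = j
    · subst h; simp [creation_mul_self]
    · simp only [smul_mul_smul_comm]
      rw [creation_anticomm (fun e => h (Fin.ext e)), mul_comm (a i)]
      simp
  · rintro ⟨i, j⟩ - h1 h2
    simp only [Prod.mk.injEq] at h2
    obtain rfl : i = j := h2.2
    simp [creation_mul_self] at h1

/-- The coordinates of the empty product. -/
def unitVec (F : Type u) [Field F] : ℕ → F := fun T => if T = 0 then 1 else 0

/-- The exterior product of a list of vectors, in bitmask coordinates. -/
def wedgeList {r : ℕ} (l : List (Fin r → F)) (v : ℕ → F) : ℕ → F :=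
  l.foldl (fun v a => wedge F r a v) v

theorem wedgeList_append {r : ℕ} (l l' : List (Fin r → F)) (v : ℕ → F) :
    wedgeList (l ++ l') v = wedgeList l' (wedgeList l v) := List.foldl_append

/-! ### Comparison with the exterior algebra -/

/-- The algebra homomorphism from the exterior algebra to the operators. -/
noncomputable def wedgeHom (F : Type u) [Field F] (r : ℕ) :
    ExteriorAlgebra F (Fin r → F) →ₐ[F] Module.End F (ℕ → F) :=
  ExteriorAlgebra.lift F ⟨wedge F r, wedge_mul_self⟩

theorem wedgeHom_ι {r : ℕ} (a : Fin r → F) : wedgeHom F r (ExteriorAlgebra.ι F a) = wedge F r a := by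
  simp [wedgeHom]

/-- The fold multiplies each further vector on the left, hence the reversal. -/
theorem wedgeList_eq {r : ℕ} (l : List (Fin r → F)) (v : ℕ → F) :
    wedgeList l v = wedgeHom F r ((l.reverse.map (ExteriorAlgebra.ι F)).prod) v := by
  induction l using List.reverseRecOn with
  | nil => simp [wedgeList]
  | append_singleton l a ih =>
    rw [wedgeList_append, ih]
    simp [wedgeList, wedgeHom_ι]

theorem prod_map_ι {r : ℕ} (l : List (Fin r → F)) :
    (l.map (ExteriorAlgebra.ι F)).prod = ExteriorAlgebra.ιMulti F l.length l.get := by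
  rw [ExteriorAlgebra.ιMulti_apply]
  congr 1
  conv_lhs => rw [← List.ofFn_get l]
  rw [List.map_ofFn]; rfl

/-- An alternating map vanishes on a dependent family. -/
theorem linearIndependent_of_wedgeList_ne_zero {r : ℕ} {l : List (Fin r → F)} {v : ℕ → F}
    (h : wedgeList l v ≠ 0) : LinearIndependent F l.reverse.get := by
  by_contra hl
  rw [wedgeList_eq, prod_map_ι, AlternatingMap.map_linearDependent _ _ hl] at h
  simp at h

/-- The top coordinate of the exterior product of `r` vectors of length `r`. -/
noncomputable def topForm (F : Type u) [Field F] (r : ℕ) : (Fin r → F) [⋀^Fin r]→ₗ[F] F :=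
  (((LinearMap.proj (2 ^ r - 1) : (ℕ → F) →ₗ[F] F) ∘ₗ LinearMap.applyₗ (unitVec F)) ∘ₗ
    (wedgeHom F r).toLinearMap).compAlternatingMap (ExteriorAlgebra.ιMulti F r)

theorem topForm_apply {r : ℕ} (x : Fin r → Fin r → F) :
    topForm F r x = wedgeHom F r (List.ofFn fun i => ExteriorAlgebra.ι F (x i)).prod (unitVec F)
      (2 ^ r - 1) := by
  rw [← ExteriorAlgebra.ιMulti_apply]; rfl

/-- The factors set the bits from the lowest to the highest. At the full mask each factor
contributes a product of signs, so the value is a unit. -/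
theorem prod_creation_ne_zero (m : ℕ) :
    (List.ofFn fun i : Fin m => creation F (m - 1 - i)).prod (unitVec F) (2 ^ m - 1) ≠ 0 := by
  induction m with
  | zero => simp [unitVec]
  | succ m ih =>
    have e : (List.ofFn fun i : Fin m => creation F (m + 1 - 1 - (i.succ : ℕ))) =
        List.ofFn fun i : Fin m => creation F (m - 1 - i) := by
      congr 1; funext i; congr 1; simp; omega
    have h2 : 2 ^ (m + 1) - 1 - 2 ^ m = 2 ^ m - 1 := by rw [pow_succ]; omega
    rw [List.ofFn_succ, List.prod_cons, e, Module.End.mul_apply, creation_apply]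
    simp only [Fin.val_zero, Nat.add_sub_cancel, Nat.sub_zero, Nat.testBit_two_pow_sub_one,
      Nat.lt_succ_self, decide_true, if_true, h2]
    refine mul_ne_zero (Finset.prod_ne_zero_iff.2 fun j _ => ?_) ih
    unfold bitSign; split_ifs <;> simp

/-- An alternating form in `r` vectors of $F^r$ is a multiple of the determinant. The multiple is
not zero because the form does not vanish on the reversed standard basis. -/
theorem topForm_ne_zero {r : ℕ} {x : Fin r → Fin r → F} (hx : LinearIndependent F x) :
    topForm F r x ≠ 0 := by
  have hw : ∀ i : Fin r, wedge F r (Pi.basisFun F (Fin r) i) = creation F i := by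
    intro i
    rw [wedge_def, Finset.sum_eq_single i]
    · simp
    · intro j _ hj; simp [hj]
    · simp
  -- Reversing the basis puts the factors in the order of `prod_creation_ne_zero`.
  have h0 : topForm F r (fun i => Pi.basisFun F (Fin r) (Fin.rev i)) ≠ 0 := by
    rw [topForm_apply, map_list_prod, List.map_ofFn]
    have e : (⇑(wedgeHom F r) ∘ fun i => ExteriorAlgebra.ι F (Pi.basisFun F (Fin r) (Fin.rev i))) =
        fun i : Fin r => creation F (r - 1 - i) := by
      funext i
      rw [Function.comp_apply, wedgeHom_ι, hw]
      congr 1; simp [Fin.val_rev]; omega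
    rw [e]; exact prod_creation_ne_zero r
  have key := AlternatingMap.eq_smul_basis_det (Pi.basisFun F (Fin r)) (topForm F r)
  have hd : (Pi.basisFun F (Fin r)).det x ≠ 0 := by
    have hs : ⊤ ≤ Submodule.span F (Set.range x) := by
      rw [hx.span_eq_top_of_card_eq_finrank' (by simp)]
    have := ((Pi.basisFun F (Fin r)).is_basis_iff_det (v := x)).1 ⟨hx, top_le_iff.1 hs⟩
    exact this.ne_zero
  rw [key, AlternatingMap.smul_apply, smul_eq_mul]
  refine mul_ne_zero (fun h => h0 ?_) hd
  rw [key, AlternatingMap.smul_apply, h, zero_smul]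

theorem wedgeList_top_ne_zero {r : ℕ} {l : List (Fin r → F)} (hl : l.length = r)
    (h : LinearIndependent F l.reverse.get) : wedgeList l (unitVec F) (2 ^ r - 1) ≠ 0 := by
  rw [wedgeList_eq]
  have hl' : l.reverse.length = r := by simpa using hl
  generalize l.reverse = m at *
  have hx : LinearIndependent F (fun i : Fin r => m.get (i.cast hl'.symm)) :=
    h.comp _ (Fin.cast_injective _)
  have := topForm_ne_zero hx
  rw [topForm_apply] at this
  convert this using 4
  apply List.ext_get
  · simp [hl']
  · intro n h1 h2; simp

/-! ### Homogeneous elements and the number of masks of a given degree -/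

/-- The number of bits below position `r` that are set. -/
def bitCount (r T : ℕ) : ℕ := ((Finset.range r).filter fun i => T.testBit i = true).card

/-- The coordinates of elements of degree `d`: functions supported on masks with `d` bits. -/
def degreeSubmodule (F : Type u) [Field F] (r d : ℕ) : Submodule F (ℕ → F) where
  carrier := {v | ∀ T, v T ≠ 0 → T < 2 ^ r ∧ bitCount r T = d}
  add_mem' {v w} hv hw T h := by
    by_cases h1 : v T = 0
    · exact hw T fun h2 => h (by simp [h1, h2])
    · exact hv T h1
  zero_mem' T h := by simp at h
  smul_mem' c v hv T h := hv T fun h1 => h (by simp [h1])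

theorem creation_mem {r d i : ℕ} (hi : i < r) {v : ℕ → F} (hv : v ∈ degreeSubmodule F r d) :
    creation F i v ∈ degreeSubmodule F r (d + 1) := by
  intro T hT
  rw [creation_apply] at hT
  split_ifs at hT with h
  · obtain ⟨h1, h2⟩ := hv _ (right_ne_zero_of_mul hT)
    constructor
    -- At positions `r` and beyond, the mask agrees with `T - 2 ^ i`, whose bits vanish there.
    · refine Nat.lt_pow_two_of_testBit _ fun j hj => ?_
      have := Nat.testBit_lt_two_pow (h1.trans_le (Nat.pow_le_pow_right (by norm_num) hj))
      rw [testBit_sub_two_pow h] at this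
      have hji : j ≠ i := by omega
      simpa [hji] using this
    · rw [← h2, bitCount, bitCount, ← Finset.card_erase_add_one (a := i) (by simp [hi, h])]
      congr 2; ext j
      simp [testBit_sub_two_pow h]; tauto
  · exact absurd rfl hT

theorem wedge_mem {r d : ℕ} (a : Fin r → F) {v : ℕ → F} (hv : v ∈ degreeSubmodule F r d) :
    wedge F r a v ∈ degreeSubmodule F r (d + 1) := by
  rw [wedge_def, LinearMap.sum_apply]
  exact Submodule.sum_mem _ fun i _ => Submodule.smul_mem _ _ (creation_mem i.2 hv)

theorem unitVec_mem (r : ℕ) : unitVec F ∈ degreeSubmodule F r 0 := by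
  intro T hT
  have : T = 0 := by by_contra h; simp [unitVec, h] at hT
  subst this
  simp [bitCount]

theorem wedgeList_mem {r : ℕ} (l : List (Fin r → F)) :
    wedgeList l (unitVec F) ∈ degreeSubmodule F r l.length := by
  induction l using List.reverseRecOn with
  | nil => exact unitVec_mem r
  | append_singleton l a ih =>
    rw [wedgeList_append, List.length_append]
    exact wedge_mem a ih

/-- Masks below `2 ^ r` are determined by their sets of bits. This is the source of the binomial
bound, since pivots of homogeneous vectors are such masks. -/
theorem card_bitCount_le (r d : ℕ) :
    ((Finset.range (2 ^ r)).filter fun T => bitCount r T = d).card ≤ r.choose d := by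
  have h := Finset.card_powersetCard d (Finset.range r)
  rw [Finset.card_range] at h
  rw [← h]
  refine Finset.card_le_card_of_injOn (fun T => (Finset.range r).filter fun i => T.testBit i = true)
    ?_ ?_
  · intro T hT
    simp only [Finset.coe_filter, Set.mem_ofPred_eq] at hT
    simp only [Finset.mem_coe, Finset.mem_powersetCard]
    exact ⟨Finset.filter_subset _ _, hT.2⟩
  · intro T hT T' hT' e
    simp only [Finset.coe_filter, Set.mem_ofPred_eq, Finset.mem_range] at hT hT'
    refine Nat.eq_of_testBit_eq fun i => ?_
    by_cases hi : i < r
    · have := congrArg (i ∈ ·) e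
      simp only [Finset.mem_filter, Finset.mem_range, hi, true_and, eq_iff_iff] at this
      exact Bool.eq_iff_iff.2 this
    · have hp : 2 ^ r ≤ 2 ^ i := Nat.pow_le_pow_right (by norm_num) (by omega)
      rw [Nat.testBit_lt_two_pow (hT.1.trans_le hp), Nat.testBit_lt_two_pow (hT'.1.trans_le hp)]

/-! ### A recursion for single coordinates -/

/-- The part of a coordinate of a product that comes from the bits in positions `i`, …, `r - 1`. -/
def wedgeTail (r : ℕ) (a v : ℕ → F) (T i : ℕ) : F :=
  ∑ k ∈ Finset.Ico i r,
    if T.testBit k then (∏ j ∈ Finset.Ico i k, bitSign F T j) * (a k * v (T - 2 ^ k)) else 0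

theorem wedgeTail_self (r : ℕ) (a v : ℕ → F) (T : ℕ) : wedgeTail r a v T r = 0 := by
  simp [wedgeTail]

/-- As in Horner's scheme, the sign of bit `i` is common to all later terms and factors out. A
coordinate is thus computed from the top bit downward with one multiplication and one subtraction
per set bit. -/
theorem wedgeTail_of_lt {r i : ℕ} (hi : i < r) (a v : ℕ → F) (T : ℕ) : wedgeTail r a v T i =
    if T.testBit i then a i * v (T - 2 ^ i) - wedgeTail r a v T (i + 1)
    else wedgeTail r a v T (i + 1) := by
  rw [wedgeTail, Finset.sum_eq_sum_Ico_succ_bot hi]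
  have : ∑ k ∈ Finset.Ico (i + 1) r, (if T.testBit k then
      (∏ j ∈ Finset.Ico i k, bitSign F T j) * (a k * v (T - 2 ^ k)) else 0) =
      bitSign F T i * wedgeTail r a v T (i + 1) := by
    rw [wedgeTail, Finset.mul_sum]
    refine Finset.sum_congr rfl fun k hk => ?_
    rw [Finset.prod_eq_prod_Ico_succ_bot (by have := Finset.mem_Ico.1 hk; omega)]
    split_ifs <;> ring
  rw [this]
  by_cases h : T.testBit i = true
  · simp [h, bitSign]; ring
  · simp [h, bitSign]

theorem wedge_eq_wedgeTail (r : ℕ) (a v : ℕ → F) (T : ℕ) :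
    wedge F r (fun i => a i) v T = wedgeTail r a v T 0 := by
  rw [wedge_def, LinearMap.sum_apply, Finset.sum_apply, wedgeTail, ← Finset.range_eq_Ico,
    Finset.sum_range]
  refine Finset.sum_congr rfl fun i _ => ?_
  rw [LinearMap.smul_apply, Pi.smul_apply, smul_eq_mul, creation_apply, ← Finset.range_eq_Ico]
  split_ifs <;> ring

end Wedge

end RepFamilies

namespace RepFamilies

section Levels

/-! ### Representative families from exterior products -/

variable {F : Type u} [Field F] {U : Type v} {r : ℕ}

/-- A list with a repetition gives a dependent family even if the set of its entries is independent;
this is how overlaps are detected. -/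
theorem linearIndependent_get_map_iff (f : U → Fin r → F) (l : List U) :
    LinearIndependent F (l.map f).get ↔ l.Nodup ∧ LinearIndepOn F f {u | u ∈ l} := by
  have h1 : LinearIndependent F (l.map f).get ↔ LinearIndependent F (f ∘ l.get) :=
    linearIndependent_equiv' (finCongr (by simp)) (by ext i; simp)
  have h2 : {u | u ∈ l} = Set.range l.get := by simp
  rw [h1, h2]
  constructor
  · intro h
    have hi : Function.Injective l.get := h.injective.of_comp
    exact ⟨List.nodup_iff_injective_get.2 hi, (linearIndepOn_range_iff hi f).2 h⟩
  · rintro ⟨hn, h⟩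
    exact (linearIndepOn_range_iff (List.nodup_iff_injective_get.1 hn) f).1 h

/-- The exterior product of the columns of `A` with labels in the list `l`. -/
def columnProduct (A : Matrix (Fin r) U F) (l : List U) : ℕ → F :=
  wedgeList (l.map fun u => A.col u) (unitVec F)

theorem columnProduct_append (A : Matrix (Fin r) U F) (l l' : List U) :
    columnProduct A (l ++ l') = wedgeList (l'.map fun u => A.col u) (columnProduct A l) := by
  rw [columnProduct, List.map_append, wedgeList_append]; rfl

theorem linearIndependent_get_reverse_map_iff (f : U → Fin r → F) (l : List U) :
    LinearIndependent F (l.map f).reverse.get ↔ l.Nodup ∧ LinearIndepOn F f {u | u ∈ l} := by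
  rw [← List.map_reverse, linearIndependent_get_map_iff]; simp

theorem nodup_of_columnProduct_ne_zero {A : Matrix (Fin r) U F} {l : List U}
    (h : columnProduct A l ≠ 0) : l.Nodup ∧ LinearIndepOn F (fun u => A.col u) {u | u ∈ l} :=
  (linearIndependent_get_reverse_map_iff _ l).1 (linearIndependent_of_wedgeList_ne_zero h)

theorem columnProduct_top_ne_zero {A : Matrix (Fin r) U F} {l : List U} (hl : l.length = r)
    (hn : l.Nodup) (hi : LinearIndepOn F (fun u => A.col u) {u | u ∈ l}) :
    columnProduct A l (2 ^ r - 1) ≠ 0 :=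
  wedgeList_top_ne_zero (by simpa using hl) ((linearIndependent_get_reverse_map_iff _ l).2 ⟨hn, hi⟩)

/-- Multiplying by the rest of a base and taking the top coordinate is linear in the first factor. A
nonzero value at a combination forces a nonzero value at one of the vectors combined. -/
theorem exists_exchange [Finite U] {A : Matrix (Fin r) U F} {M : Matroid U}
    (hM : M.eRank = (r : ℕ∞))
    (hA : IsRepresentation A M) {x : List U} (hx : x.Nodup) {Y : Set U}
    (hd : Disjoint {u | u ∈ x} Y) (hi : M.Indep ({u | u ∈ x} ∪ Y)) {ι : Type*} {q : ι → List U}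
    {Q : Set ι}
    (hs : columnProduct A x ∈ Submodule.span F ((fun j => columnProduct A (q j)) '' Q)) :
    ∃ j ∈ Q, (q j).Nodup ∧ Disjoint {u | u ∈ q j} Y ∧ M.Indep ({u | u ∈ q j} ∪ Y) := by
  obtain ⟨B, hB, hXB⟩ := hi.exists_isBase_superset
  obtain ⟨y, hyn, hy⟩ : ∃ y : List U, y.Nodup ∧ {u | u ∈ y} = B \ {u | u ∈ x} := by
    refine ⟨(Set.toFinite (B \ {u | u ∈ x})).toFinset.toList, Finset.nodup_toList _, ?_⟩
    ext u; simp
  have hxB : {u | u ∈ x} ⊆ B := Set.subset_union_left.trans hXB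
  have hyY : Y ⊆ {u | u ∈ y} := by
    rw [hy]
    exact fun u hu => ⟨hXB (Or.inr hu), fun hu' => (Set.disjoint_left.1 hd hu') hu⟩
  have hxy : {u | u ∈ x ++ y} = B := by
    have : {u | u ∈ x ++ y} = {u | u ∈ x} ∪ {u | u ∈ y} := by ext; simp
    rw [this, hy, Set.union_sdiff_cancel hxB]
  have hn : (x ++ y).Nodup := by
    refine List.nodup_append.2 ⟨hx, hyn, fun a ha b hb hab => ?_⟩
    subst hab
    have : a ∈ {u | u ∈ y} := hb
    rw [hy] at this
    exact this.2 ha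
  have hlen : (x ++ y).length = r := by
    have h1 := hB.encard_eq_eRank
    classical
    have h2 : {u | u ∈ x ++ y} = ((x ++ y).toFinset : Set U) := by ext; simp
    rw [hM, ← hxy, h2, Set.encard_coe_eq_coe_finsetCard, List.toFinset_card_of_nodup hn] at h1
    exact_mod_cast h1
  have htop := columnProduct_top_ne_zero (A := A) hlen hn
    ((hA.indep_iff _).1 (by rw [hxy]; exact hB.indep))
  set φ : (ℕ → F) →ₗ[F] F := (LinearMap.proj (2 ^ r - 1) : (ℕ → F) →ₗ[F] F) ∘ₗ
    wedgeHom F r ((((y.map fun u => A.col u)).reverse.map (ExteriorAlgebra.ι F)).prod) with hφ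
  have hφx : ∀ z : List U, φ (columnProduct A z) = columnProduct A (z ++ y) (2 ^ r - 1) := by
    intro z; rw [columnProduct_append, wedgeList_eq]; rfl
  by_contra hcon
  push Not at hcon
  -- If no index had the required properties, the functional would vanish on all spanning vectors: a
  -- nonzero value makes `q j ++ y` a list of distinct independent labels, and `y` contains `Y`.
  have hker : Submodule.span F ((fun j => columnProduct A (q j)) '' Q) ≤ LinearMap.ker φ := by
    rw [Submodule.span_le]
    rintro _ ⟨j, hj, rfl⟩
    simp only [SetLike.mem_coe, LinearMap.mem_ker]
    by_contra hne
    rw [hφx] at hne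
    have hne' : columnProduct A (q j ++ y) ≠ 0 := fun h => hne (by rw [h]; rfl)
    obtain ⟨h1, h2⟩ := nodup_of_columnProduct_ne_zero hne'
    rw [List.nodup_append] at h1
    refine hcon j hj h1.1 (Set.disjoint_left.2 fun u hu hu' => h1.2.2 u hu u (hyY hu') rfl) ?_
    refine ((hA.indep_iff _).2 h2).subset ?_
    rintro u (hu | hu)
    · simp only [Set.mem_ofPred_eq] at hu ⊢; simp [hu]
    · have := hyY hu
      simp only [Set.mem_ofPred_eq] at this ⊢; simp [this]
  have := hker hs
  rw [LinearMap.mem_ker, hφx] at this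
  exact htop this

/-! ### The induction over the number of sets -/

/-- The state after `i` rounds: the lists `x j` represent the disjoint unions of `i` sets with
respect to the lower bounds `ω j` for their weights. -/
structure IsLevel (A : Matrix (Fin r) U F) (M : Matroid U) (ℋ : Set (Set U)) (w : Set U → ℝ)
    (γ i : ℕ) {k : ℕ} (x : Fin k → List U) (ω : Fin k → ℝ) : Prop where
  length : ∀ j, (x j).length = i * γ
  linearIndependent : LinearIndependent F fun j => columnProduct A (x j)
  mem : ∀ j, {u | u ∈ x j} ∈ independentUnions M i ℋ
  le : ∀ j, ω j ≤ w {u | u ∈ x j}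
  card : k ≤ r.choose (i * γ)
  rep : ∀ X ∈ independentUnions M i ℋ, ∀ Y, Disjoint X Y → M.Indep (X ∪ Y) →
    ∃ j, Disjoint {u | u ∈ x j} Y ∧ M.Indep ({u | u ∈ x j} ∪ Y) ∧ w X ≤ ω j

theorem mem_independentUnions_zero {M : Matroid U} {ℋ : Set (Set U)} {X : Set U} :
    X ∈ independentUnions M 0 ℋ ↔ X = ∅ := by
  constructor
  · rintro ⟨-, H, -, -, rfl⟩; simp
  · rintro rfl
    exact ⟨M.empty_indep, fun j => j.elim0, fun j => j.elim0, fun j => j.elim0, by simp⟩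

theorem IsLevel.zero (A : Matrix (Fin r) U F) (M : Matroid U) (ℋ : Set (Set U)) (w : Set U → ℝ)
    (γ : ℕ) : IsLevel A M ℋ w γ 0 (fun _ : Fin 1 => []) fun _ => w ∅ where
  length _ := by simp
  linearIndependent := by
    refine linearIndependent_unique_iff.2 fun h => ?_
    have := congrFun h 0
    simp [columnProduct, wedgeList, unitVec] at this
  mem _ := by rw [mem_independentUnions_zero]; simp
  le _ := by simp
  card := by simp
  rep X hX Y _ hi := by
    rw [mem_independentUnions_zero] at hX
    subst hX
    exact ⟨0, by simp, by simpa using hi, le_rfl⟩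

theorem IsDisjointUnion.snoc {i : ℕ} {K : Fin i → Set U} {X H : Set U} (h : IsDisjointUnion K X)
    (hd : Disjoint X H) : IsDisjointUnion (Fin.snoc (α := fun _ => Set U) K H) (X ∪ H) := by
  obtain ⟨h1, rfl⟩ := h
  have hK : ∀ j, Disjoint (K j) H := fun j => hd.mono_left (Set.subset_iUnion K j)
  constructor
  · intro j k hjk
    induction j using Fin.lastCases with
    | last =>
      induction k using Fin.lastCases with
      | last => exact absurd rfl hjk
      | cast k => simpa using (hK k).symm
    | cast j =>
      induction k using Fin.lastCases with
      | last => simpa using hK j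
      | cast k => simpa using h1 (fun e => hjk (by rw [e]))
  · ext u
    simp only [Set.mem_union, Set.mem_iUnion]
    constructor
    · rintro (⟨j, hj⟩ | hu)
      · exact ⟨j.castSucc, by simpa using hj⟩
      · exact ⟨Fin.last i, by simpa using hu⟩
    · rintro ⟨j, hj⟩
      induction j using Fin.lastCases with
      | last => right; simpa using hj
      | cast j => left; exact ⟨j, by simpa using hj⟩

theorem snoc_mem {ℋ : Set (Set U)} {i : ℕ} {K : Fin i → Set U} {H : Set U}
    (hK : ∀ j, K j ∈ ℋ) (hH : H ∈ ℋ) (j : Fin (i + 1)) :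
    (Fin.snoc (α := fun _ => Set U) K H) j ∈ ℋ := by
  induction j using Fin.lastCases with
  | last => simpa using hH
  | cast j => simpa using hK j

theorem IsDisjointUnion.ncard [Finite U] {ℋ : Set (Set U)} {γ i : ℕ} (hℋ : IsUniformFamily γ ℋ)
    {K : Fin i → Set U} (hK : ∀ j, K j ∈ ℋ) {X : Set U} (h : IsDisjointUnion K X) :
    X.ncard = i * γ := by
  obtain ⟨h1, rfl⟩ := h
  have hf : ∀ j, (K j).Finite := fun j => Set.toFinite _
  rw [Set.ncard_iUnion_of_finite hf h1, finsum_eq_sum_of_fintype,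
    Finset.sum_congr rfl fun j _ => hℋ _ (hK j)]
  simp

/-- The best splitting of a new set consists of an old set, which has a representative with a good
lower bound, and a member of the family. Monotonicity of `g` passes the bound to the candidate, and
`exists_exchange` passes it to a basis member. That basis members are admissible at all follows from
their products being nonzero. -/
theorem IsLevel.succ [Finite U] {A : Matrix (Fin r) U F} {M : Matroid U}
    (hM : M.eRank = (r : ℕ∞)) (hA : IsRepresentation A M) {t : ℕ} {H : Fin t → Set U} {γ i : ℕ}
    (hγ : 0 < γ) (hH : IsUniformFamily γ (Set.range H)) {w : Set U → ℝ} {g : ℝ → Set U → ℝ}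
    (hw : IsInductiveUnionMaximizing (Set.range H) w g) {k : ℕ} {x : Fin k → List U}
    {ω : Fin k → ℝ} (hl : IsLevel A M (Set.range H) w γ i x ω)
    {e : Fin t → List U} (he : ∀ h, {u | u ∈ e h} = H h) (hel : ∀ h, (e h).length = γ)
    {k' : ℕ} {x' : Fin k' → List U} {ω' : Fin k' → ℝ}
    (hsub : ∀ j', ∃ j h, x' j' = x j ++ e h ∧ ω' j' = g (ω j) (H h))
    (hind : LinearIndependent F fun j => columnProduct A (x' j))
    (hcard : k' ≤ r.choose ((i + 1) * γ))
    (hspan : ∀ j h, columnProduct A (x j ++ e h) ∈ Submodule.span F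
      ((fun j' => columnProduct A (x' j')) '' {j' | g (ω j) (H h) ≤ ω' j'})) :
    IsLevel A M (Set.range H) w γ (i + 1) x' ω' := by
  have hset : ∀ j h, {u | u ∈ x j ++ e h} = {u | u ∈ x j} ∪ H h := by
    intro j h; rw [← he h]; ext u; simp
  -- The list `e h` has `γ` entries and enumerates a set of `γ` elements.
  have hen : ∀ h, (e h).Nodup := by
    intro h
    classical
    have h1 : (H h).ncard = γ := hH _ ⟨h, rfl⟩
    have h2 : {u | u ∈ e h} = ((e h).toFinset : Set U) := by ext; simp
    rw [← he h, h2, Set.ncard_coe_finset] at h1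
    rw [← hel h] at h1
    exact List.dedup_eq_self.1 ((List.dedup_sublist _).eq_of_length h1)
  have hnew : ∀ j h, (x j ++ e h).Nodup → M.Indep {u | u ∈ x j ++ e h} →
      {u | u ∈ x j ++ e h} ∈ independentUnions M (i + 1) (Set.range H) ∧
      g (ω j) (H h) ≤ w {u | u ∈ x j ++ e h} := by
    intro j h hn hi
    obtain ⟨-, K, hK, hKX⟩ := hl.mem j
    have hd : Disjoint {u | u ∈ x j} (H h) := by
      rw [← he h]
      exact Set.disjoint_left.2 fun u hu hu' => (List.nodup_append.1 hn).2.2 u hu u hu' rfl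
    have hmem := snoc_mem hK (⟨h, rfl⟩ : H h ∈ Set.range H)
    have hdu := hKX.snoc hd
    refine ⟨⟨hi, _, hmem, by rw [hset]; exact hdu⟩, ?_⟩
    -- The recursion for `w` is available for nonempty sets only, which is where `0 < γ` enters.
    have hne : {u | u ∈ x j} ∪ H h ≠ ∅ := by
      intro h0
      have h1 := hdu.ncard hH hmem
      rw [h0, Set.ncard_empty] at h1
      have : 0 < (i + 1) * γ := Nat.mul_pos (Nat.succ_pos i) hγ
      omega
    rw [hset]
    refine (hw.monotone_left _ ⟨h, rfl⟩ (hl.le j)).trans ((hw.isGreatest _ ⟨_, _, hmem, hdu⟩ hne).2 ?_)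
    exact ⟨H h, ⟨h, rfl⟩, _, ⟨i, K, hK, hKX⟩, hd, rfl, rfl⟩
  have hgood : ∀ j', {u | u ∈ x' j'} ∈ independentUnions M (i + 1) (Set.range H) ∧
      ω' j' ≤ w {u | u ∈ x' j'} := by
    intro j'
    obtain ⟨j, h, h1, h2⟩ := hsub j'
    obtain ⟨h3, h4⟩ := nodup_of_columnProduct_ne_zero (hind.ne_zero j')
    rw [h1] at h3 h4 ⊢
    rw [h2]
    exact hnew j h h3 ((hA.indep_iff _).2 h4)
  refine ⟨fun j' => ?_, hind, fun j' => (hgood j').1, fun j' => (hgood j').2, hcard, ?_⟩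
  · obtain ⟨j, h, h1, -⟩ := hsub j'
    rw [h1, List.length_append, hl.length, hel]; ring
  · rintro X ⟨hXi, K, hK, hKX⟩ Y hd hi
    have hXc := hKX.ncard hH hK
    have hne : X ≠ ∅ := by
      rintro rfl
      have : 0 < (i + 1) * γ := Nat.mul_pos (Nat.succ_pos i) hγ
      rw [Set.ncard_empty] at hXc; omega
    obtain ⟨⟨_, ⟨h, rfl⟩, S, ⟨m, K', hK', hS⟩, hSd, rfl, hwX⟩, -⟩ :=
      hw.isGreatest X ⟨_, K, hK, hKX⟩ hne
    -- The optimal `S` is a union of an unspecified number of members; counting elements shows that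
    -- the number is `i`.
    have hm : m = i := by
      rw [Set.ncard_union_eq hSd, hS.ncard hH hK', hH _ ⟨h, rfl⟩] at hXc
      have : (m + 1) * γ = (i + 1) * γ := by rw [← hXc]; ring
      have := Nat.eq_of_mul_eq_mul_right hγ this
      omega
    subst hm
    -- Adding `H h` to the set to be avoided keeps the replacement of `S` disjoint from the member
    -- that is appended to it.
    obtain ⟨j, h1, h2, h3⟩ := hl.rep S ⟨hXi.subset Set.subset_union_left, K', hK', hS⟩ (H h ∪ Y)
      (Set.disjoint_union_right.2 ⟨hSd, hd.mono_left Set.subset_union_left⟩)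
      (by rwa [← Set.union_assoc])
    rw [Set.disjoint_union_right] at h1
    rw [← Set.union_assoc, ← hset] at h2
    have hYd : Disjoint {u | u ∈ x j ++ e h} Y := by
      rw [hset]
      exact Set.disjoint_union_left.2 ⟨h1.2, hd.mono_left Set.subset_union_right⟩
    have hn : (x j ++ e h).Nodup := by
      refine List.nodup_append.2 ⟨(nodup_of_columnProduct_ne_zero (hl.linearIndependent.ne_zero j)).1,
        hen h, fun a ha b hb hab => ?_⟩
      subst hab
      refine Set.disjoint_left.1 h1.1 ha ?_
      rw [← he h]; exact hb
    obtain ⟨j', hj', -, h5, h6⟩ := exists_exchange hM hA hn hYd h2 (hspan j h)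
    exact ⟨j', h5, h6, hwX.trans_le ((hw.monotone_left _ ⟨h, rfl⟩ h3).trans hj')⟩

/-- Polarization of `wedge_mul_self`. -/
theorem wedge_mul_comm (a b : Fin r → F) : wedge F r a * wedge F r b = -(wedge F r b * wedge F r a) := by
  have h := wedge_mul_self (a + b)
  rw [map_add, mul_add, add_mul, add_mul, wedge_mul_self, wedge_mul_self] at h
  rw [eq_neg_iff_add_eq_zero, ← h]; abel

theorem exists_wedgeList_eq_smul_of_perm {l l' : List (Fin r → F)} (h : l.Perm l') (v : ℕ → F) :
    ∃ c : F, wedgeList l v = c • wedgeList l' v := by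
  induction h generalizing v with
  | nil => exact ⟨1, by simp⟩
  | cons a _ ih => exact ih (wedge F r a v)
  | swap a b l =>
    refine ⟨-1, ?_⟩
    have h : wedge F r a (wedge F r b v) = -(wedge F r b (wedge F r a v)) := by
      have := congrArg (fun f : Module.End F (ℕ → F) => f v) (wedge_mul_comm a b)
      simpa using this
    change wedgeList l (wedge F r a (wedge F r b v)) =
      (-1 : F) • wedgeList l (wedge F r b (wedge F r a v))
    rw [h, wedgeList_eq, wedgeList_eq, map_neg, neg_one_smul]
  | trans _ _ ih1 ih2 =>
    obtain ⟨c, hc⟩ := ih1 v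
    obtain ⟨d, hd⟩ := ih2 v
    exact ⟨c * d, by rw [hc, hd, mul_smul]⟩

/-- Two lists of the same set are permutations of each other, so their products would be
proportional, against linear independence. -/
theorem IsLevel.injective {A : Matrix (Fin r) U F} {M : Matroid U} {ℋ : Set (Set U)}
    {w : Set U → ℝ} {γ i k : ℕ} {x : Fin k → List U} {ω : Fin k → ℝ}
    (hl : IsLevel A M ℋ w γ i x ω) : Function.Injective fun j => {u | u ∈ x j} := by
  intro j j' he
  by_contra hne
  have hn := fun j => (nodup_of_columnProduct_ne_zero (hl.linearIndependent.ne_zero j)).1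
  have hp : (x j).Perm (x j') := (List.perm_ext_iff_of_nodup (hn j) (hn j')).2 fun a => by
    have := congrArg (a ∈ ·) he
    simpa using this
  obtain ⟨c, hc⟩ := exists_wedgeList_eq_smul_of_perm (hp.map fun u => A.col u) (unitVec F)
  refine hl.linearIndependent.notMem_span_image (s := {j'}) (x := j) (by simpa using hne) ?_
  rw [Set.image_singleton, Submodule.mem_span_singleton]
  exact ⟨c, hc.symm⟩

theorem IsLevel.isMaxRepresentative {A : Matrix (Fin r) U F} {M : Matroid U} {ℋ : Set (Set U)}
    {w : Set U → ℝ} {γ i k q : ℕ} {x : Fin k → List U} {ω : Fin k → ℝ}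
    (hl : IsLevel A M ℋ w γ i x ω) :
    IsMaxRepresentative M q (independentUnions M i ℋ) w (Set.range fun j => {u | u ∈ x j}) where
  subset := by rintro _ ⟨j, rfl⟩; exact hl.mem j
  exists_ge Y _ X hX hd hi := by
    obtain ⟨j, h1, h2, h3⟩ := hl.rep X hX Y hd hi
    exact ⟨_, ⟨j, rfl⟩, h1, h2, h3.trans (hl.le j)⟩

end Levels

end RepFamilies

namespace RepFamilies

section Exchange

/-! ### Weighted bases with pivots -/

variable {F : Type u} [Field F] {V : Type*} [AddCommGroup V] [Module F V] {ι : Type*}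

/-- The vectors `cur q`, `q ∈ L`, arise from the vectors `orig q` by adding combinations of better
ones, and each `orig c` with `c ∈ C` is spanned by those with indices in `L` that are at least as
good. -/
structure IsWeightedBasis (F : Type u) [Field F] {V : Type*} [AddCommGroup V] [Module F V]
    {ι : Type*} (better : ι → ι → Prop) (orig cur : ι → V) (L C : Set ι) : Prop where
  sub : L ⊆ C
  tri : ∀ q ∈ L, cur q - orig q ∈ Submodule.span F (orig '' {q' | q' ∈ L ∧ better q' q})
  rep : ∀ c ∈ C, orig c ∈ Submodule.span F (orig '' {q | q ∈ L ∧ (q = c ∨ better q c)})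

namespace IsWeightedBasis

variable {better : ι → ι → Prop} {orig cur orig' cur' : ι → V} {L C : Set ι}

/-- Only the order and the original vectors on `C`, and the current vectors on `L`, matter. Memory
cells of discarded rows may thus be changed freely. -/
theorem congr (h : IsWeightedBasis F better orig cur L C) {better' : ι → ι → Prop}
    (hb : ∀ p ∈ C, ∀ q ∈ C, (better' p q ↔ better p q)) (ho : ∀ c ∈ C, orig' c = orig c)
    (hc : ∀ q ∈ L, cur' q = cur q) : IsWeightedBasis F better' orig' cur' L C where
  sub := h.sub
  tri q hq := by
    have e : orig' '' {q' | q' ∈ L ∧ better' q' q} = orig '' {q' | q' ∈ L ∧ better q' q} := by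
      have : {q' | q' ∈ L ∧ better' q' q} = {q' | q' ∈ L ∧ better q' q} := by
        ext q'; exact and_congr_right fun hq' => hb _ (h.sub hq') _ (h.sub hq)
      rw [this]
      exact Set.image_congr fun q' hq' => ho _ (h.sub hq'.1)
    rw [e, ho q (h.sub hq), hc q hq]
    exact h.tri q hq
  rep c hcC := by
    have e : orig' '' {q | q ∈ L ∧ (q = c ∨ better' q c)} =
        orig '' {q | q ∈ L ∧ (q = c ∨ better q c)} := by
      have : {q | q ∈ L ∧ (q = c ∨ better' q c)} = {q | q ∈ L ∧ (q = c ∨ better q c)} := by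
        ext q'; exact and_congr_right fun hq' => or_congr_right (hb _ (h.sub hq') _ hcC)
      rw [this]
      exact Set.image_congr fun q' hq' => ho _ (h.sub hq'.1)
    rw [e, ho c hcC]
    exact h.rep c hcC

theorem empty : IsWeightedBasis F better orig cur ∅ ∅ :=
  ⟨subset_rfl, fun _ h => h.elim, fun _ h => h.elim⟩

theorem insert (h : IsWeightedBasis F better orig cur L C) {p : ι} (hp : cur p = orig p) :
    IsWeightedBasis F better orig cur (insert p L) (insert p C) where
  sub := Set.insert_subset_insert h.sub
  tri q hq := by
    rcases hq with rfl | hq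
    · rw [hp, sub_self]; exact Submodule.zero_mem _
    · refine Submodule.span_mono (Set.image_mono ?_) (h.tri q hq)
      exact fun x hx => ⟨Or.inr hx.1, hx.2⟩
  rep c hc := by
    rcases hc with rfl | hc
    · exact Submodule.subset_span ⟨c, ⟨Or.inl rfl, Or.inl rfl⟩, rfl⟩
    · refine Submodule.span_mono (Set.image_mono ?_) (h.rep c hc)
      exact fun x hx => ⟨Or.inr hx.1, hx.2⟩

theorem span_le_of_better (htr : ∀ a b c, better a b → better b c → better a c) {p q : ι}
    (hb : better q p) : Submodule.span F (orig '' {x | x ∈ L ∧ better x q}) ≤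
      Submodule.span F (orig '' {x | x ∈ L ∧ better x p}) := by
  refine Submodule.span_mono (Set.image_mono ?_)
  rintro y ⟨hy, hyb⟩
  exact ⟨hy, htr _ _ _ hyb hb⟩

/-- The subtracted row is its original plus originals better still, hence by transitivity a
combination of originals better than `p`. The originals, and so the field `rep`, are not affected.
-/
theorem reduce [DecidableEq ι] (h : IsWeightedBasis F better orig cur L C)
    (htr : ∀ a b c, better a b → better b c → better a c) {p q : ι} (hq : q ∈ L)
    (hb : better q p) (a : F) :
    IsWeightedBasis F better orig (Function.update cur p (cur p - a • cur q)) L C where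
  sub := h.sub
  tri x hx := by
    by_cases hxp : x = p
    · subst hxp
      rw [Function.update_self]
      have h1 := h.tri x hx
      have h2 := h.tri q hq
      have h3 : orig q ∈ Submodule.span F (orig '' {q' | q' ∈ L ∧ better q' x}) :=
        Submodule.subset_span ⟨q, ⟨hq, hb⟩, rfl⟩
      have h4 : cur q - orig q ∈ Submodule.span F (orig '' {q' | q' ∈ L ∧ better q' x}) :=
        span_le_of_better htr hb h2
      have h5 := Submodule.sub_mem _ h1 (Submodule.smul_mem _ a (Submodule.add_mem _ h3 h4))
      convert h5 using 1
      rw [add_sub_cancel]; abel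
    · rw [Function.update_of_ne hxp]; exact h.tri x hx
  rep := h.rep

/-- Once `cur p` is zero, `tri` expresses `orig p` by strictly better live originals; irreflexivity
excludes `orig p` itself from that combination. Substituting it removes `p` from every other
relation, and transitivity preserves the comparisons. -/
theorem drop (htr : ∀ a b c, better a b → better b c → better a c) (hirr : ∀ a, ¬ better a a)
    {p : ι} (hpL : p ∉ L) (h : IsWeightedBasis F better orig cur (Insert.insert p L) C)
    (h0 : cur p = 0) : IsWeightedBasis F better orig cur L C := by
  have hp : orig p ∈ Submodule.span F (orig '' {q | q ∈ L ∧ better q p}) := by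
    have h1 := h.tri p (Or.inl rfl)
    rw [h0, zero_sub, Submodule.neg_mem_iff] at h1
    refine Submodule.span_mono (Set.image_mono ?_) h1
    rintro x ⟨rfl | hx, hb⟩
    · exact absurd hb (hirr _)
    · exact ⟨hx, hb⟩
  have key : ∀ c, Submodule.span F (orig '' {q | q ∈ Insert.insert p L ∧ better q c}) ≤
      Submodule.span F (orig '' {q | q ∈ L ∧ better q c}) := by
    intro c
    rw [Submodule.span_le]
    rintro _ ⟨x, ⟨rfl | hx, hb⟩, rfl⟩
    · exact span_le_of_better htr hb hp
    · exact Submodule.subset_span ⟨x, ⟨hx, hb⟩, rfl⟩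
  refine ⟨(Set.subset_insert _ _).trans h.sub, fun q hq => key q (h.tri q (Or.inr hq)), ?_⟩
  intro c hc
  have h1 := h.rep c hc
  refine (Submodule.span_le.2 ?_) h1
  rintro _ ⟨x, ⟨rfl | hx, hb⟩, rfl⟩
  · refine Submodule.span_mono (Set.image_mono ?_) hp
    rintro y ⟨hy, hyb⟩
    rcases hb with rfl | hb
    · exact ⟨hy, Or.inr hyb⟩
    · exact ⟨hy, Or.inr (htr _ _ _ hyb hb)⟩
  · exact Submodule.subset_span ⟨x, ⟨hx, hb⟩, rfl⟩

/-- By `tri`, the current vectors lie in the span of equally many originals. Comparing dimensions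
transfers independence without inverting the triangular relation. -/
theorem linearIndependent (h : IsWeightedBasis F better orig cur L C) {k : ℕ} {e : Fin k → ι}
    (he : Set.range e = L) (hi : LinearIndependent F fun j => cur (e j)) :
    LinearIndependent F fun j => orig (e j) := by
  rw [linearIndependent_iff_card_eq_finrank_span] at hi ⊢
  have hle : Submodule.span F (Set.range fun j => cur (e j)) ≤
      Submodule.span F (Set.range fun j => orig (e j)) := by
    rw [Submodule.span_le]
    rintro _ ⟨j, rfl⟩
    have hj : e j ∈ L := he ▸ ⟨j, rfl⟩
    have h1 : cur (e j) - orig (e j) ∈ Submodule.span F (Set.range fun j => orig (e j)) := by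
      refine Submodule.span_mono ?_ (h.tri _ hj)
      rintro _ ⟨q, ⟨hq, -⟩, rfl⟩
      rw [← he] at hq
      obtain ⟨i, rfl⟩ := hq
      exact ⟨i, rfl⟩
    have h2 : orig (e j) ∈ Submodule.span F (Set.range fun j => orig (e j)) :=
      Submodule.subset_span ⟨j, rfl⟩
    simpa using Submodule.add_mem _ h1 h2
  have : FiniteDimensional F (Submodule.span F (Set.range fun j => orig (e j))) :=
    FiniteDimensional.span_of_finite F (Set.finite_range _)
  refine le_antisymm ?_ (finrank_range_le_card _)
  rw [hi]
  exact Submodule.finrank_mono hle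

end IsWeightedBasis

/-! ### Pivot tables -/

/-- The nonzero entries of the table `slot`. -/
def live (K : ℕ) (slot : ℕ → ℕ) : Set ℕ := {q | q ≠ 0 ∧ ∃ T < K, slot T = q}

/-- The entry `T` of `slot`, if nonzero, is the index of a vector with pivot `T`. -/
def IsEchelon (K : ℕ) (slot : ℕ → ℕ) (cur : ℕ → ℕ → F) : Prop :=
  ∀ T < K, slot T ≠ 0 → cur (slot T) T ≠ 0 ∧ ∀ x < T, cur (slot T) x = 0

theorem IsEchelon.injective {K : ℕ} {slot : ℕ → ℕ} {cur : ℕ → ℕ → F} (h : IsEchelon K slot cur)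
    {T T' : ℕ} (hT : T < K) (hT' : T' < K) (h0 : slot T ≠ 0) (he : slot T = slot T') : T = T' := by
  have h1 := h T hT h0
  have h2 := h T' hT' (he ▸ h0)
  rcases lt_trichotomy T T' with hlt | rfl | hlt
  · exact absurd (he ▸ h2.2 T hlt) h1.1
  · rfl
  · exact absurd (he ▸ h1.2 T' hlt) h2.1

/-- The table of pivots describes a weighted basis. -/
structure IsPivotTable (K : ℕ) (better : ℕ → ℕ → Prop) (D : Submodule F (ℕ → F))
    (orig cur : ℕ → ℕ → F) (C : Set ℕ) (slot : ℕ → ℕ) : Prop where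
  basis : IsWeightedBasis F better orig cur (live K slot) C
  echelon : IsEchelon K slot cur
  mem : ∀ q ∈ live K slot, cur q ∈ D

/-- The table of pivots, together with the index `c`, describes a weighted basis, and the vector
with index `c` vanishes below `T`. -/
structure IsCarrying (K : ℕ) (better : ℕ → ℕ → Prop) (D : Submodule F (ℕ → F))
    (orig cur : ℕ → ℕ → F) (C : Set ℕ) (slot : ℕ → ℕ) (c T : ℕ) : Prop where
  ne_zero : c ≠ 0
  notMem : c ∉ live K slot
  basis : IsWeightedBasis F better orig cur (insert c (live K slot)) C
  echelon : IsEchelon K slot cur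
  mem : ∀ q ∈ insert c (live K slot), cur q ∈ D
  low : ∀ x < T, cur c x = 0

namespace IsCarrying

variable {K : ℕ} {better : ℕ → ℕ → Prop} {D : Submodule F (ℕ → F)} {orig cur : ℕ → ℕ → F}
  {C : Set ℕ} {slot : ℕ → ℕ} {c T : ℕ}

theorem skip (h : IsCarrying K better D orig cur C slot c T) (h0 : cur c T = 0) :
    IsCarrying K better D orig cur C slot c (T + 1) :=
  ⟨h.ne_zero, h.notMem, h.basis, h.echelon, h.mem, fun x hx => by
    rcases Nat.lt_succ_iff_lt_or_eq.1 hx with hx | rfl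
    · exact h.low x hx
    · exact h0⟩

theorem congr (h : IsCarrying K better D orig cur C slot c T) {cur' : ℕ → ℕ → F}
    (hc : ∀ q ∈ insert c (live K slot), cur' q = cur q) :
    IsCarrying K better D orig cur' C slot c T := by
  refine ⟨h.ne_zero, h.notMem, h.basis.congr (fun _ _ _ _ => Iff.rfl) (fun _ _ => rfl) hc, ?_, ?_, ?_⟩
  · intro T' hT' hne
    rw [hc _ (Or.inr ⟨hne, T', hT', rfl⟩)]
    exact h.echelon T' hT' hne
  · intro q hq
    rw [hc q hq]; exact h.mem q hq
  · rw [hc c (Or.inl rfl)]; exact h.low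

theorem isEchelon_update (h : IsCarrying K better D orig cur C slot c T) (h0 : cur c T ≠ 0) :
    IsEchelon K (Function.update slot T c) cur := by
  intro T' hT' hne
  by_cases e : T' = T
  · subst e
    rw [Function.update_self]; exact ⟨h0, h.low⟩
  · rw [Function.update_of_ne e] at hne ⊢
    exact h.echelon T' hT' hne

/-- The carried row and the stored one exchange roles. Both vanish below `T`, and the set formed by
the live rows and the carried one stays the same. -/
theorem swap (h : IsCarrying K better D orig cur C slot c T) (hT : T < K) (h0 : cur c T ≠ 0)
    (hs : slot T ≠ 0) :
    IsCarrying K better D orig cur C (Function.update slot T c) (slot T) T := by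
  have hcs : slot T ≠ c := fun e => h.notMem ⟨e ▸ hs, T, hT, e⟩
  have hnot : slot T ∉ live K (Function.update slot T c) := by
    rintro ⟨-, T', hT', e⟩
    by_cases hTT : T' = T
    · subst hTT; rw [Function.update_self] at e; exact hcs e.symm
    · rw [Function.update_of_ne hTT] at e
      exact hTT (h.echelon.injective hT' hT (e ▸ hs) e)
  have hset : insert (slot T) (live K (Function.update slot T c)) = insert c (live K slot) := by
    ext q
    constructor
    · rintro (rfl | ⟨hq, T', hT', rfl⟩)
      · exact Or.inr ⟨hs, T, hT, rfl⟩
      · by_cases hTT : T' = T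
        · subst hTT; rw [Function.update_self]; exact Or.inl rfl
        · rw [Function.update_of_ne hTT] at hq ⊢; exact Or.inr ⟨hq, T', hT', rfl⟩
    · rintro (rfl | ⟨hq, T', hT', rfl⟩)
      · exact Or.inr ⟨h.ne_zero, T, hT, Function.update_self ..⟩
      · by_cases hTT : T' = T
        · subst hTT; exact Or.inl rfl
        · exact Or.inr ⟨hq, T', hT', Function.update_of_ne hTT _ _⟩
  exact ⟨hs, hnot, hset ▸ h.basis, h.isEchelon_update h0, hset ▸ h.mem, (h.echelon T hT hs).2⟩

/-- Both vectors vanish below `T`, and the scalar is chosen to cancel the coordinate `T`, so the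
zone of zeros grows by one. -/
theorem reduce (h : IsCarrying K better D orig cur C slot c T)
    (htr : ∀ a b c, better a b → better b c → better a c) (hT : T < K)
    (hs : slot T ≠ 0) (hb : better (slot T) c) :
    IsCarrying K better D orig
      (Function.update cur c (cur c - (cur c T / cur (slot T) T) • cur (slot T))) C slot c
      (T + 1) := by
  have hsl : slot T ∈ insert c (live K slot) := Or.inr ⟨hs, T, hT, rfl⟩
  refine ⟨h.ne_zero, h.notMem, h.basis.reduce htr hsl hb _, ?_, ?_, ?_⟩
  · intro T' hT' hne
    have : slot T' ≠ c := fun e => h.notMem ⟨h.ne_zero, T', hT', e⟩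
    rw [Function.update_of_ne this]
    exact h.echelon T' hT' hne
  · intro q hq
    by_cases e : q = c
    · subst e
      rw [Function.update_self]
      exact Submodule.sub_mem _ (h.mem _ hq) (Submodule.smul_mem _ _ (h.mem _ hsl))
    · rw [Function.update_of_ne e]; exact h.mem q hq
  · intro x hx
    rw [Function.update_self, Pi.sub_apply, Pi.smul_apply, smul_eq_mul]
    obtain ⟨h1, h2⟩ := h.echelon T hT hs
    rcases Nat.lt_succ_iff_lt_or_eq.1 hx with hx | rfl
    · rw [h.low x hx, h2 x hx]; simp
    · rw [div_mul_cancel₀ _ h1, sub_self]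

theorem place (h : IsCarrying K better D orig cur C slot c T) (hT : T < K) (h0 : cur c T ≠ 0)
    (hs : slot T = 0) :
    IsPivotTable K better D orig cur C (Function.update slot T c) := by
  have hset : live K (Function.update slot T c) = insert c (live K slot) := by
    ext q
    constructor
    · rintro ⟨hq, T', hT', rfl⟩
      by_cases hTT : T' = T
      · subst hTT; rw [Function.update_self]; exact Or.inl rfl
      · rw [Function.update_of_ne hTT] at hq ⊢; exact Or.inr ⟨hq, T', hT', rfl⟩
    · rintro (rfl | ⟨hq, T', hT', rfl⟩)
      · exact ⟨h.ne_zero, T, hT, Function.update_self ..⟩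
      · by_cases hTT : T' = T
        · subst hTT; exact absurd hs hq
        · exact ⟨hq, T', hT', Function.update_of_ne hTT _ _⟩
  exact ⟨hset ▸ h.basis, h.isEchelon_update h0, hset ▸ h.mem⟩

theorem finish (h : IsCarrying K better D orig cur C slot c T)
    (htr : ∀ a b c, better a b → better b c → better a c) (hirr : ∀ a, ¬ better a a)
    (h0 : cur c = 0) : IsPivotTable K better D orig cur C slot :=
  ⟨h.basis.drop htr hirr h.notMem h0, h.echelon, fun q hq => h.mem q (Or.inr hq)⟩

end IsCarrying

namespace IsPivotTable

variable {K : ℕ} {better : ℕ → ℕ → Prop} {D : Submodule F (ℕ → F)} {orig cur : ℕ → ℕ → F}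
  {C : Set ℕ} {slot : ℕ → ℕ}

theorem congr (h : IsPivotTable K better D orig cur C slot) {better' : ℕ → ℕ → Prop}
    {orig' cur' : ℕ → ℕ → F}
    (hb : ∀ p ∈ C, ∀ q ∈ C, (better' p q ↔ better p q)) (ho : ∀ c ∈ C, orig' c = orig c)
    (hc : ∀ q ∈ live K slot, cur' q = cur q) : IsPivotTable K better' D orig' cur' C slot := by
  refine ⟨h.basis.congr hb ho hc, ?_, ?_⟩
  · intro T' hT' hne
    rw [hc _ ⟨hne, T', hT', rfl⟩]
    exact h.echelon T' hT' hne
  · intro q hq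
    rw [hc q hq]; exact h.mem q hq

theorem carry (h : IsPivotTable K better D orig cur C slot) {c : ℕ} (hc : c ≠ 0) (hcC : c ∉ C)
    (hcur : cur c = orig c) (hD : orig c ∈ D) :
    IsCarrying K better D orig cur (insert c C) slot c 0 :=
  ⟨hc, fun hl => hcC (h.basis.sub hl), h.basis.insert hcur, h.echelon, fun q hq => by
    rcases hq with rfl | hq
    · rw [hcur]; exact hD
    · exact h.mem q hq, fun x hx => absurd hx (Nat.not_lt_zero x)⟩

theorem linearIndependent (h : IsPivotTable K better D orig cur C slot) {k : ℕ} {T : Fin k → ℕ}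
    (hT : StrictMono T) (hTK : ∀ T', (∃ j, T j = T') ↔ T' < K ∧ slot T' ≠ 0) :
    LinearIndependent F fun j => orig (slot (T j)) := by
  have hj : ∀ j, T j < K ∧ slot (T j) ≠ 0 := fun j => (hTK _).1 ⟨j, rfl⟩
  refine h.basis.linearIndependent (e := fun j => slot (T j)) ?_ ?_
  · ext q
    constructor
    · rintro ⟨j, rfl⟩
      exact ⟨(hj j).2, T j, (hj j).1, rfl⟩
    · rintro ⟨hq, T', hT', rfl⟩
      obtain ⟨j, rfl⟩ := (hTK T').2 ⟨hT', hq⟩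
      exact ⟨j, rfl⟩
  · rw [Fintype.linearIndependent_iff]
    intro a ha
    by_contra hne
    push Not at hne
    -- Take the first nonzero coefficient and evaluate at its pivot: earlier coefficients are zero,
    -- and later vectors vanish there because their pivots are larger.
    obtain ⟨i, hi, hmin⟩ : ∃ i, a i ≠ 0 ∧ ∀ j < i, a j = 0 := by
      obtain ⟨i, hi⟩ := hne
      induction i using WellFoundedLT.induction with
      | ind i ih =>
        by_cases h : ∀ j < i, a j = 0
        · exact ⟨i, hi, h⟩
        · push Not at h
          obtain ⟨j, hj, hj'⟩ := h
          exact ih j hj hj'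
    have := congrFun ha (T i)
    simp only [Finset.sum_apply, Pi.smul_apply, smul_eq_mul, Pi.zero_apply] at this
    rw [Finset.sum_eq_single i] at this
    · exact (mul_ne_zero hi (h.echelon _ (hj i).1 (hj i).2).1) this
    · intro j _ hji
      rcases hji.lt_or_gt with hlt | hlt
      · rw [hmin j hlt, zero_mul]
      · rw [(h.echelon _ (hj j).1 (hj j).2).2 _ (hT hlt), mul_zero]
    · simp

/-- A pivot is a nonzero coordinate of a vector of degree `d`, so the pivots are distinct masks with
`d` bits. -/
theorem card_le {r d : ℕ} (h : IsPivotTable K better (degreeSubmodule F r d) orig cur C slot)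
    {k : ℕ} {T : Fin k → ℕ} (hT : StrictMono T)
    (hTK : ∀ j, T j < K ∧ slot (T j) ≠ 0) : k ≤ r.choose d := by
  refine le_trans ?_ (card_bitCount_le r d)
  have := Finset.card_le_card_of_injOn (s := Finset.univ)
    (t := (Finset.range (2 ^ r)).filter fun T => bitCount r T = d) T ?_ hT.injective.injOn
  · simpa using this
  · intro j _
    have := h.mem _ ⟨(hTK j).2, T j, (hTK j).1, rfl⟩ _ (h.echelon _ (hTK j).1 (hTK j).2).1
    simpa using this

end IsPivotTable

end Exchange

end RepFamilies

namespace RepFamilies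

section Execution

/-! ### Executions with bounds on the number of steps -/

variable {F : Type u}

theorem setCell_apply {V : Type*} (m : ℕ → ℕ → V) (a i : ℕ) (x : V) (b j : ℕ) :
    setCell m a i x b j = if b = a ∧ j = i then x else m b j := by
  unfold setCell
  by_cases hb : b = a
  · subst hb
    by_cases hj : j = i
    · subst hj; simp
    · simp [hj]
  · simp [hb]

theorem setCell_of_ne {V : Type*} (m : ℕ → ℕ → V) {a b : ℕ} (h : b ≠ a) (i : ℕ) (x : V) :
    setCell m a i x b = m b := by
  simp [setCell, h]

/-- The two memories agree outside of the listed arrays. -/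
structure AgreeOff (NA FA WA : List ℕ) (s s' : Memory F) : Prop where
  nat : ∀ a, a ∉ NA → s'.nat a = s.nat a
  fld : ∀ a, a ∉ FA → s'.fld a = s.fld a
  wgt : ∀ a, a ∉ WA → s'.wgt a = s.wgt a

namespace AgreeOff

variable {NA FA WA NA' FA' WA' : List ℕ} {s s' s'' : Memory F}

theorem refl (s : Memory F) : AgreeOff NA FA WA s s := ⟨by simp, by simp, by simp⟩

theorem trans (h : AgreeOff NA FA WA s s') (h' : AgreeOff NA' FA' WA' s' s'')
    (hN : NA' ⊆ NA := by decide) (hF : FA' ⊆ FA := by decide) (hW : WA' ⊆ WA := by decide) :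
    AgreeOff NA FA WA s s'' :=
  ⟨fun a ha => (h'.nat a fun h => ha (hN h)).trans (h.nat a ha),
    fun a ha => (h'.fld a fun h => ha (hF h)).trans (h.fld a ha),
    fun a ha => (h'.wgt a fun h => ha (hW h)).trans (h.wgt a ha)⟩

theorem setNat (h : AgreeOff NA FA WA s s') {a i x : ℕ} (ha : a ∈ NA := by decide) :
    AgreeOff NA FA WA s ⟨setCell s'.nat a i x, s'.fld, s'.wgt⟩ :=
  ⟨fun b hb => (setCell_of_ne _ (fun e : b = a => hb (e ▸ ha)) _ _).trans (h.nat b hb), h.fld, h.wgt⟩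

theorem setFld (h : AgreeOff NA FA WA s s') {a i : ℕ} {x : F} (ha : a ∈ FA := by decide) :
    AgreeOff NA FA WA s ⟨s'.nat, setCell s'.fld a i x, s'.wgt⟩ :=
  ⟨h.nat, fun b hb => (setCell_of_ne _ (fun e : b = a => hb (e ▸ ha)) _ _).trans (h.fld b hb), h.wgt⟩

theorem setWgt (h : AgreeOff NA FA WA s s') {a i : ℕ} {x : ℝ} (ha : a ∈ WA := by decide) :
    AgreeOff NA FA WA s ⟨s'.nat, s'.fld, setCell s'.wgt a i x⟩ :=
  ⟨h.nat, h.fld, fun b hb => (setCell_of_ne _ (fun e : b = a => hb (e ▸ ha)) _ _).trans (h.wgt b hb)⟩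

theorem n (h : AgreeOff NA FA WA s s') (a : ℕ) (ha : a ∉ NA := by decide) :
    s'.nat a = s.nat a := h.nat a ha

theorem f (h : AgreeOff NA FA WA s s') (a : ℕ) (ha : a ∉ FA := by decide) :
    s'.fld a = s.fld a := h.fld a ha

theorem w (h : AgreeOff NA FA WA s s') (a : ℕ) (ha : a ∉ WA := by decide) :
    s'.wgt a = s.wgt a := h.wgt a ha

end AgreeOff

variable [Field F]

/-! ### Rules for halting with a step bound -/

/-- The program halts after at most `B` steps, in a memory that satisfies `Q`. -/
def HaltsIn (G : ℝ → ℕ → ℝ) (p : Program) (s : Memory F) (B : ℕ) (Q : Memory F → Prop) : Prop :=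
  ∃ s' T N, Runs G p s s' T N ∧ T ≤ B ∧ Q s'

/-- Every counted operation is itself a step, so for a nonempty family it suffices to bound the
steps. -/
theorem Runs.ops_le {G : ℝ → ℕ → ℝ} {p : Program} {s s' : Memory F} {T N : ℕ}
    (h : Runs G p s s' T N) : N ≤ T := by
  induction h <;> omega

namespace HaltsIn

variable {G : ℝ → ℕ → ℝ} {p q : Program} {s : Memory F} {B B₁ B₂ : ℕ} {Q R : Memory F → Prop}

theorem mono (h : HaltsIn G p s B₁ R) (hB : B₁ ≤ B) (hQ : ∀ s', R s' → Q s') :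
    HaltsIn G p s B Q := by
  obtain ⟨s', T, N, h1, h2, h3⟩ := h
  exact ⟨s', T, N, h1, h2.trans hB, hQ _ h3⟩

theorem skip (h : Q s) : HaltsIn G .skip s (B + 1) Q := ⟨s, 1, 0, .skip s, by omega, h⟩

theorem natSet {a : ℕ} {i e : Expr}
    (h : Q ⟨setCell s.nat a (i.val s) (e.val s), s.fld, s.wgt⟩) :
    HaltsIn G (.natSet a i e) s (B + 1) Q := ⟨_, 1, 0, .natSet a i e s, by omega, h⟩

theorem fldZero {a : ℕ} {i : Expr} (h : Q ⟨s.nat, setCell s.fld a (i.val s) 0, s.wgt⟩) :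
    HaltsIn G (.fldZero a i) s (B + 1) Q := ⟨_, 1, 1, .fldZero a i s, by omega, h⟩

theorem fldOne {a : ℕ} {i : Expr} (h : Q ⟨s.nat, setCell s.fld a (i.val s) 1, s.wgt⟩) :
    HaltsIn G (.fldOne a i) s (B + 1) Q := ⟨_, 1, 1, .fldOne a i s, by omega, h⟩

theorem fldOp {o : FieldOp} {a b c : ℕ} {i j k : Expr}
    (h : Q ⟨s.nat, setCell s.fld a (i.val s) (o.val (s.fld b (j.val s)) (s.fld c (k.val s))),
      s.wgt⟩) :
    HaltsIn G (.fldOp o a i b j c k) s (B + 1) Q := ⟨_, 1, 1, .fldOp o a i b j c k s, by omega, h⟩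

theorem fldCopy {a b : ℕ} {i j : Expr}
    (h : Q ⟨s.nat, setCell s.fld a (i.val s) (s.fld b (j.val s)), s.wgt⟩) :
    HaltsIn G (.fldCopy a i b j) s (B + 1) Q := ⟨_, 1, 0, .fldCopy a i b j s, by omega, h⟩

theorem wgtCopy {a b : ℕ} {i j : Expr}
    (h : Q ⟨s.nat, s.fld, setCell s.wgt a (i.val s) (s.wgt b (j.val s))⟩) :
    HaltsIn G (.wgtCopy a i b j) s (B + 1) Q := ⟨_, 1, 0, .wgtCopy a i b j s, by omega, h⟩

theorem call {a b : ℕ} {i j e : Expr}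
    (h : Q ⟨s.nat, s.fld, setCell s.wgt a (i.val s) (G (s.wgt b (j.val s)) (e.val s))⟩) :
    HaltsIn G (.call a i b j e) s (B + 1) Q := ⟨_, 1, 1, .call a i b j e s, by omega, h⟩

/-- The postcondition of `p` is the halting statement for `q`, so a proof can follow the program
text forward. -/
theorem seq (h : HaltsIn G p s B₁ fun s' => HaltsIn G q s' B₂ Q) :
    HaltsIn G (.seq p q) s (B₁ + B₂) Q := by
  obtain ⟨s', T, N, h1, h2, s'', T', N', h3, h4, h5⟩ := h
  exact ⟨s'', _, _, .seq h1 h3, by omega, h5⟩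

theorem seq_one (h : HaltsIn G p s 1 fun s' => HaltsIn G q s' B Q) :
    HaltsIn G (.seq p q) s (B + 1) Q := by
  rw [add_comm]; exact seq h

theorem ifLt {e₁ e₂ : Expr} (h1 : e₁.val s < e₂.val s → HaltsIn G p s B Q)
    (h2 : ¬ e₁.val s < e₂.val s → HaltsIn G q s B Q) : HaltsIn G (.ifLt e₁ e₂ p q) s (B + 1) Q := by
  by_cases h : e₁.val s < e₂.val s
  · obtain ⟨s', T, N, h3, h4, h5⟩ := h1 h
    exact ⟨s', _, _, .ifLt_true h h3, by omega, h5⟩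
  · obtain ⟨s', T, N, h3, h4, h5⟩ := h2 h
    exact ⟨s', _, _, .ifLt_false h h3, by omega, h5⟩

theorem ifZero {a : ℕ} {i : Expr} (h1 : s.fld a (i.val s) = 0 → HaltsIn G p s B Q)
    (h2 : s.fld a (i.val s) ≠ 0 → HaltsIn G q s B Q) : HaltsIn G (.ifZero a i p q) s (B + 1) Q := by
  by_cases h : s.fld a (i.val s) = 0
  · obtain ⟨s', T, N, h3, h4, h5⟩ := h1 h
    exact ⟨s', _, _, .ifZero_true h h3, by omega, h5⟩
  · obtain ⟨s', T, N, h3, h4, h5⟩ := h2 h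
    exact ⟨s', _, _, .ifZero_false h h3, by omega, h5⟩

theorem ifLe {a b : ℕ} {i j : Expr}
    (h1 : s.wgt a (i.val s) ≤ s.wgt b (j.val s) → HaltsIn G p s B Q)
    (h2 : ¬ s.wgt a (i.val s) ≤ s.wgt b (j.val s) → HaltsIn G q s B Q) :
    HaltsIn G (.ifLe a i b j p q) s (B + 1) Q := by
  by_cases h : s.wgt a (i.val s) ≤ s.wgt b (j.val s)
  · obtain ⟨s', T, N, h3, h4, h5⟩ := h1 h
    exact ⟨s', _, _, .ifLe_true h h3, by omega, h5⟩
  · obtain ⟨s', T, N, h3, h4, h5⟩ := h2 h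
    exact ⟨s', _, _, .ifLe_false h h3, by omega, h5⟩

/-- The invariant carries the number `k` of completed rounds. The body has to justify `k < n`, so
termination comes by induction on `n - k`. -/
theorem whileLt {e₁ e₂ : Expr} (n : ℕ) (I : ℕ → Memory F → Prop) (h0 : I 0 s)
    (hbody : ∀ k s, I k s → e₁.val s < e₂.val s → k < n ∧ HaltsIn G p s B (I (k + 1)))
    (hend : ∀ k s, I k s → ¬ e₁.val s < e₂.val s → Q s) :
    HaltsIn G (.whileLt e₁ e₂ p) s (n * (B + 1) + 1) Q := by
  suffices ∀ m k s, n - k = m → I k s → HaltsIn G (.whileLt e₁ e₂ p) s (m * (B + 1) + 1) Q from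
    this n 0 s rfl h0
  intro m
  induction m with
  | zero =>
    intro k s hm hI
    have h : ¬ e₁.val s < e₂.val s := fun h => by have := (hbody k s hI h).1; omega
    exact ⟨s, _, _, .while_false h, by omega, hend k s hI h⟩
  | succ m ih =>
    intro k s hm hI
    by_cases h : e₁.val s < e₂.val s
    · obtain ⟨hk, s', T, N, h1, h2, h3⟩ := hbody k s hI h
      obtain ⟨s'', T', N', h4, h5, h6⟩ := ih (k + 1) s' (by omega) h3
      refine ⟨s'', _, _, .while_true h h1 h4, ?_, h6⟩
      rw [Nat.succ_mul]; omega
    · exact ⟨s, _, _, .while_false h, by omega, hend k s hI h⟩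

end HaltsIn

/-- The cell `0` of the array `a`, used as a variable. -/
abbrev var (a : ℕ) : Expr := .cell a (.const 0)

/-- Assignment to a variable. -/
abbrev setVar (a : ℕ) (e : Expr) : Program := .natSet a (.const 0) e

/-- Increment a variable. -/
abbrev incVar (a : ℕ) : Program := setVar a (.add (var a) (.const 1))

end Execution

section VectorPrograms

/-! ### Programs for exterior products -/

variable {F : Type u} [Field F] {G : ℝ → ℕ → ℝ}

/-- Fill the table of powers of two. -/
def powProgram : Program :=
  .seq (.natSet 4 (.const 0) (.const 1)) <|
  .seq (setVar 11 (.const 0)) <|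
  .seq (.whileLt (var 11) (.cell 0 (.const 4)) <|
    .seq (.natSet 4 (.add (var 11) (.const 1)) (.add (.cell 4 (var 11)) (.cell 4 (var 11))))
      (incVar 11)) <|
  setVar 10 (.cell 4 (.cell 0 (.const 4)))

/-- The rank, and the powers of two, are stored where the programs expect them. -/
structure HasTables (r : ℕ) (s : Memory F) : Prop where
  rank : s.nat 0 4 = r
  size : s.nat 10 0 = 2 ^ r
  pow : ∀ i ≤ r, s.nat 4 i = 2 ^ i

omit [Field F] in
theorem HasTables.of_agreeOff {r : ℕ} {s s' : Memory F} {NA FA WA : List ℕ} (h : HasTables r s)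
    (ha : AgreeOff NA FA WA s s') (h0 : 0 ∉ NA := by decide) (h4 : 4 ∉ NA := by decide)
    (h10 : 10 ∉ NA := by decide) : HasTables r s' :=
  ⟨by rw [ha.nat 0 h0]; exact h.rank, by rw [ha.nat 10 h10]; exact h.size,
    by rw [ha.nat 4 h4]; exact h.pow⟩

theorem powProgram_spec {r : ℕ} {s : Memory F} (hr : s.nat 0 4 = r) :
    HaltsIn G powProgram s (r * 3 + 4) fun s' =>
      AgreeOff [4, 10, 11] [] [] s s' ∧ HasTables r s' := by
  refine HaltsIn.mono (B₁ := (r * (2 + 1) + 1 + 1) + 1 + 1) ?_ (by omega) fun _ h => h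
  refine .seq_one <| .natSet <| .seq_one <| .natSet <|
    .seq (B₁ := r * (2 + 1) + 1) (B₂ := 1) ?_
  refine HaltsIn.whileLt r (fun k s' => AgreeOff [4, 10, 11] [] [] s s' ∧ s'.nat 11 0 = k ∧ k ≤ r ∧
    ∀ i ≤ k, s'.nat 4 i = 2 ^ i) ?_ ?_ ?_
  · refine ⟨(AgreeOff.refl s).setNat.setNat, ?_⟩
    simp [setCell_apply, Expr.val]
  · rintro k s' ⟨ha, hk, hkr, hp⟩ hlt
    simp only [Expr.val, hk, ha.n 0, hr] at hlt
    refine ⟨hlt, .seq_one <| .natSet <| .natSet ⟨ha.setNat.setNat, ?_⟩⟩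
    simp only [Expr.val, setCell_apply, hk]
    refine ⟨by simp, hlt, fun i hi => ?_⟩
    by_cases h : i = k + 1
    · subst h; simp [hp k le_rfl, pow_succ]; ring
    · simpa [h] using hp i (by omega)
  · rintro k s' ⟨ha, hk, hkr, hp⟩ hlt
    simp only [Expr.val, hk, ha.n 0, hr] at hlt
    obtain rfl : k = r := by omega
    refine .natSet ⟨ha.setNat, ?_⟩
    simp only [Expr.val, ha.n 0, hr]
    constructor
    · simp [setCell_apply, ha.n 0, hr]
    · simp [setCell_apply, hp]
    · simpa [setCell_apply] using hp

/-- Compute the address of the column with the label in the variable `21`. -/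
def addressProgram : Program :=
  .seq (setVar 12 (.const 0)) <|
  .seq (setVar 13 (.const 0)) <|
  .whileLt (var 13) (.cell 0 (.const 4)) <|
    .seq (setVar 12 (.add (var 12) (var 21))) (incVar 13)

/-- Natural numbers cannot be multiplied, so the address of a column is computed by `r` additions.
-/
theorem addressProgram_spec {r : ℕ} {s : Memory F} (hr : s.nat 0 4 = r) :
    HaltsIn G addressProgram s (r * 3 + 3) fun s' =>
      AgreeOff [12, 13] [] [] s s' ∧ s'.nat 12 0 = s.nat 21 0 * r := by
  refine .seq_one <| .natSet <| .seq_one <| .natSet ?_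
  refine HaltsIn.whileLt r (fun k s' => AgreeOff [12, 13] [] [] s s' ∧ s'.nat 13 0 = k ∧ k ≤ r ∧
    s'.nat 12 0 = s.nat 21 0 * k) ?_ ?_ ?_
  · exact ⟨(AgreeOff.refl s).setNat.setNat, by simp [setCell_apply, Expr.val]⟩
  · rintro k s' ⟨ha, hk, hkr, hb⟩ hlt
    simp only [Expr.val, hk, ha.n 0, hr] at hlt
    refine ⟨hlt, .seq_one <| .natSet <| .natSet ⟨ha.setNat.setNat, ?_⟩⟩
    simp [Expr.val, setCell_apply, hk, hb, ha.n 21, Nat.mul_succ]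
    omega
  · rintro k s' ⟨ha, hk, hkr, hb⟩ hlt
    simp only [Expr.val, hk, ha.n 0, hr] at hlt
    obtain rfl : k = r := by omega
    exact ⟨ha, hb⟩

/-- Compute one coordinate of an exterior product. -/
def coordinateProgram : Program :=
  .whileLt (.const 0) (var 16) <|
    .seq (setVar 16 (.sub (var 16) (.const 1))) <|
    .ifLt (var 15) (.cell 4 (var 16)) .skip <|
    .seq (setVar 15 (.sub (var 15) (.cell 4 (var 16)))) <|
    .seq (.fldOp .mul 2 (.const 1) 0 (.add (var 12) (var 16)) 1
      (.add (var 17) (.sub (var 14) (.cell 4 (var 16))))) <|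
    .fldOp .sub 2 (.const 0) 2 (.const 1) 2 (.const 0)

/-- This turns a bit test into a comparison: going downward, the machine keeps the remainder of `T`
and compares it with the next power of two. -/
theorem mod_two_pow_succ_lt_iff (T i : ℕ) :
    T % 2 ^ (i + 1) < 2 ^ i ↔ T.testBit i = false := by
  have h := Nat.testBit_mod_two_pow T (i + 1) i
  simp only [Nat.lt_succ_self, decide_true, Bool.true_and] at h
  rw [← h]
  constructor
  · exact Nat.testBit_lt_two_pow
  · intro h'
    by_contra hc
    have hlt : T % 2 ^ (i + 1) < 2 ^ (i + 1) := Nat.mod_lt _ (by positivity)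
    rw [Nat.testBit_of_two_pow_le_and_two_pow_add_one_gt (by omega) hlt] at h'
    exact absurd h' (by simp)

theorem mod_two_pow_succ_sub {T i : ℕ} (h : ¬ T % 2 ^ (i + 1) < 2 ^ i) :
    T % 2 ^ (i + 1) - 2 ^ i = T % 2 ^ i := by
  have hlt : T % 2 ^ (i + 1) < 2 ^ (i + 1) := Nat.mod_lt _ (by positivity)
  have hp : 2 ^ (i + 1) = 2 ^ i * 2 := pow_succ 2 i
  rw [← Nat.mod_mod_of_dvd T (pow_dvd_pow 2 (Nat.le_succ i))]
  generalize T % 2 ^ (i + 1) = m at *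
  rw [Nat.mod_eq_sub_mod (by omega), Nat.mod_eq_of_lt (by omega)]

theorem mod_two_pow_succ_of_lt {T i : ℕ} (h : T % 2 ^ (i + 1) < 2 ^ i) :
    T % 2 ^ (i + 1) = T % 2 ^ i := by
  have h1 : T % 2 ^ (i + 1) % 2 ^ i = T % 2 ^ i :=
    Nat.mod_mod_of_dvd _ (pow_dvd_pow 2 (Nat.le_succ i))
  rw [← h1, Nat.mod_eq_of_lt h]

/-- The scratch cell holds `wedgeTail` while the bit position decreases. Only coordinates of `v` at
masks below `T` are read, which permits multiplication in place. -/
theorem coordinateProgram_spec {r T p : ℕ} {s : Memory F} {v : ℕ → F} (ht : HasTables r s)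
    (hT : s.nat 14 0 = T) (hTr : T < 2 ^ r) (hx : s.nat 15 0 = T) (hi : s.nat 16 0 = r)
    (hp : s.nat 17 0 = p) (h0 : s.fld 2 0 = 0) (hv : ∀ x < T, s.fld 1 (p + x) = v x) :
    HaltsIn G coordinateProgram s (r * 6 + 1) fun s' =>
      AgreeOff [15, 16] [2] [] s s' ∧
        s'.fld 2 0 = wedge F r (fun i => s.fld 0 (s.nat 12 0 + i)) v T := by
  set a : ℕ → F := fun i => s.fld 0 (s.nat 12 0 + i) with ha
  refine HaltsIn.whileLt r (fun k s' => AgreeOff [15, 16] [2] [] s s' ∧ k ≤ r ∧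
    s'.nat 16 0 = r - k ∧ s'.nat 15 0 = T % 2 ^ (r - k) ∧
    s'.fld 2 0 = wedgeTail r a v T (r - k)) ?_ ?_ ?_
  · exact ⟨AgreeOff.refl s, Nat.zero_le _, hi, by rw [hx, Nat.sub_zero, Nat.mod_eq_of_lt hTr],
      by rw [h0, Nat.sub_zero, wedgeTail_self]⟩
  · rintro k s' ⟨hag, hkr, hi', hx', hf⟩ hlt
    simp only [Expr.val, hi'] at hlt
    obtain ⟨i, hik⟩ : ∃ i, r - k = i + 1 := ⟨r - k - 1, by omega⟩
    have hik' : r - (k + 1) = i := by omega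
    rw [hik] at hi' hx' hf
    rw [hik']
    have hpow : s'.nat 4 i = 2 ^ i := by rw [hag.n 4]; exact ht.pow i (by omega)
    have htail := wedgeTail_of_lt (r := r) (i := i) (by omega) a v T
    refine ⟨by omega, .seq_one <| .natSet <| .ifLt ?_ ?_⟩
    · intro h
      simp [Expr.val, setCell_apply, hi', hx', hpow] at h
      refine HaltsIn.skip ⟨hag.setNat, by omega, ?_⟩
      rw [(mod_two_pow_succ_lt_iff T i).1 h] at htail
      simp [Expr.val, setCell_apply, hi', hx', hf, htail, mod_two_pow_succ_of_lt h]
    · intro h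
      simp only [Expr.val, setCell_apply, hi', hx', hpow, and_self, if_true, add_tsub_cancel_right,
        show (15 : ℕ) ≠ 16 by decide, show (4 : ℕ) ≠ 16 by decide, false_and, if_false] at h
      have hb : T.testBit i = true := by
        by_contra hb
        exact h ((mod_two_pow_succ_lt_iff T i).2 (by simpa using hb))
      refine .seq_one <| .natSet <| .seq_one <| .fldOp <| .fldOp
        ⟨hag.setNat.setNat.setFld.setFld, by omega, ?_⟩
      rw [hb] at htail
      have hlt : T - 2 ^ i < T := by
        have := two_pow_le_of_testBit hb
        have : 0 < 2 ^ i := by positivity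
        omega
      have hv' := hv _ hlt
      rw [htail]
      simp [Expr.val, setCell_apply, hi', hx', hf, hpow, mod_two_pow_succ_sub h, FieldOp.val,
        hag.n 14, hag.n 17, hag.n 12, hag.f 1, hag.f 0, hT, hp, hv', ha]
  · rintro k s' ⟨hag, hkr, hi', hx', hf⟩ hlt
    simp only [Expr.val, hi'] at hlt
    have : r - k = 0 := by omega
    rw [this] at hf
    exact ⟨hag, by rw [hf, ← wedge_eq_wedgeTail]⟩

/-- Multiply the vector at the address in the variable `17` by the column at the address in the
variable `12`. -/
def wedgeProgram : Program :=
  .seq (setVar 14 (var 10)) <|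
  .whileLt (.const 0) (var 14) <|
    .seq (setVar 14 (.sub (var 14) (.const 1))) <|
    .seq (setVar 15 (var 14)) <|
    .seq (setVar 16 (.cell 0 (.const 4))) <|
    .seq (.fldZero 2 (.const 0)) <|
    .seq coordinateProgram <|
    .fldCopy 1 (.add (var 17) (var 14)) 2 (.const 0)

/-- The masks are treated in decreasing order: a new coordinate depends only on smaller masks, and
these still hold the old values. -/
theorem wedgeProgram_spec {r p : ℕ} {s : Memory F} {v : ℕ → F} (ht : HasTables r s)
    (hp : s.nat 17 0 = p) (hv : ∀ x < 2 ^ r, s.fld 1 (p + x) = v x) :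
    HaltsIn G wedgeProgram s (2 ^ r * (r * 6 + 7) + 2) fun s' =>
      AgreeOff [14, 15, 16] [1, 2] [] s s' ∧
      (∀ x < 2 ^ r, s'.fld 1 (p + x) = wedge F r (fun i => s.fld 0 (s.nat 12 0 + i)) v x) ∧
      ∀ q, (q < p ∨ p + 2 ^ r ≤ q) → s'.fld 1 q = s.fld 1 q := by
  set a : Fin r → F := fun i => s.fld 0 (s.nat 12 0 + i) with ha
  refine .seq_one <| .natSet ?_
  refine HaltsIn.whileLt (2 ^ r) (fun k s' => AgreeOff [14, 15, 16] [1, 2] [] s s' ∧ k ≤ 2 ^ r ∧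
    s'.nat 14 0 = 2 ^ r - k ∧ (∀ x < 2 ^ r - k, s'.fld 1 (p + x) = v x) ∧
    (∀ x < 2 ^ r, 2 ^ r - k ≤ x → s'.fld 1 (p + x) = wedge F r a v x) ∧
    ∀ q, (q < p ∨ p + 2 ^ r ≤ q) → s'.fld 1 q = s.fld 1 q) ?_ ?_ ?_
  · refine ⟨(AgreeOff.refl s).setNat, Nat.zero_le _, by simp [setCell_apply, Expr.val, ht.size],
      by simpa using hv, fun x hx hx' => absurd hx (by omega), fun q _ => rfl⟩
  · rintro k s' ⟨hag, hk, hT, h1, h2, h3⟩ hlt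
    simp only [Expr.val, hT] at hlt
    obtain ⟨T, hkT⟩ : ∃ T, 2 ^ r - k = T + 1 := ⟨2 ^ r - k - 1, by omega⟩
    have hkT' : 2 ^ r - (k + 1) = T := by omega
    rw [hkT] at hT h1 h2
    rw [hkT']
    refine ⟨by omega, .seq_one <| .natSet <| .seq_one <| .natSet <| .seq_one <| .natSet <|
      .seq_one <| .fldZero <| .seq (B₁ := r * 6 + 1) (B₂ := 1) ?_⟩
    have hag' := hag.setNat (a := 14) (i := 0) (x := T) |>.setNat (a := 15) (i := 0) (x := T)
      |>.setNat (a := 16) (i := 0) (x := r) |>.setFld (a := 2) (i := 0) (x := 0)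
    simp only [Expr.val, setCell_apply, hT, hag.n 0, ht.rank, Nat.add_sub_cancel, and_self,
      if_true, show (0 : ℕ) ≠ 15 by decide, show (0 : ℕ) ≠ 14 by decide, false_and, if_false]
    refine (coordinateProgram_spec (r := r) (T := T) (p := p) (v := v)
      (ht.of_agreeOff hag') ?_ (by omega) ?_ ?_ ?_ ?_ ?_).mono le_rfl ?_
    · simp [setCell_apply]
    · simp [setCell_apply]
    · simp [setCell_apply]
    · simp [setCell_apply, hag.n 17, hp]
    · simp [setCell_apply]
    · intro x hx; simpa [setCell_apply] using h1 x (by omega)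
    · rintro s'' ⟨hc, hres⟩
      have h14 : s''.nat 14 0 = T := by rw [hc.n 14]; simp [setCell_apply]
      have h17 : s''.nat 17 0 = p := by rw [hc.n 17]; simp [setCell_apply, hag.n 17, hp]
      have hf1 : s''.fld 1 = s'.fld 1 := by rw [hc.f 1]; simp [setCell_of_ne]
      have hag'' := hag'.trans hc
      refine .fldCopy ⟨hag''.setFld, by omega, ?_, ?_, ?_, ?_⟩
      · simp [h14]
      · intro x hx
        simp [Expr.val, setCell_apply, h14, h17, hx.ne, hf1, h1 x (by omega)]
      · intro x hx hTx
        simp only [Expr.val, setCell_apply, h14, h17, hf1, true_and, Nat.add_left_cancel_iff]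
        split_ifs with hxT
        · subst hxT
          rw [hres]
          simp [setCell_of_ne, hag.n 12, hag.f 0, ha]
        · exact h2 x hx (by omega)
      · intro q hq
        have : q ≠ p + T := by omega
        simp [Expr.val, setCell_apply, h14, h17, hf1, this, h3 q hq]
  · rintro k s' ⟨hag, hk, hT, h1, h2, h3⟩ hlt
    simp only [Expr.val, hT] at hlt
    exact ⟨hag, fun x hx => h2 x hx (by omega), h3⟩

/-- Compute the exterior product of the columns listed in the row at the address in the variable
`17`; their number is in the variable `37`. -/
def productProgram : Program :=
  .seq (setVar 20 (.const 0)) <|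
  .seq (.whileLt (var 20) (var 10) <|
    .seq (.fldZero 1 (.add (var 17) (var 20))) (incVar 20)) <|
  .seq (.fldOne 1 (var 17)) <|
  .seq (setVar 19 (.const 0)) <|
  .whileLt (var 19) (var 37) <|
    .seq (setVar 21 (.cell 5 (.add (var 17) (var 19)))) <|
    .seq addressProgram <|
    .seq wedgeProgram (incVar 19)

/-- The labels stored in the row of length `d` at the address `c`. -/
def rowLabels (s : Memory F) (c d : ℕ) : List ℕ := (List.range d).map fun j => s.nat 5 (c + j)

/-- The column stored for the label `x`. -/
def storedColumn (r : ℕ) (s : Memory F) (x : ℕ) : Fin r → F := fun i => s.fld 0 (x * r + i)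

/-- The exterior product of the stored columns with the labels in `l`. -/
def storedProduct (r : ℕ) (s : Memory F) (l : List ℕ) : ℕ → F :=
  wedgeList (l.map (storedColumn r s)) (unitVec F)

/-- The vector stored at the address `c`. -/
def storedVec (K : ℕ) (s : Memory F) (c : ℕ) : ℕ → F := fun x => if x < K then s.fld 1 (c + x) else 0

theorem storedProduct_congr {r : ℕ} {s s' : Memory F} (h : s'.fld 0 = s.fld 0) (l : List ℕ) :
    storedProduct r s' l = storedProduct r s l := by
  unfold storedProduct storedColumn; rw [h]

theorem storedProduct_mem (r : ℕ) (s : Memory F) (l : List ℕ) :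
    storedProduct r s l ∈ degreeSubmodule F r l.length := by
  have := wedgeList_mem (l.map (storedColumn r s))
  rwa [List.length_map] at this

theorem productProgram_spec {r p d : ℕ} {s : Memory F} (ht : HasTables r s)
    (hp : s.nat 17 0 = p) (hd : s.nat 37 0 = d) :
    HaltsIn G productProgram s
      (2 ^ r * 3 + 1 + 1 + 1 + 1 + (d * (r * 3 + 2 ^ r * (r * 6 + 7) + 8) + 1)) fun s' =>
      AgreeOff [12, 13, 14, 15, 16, 19, 20, 21] [1, 2] [] s s' ∧
      storedVec (2 ^ r) s' p = storedProduct r s (rowLabels s p d) ∧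
      ∀ q, (q < p ∨ p + 2 ^ r ≤ q) → s'.fld 1 q = s.fld 1 q := by
  refine HaltsIn.mono (B₁ := (2 ^ r * (2 + 1) + 1 +
    (d * (1 + (r * 3 + 3 + (2 ^ r * (r * 6 + 7) + 2 + 1)) + 1) + 1 + 1 + 1)) + 1) ?_ ?_
    fun _ h => h
  swap
  · have : d * (1 + (r * 3 + 3 + (2 ^ r * (r * 6 + 7) + 2 + 1)) + 1) =
      d * (r * 3 + 2 ^ r * (r * 6 + 7) + 8) := by ring
    omega
  refine .seq_one <| .natSet <| .seq ?_
  refine HaltsIn.whileLt (2 ^ r) (fun k s' => AgreeOff [20] [1] [] s s' ∧ k ≤ 2 ^ r ∧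
    s'.nat 20 0 = k ∧ (∀ x < k, s'.fld 1 (p + x) = 0) ∧
    ∀ q, (q < p ∨ p + 2 ^ r ≤ q) → s'.fld 1 q = s.fld 1 q) ?_ ?_ ?_
  · exact ⟨(AgreeOff.refl s).setNat, Nat.zero_le _, by simp [setCell_apply, Expr.val],
      fun x hx => absurd hx (by omega), fun q _ => rfl⟩
  · rintro k s' ⟨hag, hk, hk', h1, h2⟩ hlt
    simp only [Expr.val, hk', hag.n 10, ht.size] at hlt
    refine ⟨hlt, .seq_one <| .fldZero <| .natSet ⟨hag.setFld.setNat, by omega, ?_, ?_, ?_⟩⟩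
    · simp [Expr.val, setCell_apply, hk']
    · intro x hx
      simp only [Expr.val, setCell_apply, hk', hag.n 17, hp, true_and, Nat.add_left_cancel_iff]
      split_ifs with hxk
      · rfl
      · exact h1 x (by omega)
    · intro q hq
      have : q ≠ p + k := by omega
      simp [Expr.val, setCell_apply, hk', hag.n 17, hp, this, h2 q hq]
  rintro k s₁ ⟨hag, hk, hk', h1, h2⟩ hlt
  simp only [Expr.val, hk', hag.n 10, ht.size] at hlt
  obtain rfl : k = 2 ^ r := by omega
  refine .seq_one <| .fldOne <| .seq_one <| .natSet ?_
  simp only [Expr.val, hag.n 17, hp]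
  refine HaltsIn.whileLt d (fun k s' =>
    AgreeOff [12, 13, 14, 15, 16, 19, 20, 21] [1, 2] [] s s' ∧ k ≤ d ∧ s'.nat 19 0 = k ∧
    (∀ x < 2 ^ r, s'.fld 1 (p + x) = storedProduct r s (rowLabels s p k) x) ∧
    ∀ q, (q < p ∨ p + 2 ^ r ≤ q) → s'.fld 1 q = s.fld 1 q) ?_ ?_ ?_
  · refine ⟨((AgreeOff.refl s).trans hag).setFld.setNat, by omega, by simp [setCell_apply], ?_, ?_⟩
    · intro x hx
      by_cases hx0 : x = 0
      · simp [setCell_apply, hx0, rowLabels, storedProduct, wedgeList, unitVec]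
      · simp [setCell_apply, hx0, rowLabels, storedProduct, wedgeList, unitVec, h1 x hx]
    · intro q hq
      have hpos : 0 < 2 ^ r := by positivity
      have : q ≠ p := by omega
      simp [setCell_apply, this, h2 q hq]
  · rintro k s' ⟨hag, hk, hk', h1, h2⟩ hlt
    simp only [Expr.val, hk', hag.n 37, hd] at hlt
    refine ⟨hlt, HaltsIn.mono (B₁ := (r * 3 + 3 + (2 ^ r * (r * 6 + 7) + 2 + 1)) + 1) ?_ (by omega)
      fun _ h => h⟩
    refine .seq_one <| .natSet <| .seq ?_
    have hag1 := hag.setNat (a := 21) (i := 0) (x := s.nat 5 (p + k))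
    simp only [Expr.val, hk', hag.n 17, hag.n 5, hp]
    refine (addressProgram_spec (r := r) (ht.of_agreeOff hag1).rank).mono le_rfl ?_
    rintro s₂ ⟨hag2, h12⟩
    simp only [setCell_apply, and_self, if_true] at h12
    have hag2' := hag1.trans hag2
    refine .seq <| (wedgeProgram_spec (r := r) (p := p)
      (v := storedProduct r s (rowLabels s p k)) (ht.of_agreeOff hag2') ?_ ?_).mono le_rfl ?_
    · rw [hag2'.n 17, hp]
    · intro x hx; rw [hag2.f 1]; exact h1 x hx
    rintro s₃ ⟨hag3, h3, h4⟩
    have hag3' := hag2'.trans hag3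
    refine .natSet ⟨hag3'.setNat, by omega, ?_, ?_, ?_⟩
    · simp [Expr.val, setCell_apply, hag3.n 19, hag2.n 19, hk']
    · intro x hx
      have e : storedProduct r s (rowLabels s p (k + 1)) =
          wedge F r (storedColumn r s (s.nat 5 (p + k))) (storedProduct r s (rowLabels s p k)) := by
        unfold storedProduct rowLabels
        rw [List.range_succ, List.map_append, List.map_append, wedgeList_append]; rfl
      rw [e]
      show s₃.fld 1 (p + x) = _
      rw [h3 x hx, h12, hag2'.f 0]; rfl
    · intro q hq
      show s₃.fld 1 q = _
      rw [h4 q hq, hag2.f 1]; exact h2 q hq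
  · rintro k s' ⟨hag, hk, hk', h1, h2⟩ hlt
    simp only [Expr.val, hk', hag.n 37, hd] at hlt
    obtain rfl : k = d := by omega
    refine ⟨hag, ?_, h2⟩
    funext x
    unfold storedVec
    split_ifs with hx
    · exact h1 x hx
    -- Beyond `2 ^ r` the stored vector is zero by convention, and the product is zero because it is
    -- homogeneous.
    · by_contra hne
      exact hx (storedProduct_mem r s _ x (Ne.symm hne)).1

end VectorPrograms

end RepFamilies

namespace RepFamilies

section CandidatePrograms

/-! ### Programs for the candidates -/

variable {F : Type u} [Field F] {G : ℝ → ℕ → ℝ}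

theorem setCell_self {V : Type*} (m : ℕ → ℕ → V) (a i : ℕ) (x : V) :
    setCell m a i x a = Function.update (m a) i x := by
  simp [setCell]

/-- Store the union of a row and of a member of the family in a new row, and compute its weight. -/
def buildProgram : Program :=
  .seq (setVar 24 (.const 0)) <|
  .seq (.whileLt (var 24) (var 18) <|
    .seq (.natSet 5 (.add (var 17) (var 24)) (.cell 5 (.add (var 22) (var 24)))) (incVar 24)) <|
  .seq (setVar 24 (.const 0)) <|
  .seq (.whileLt (var 24) (.cell 0 (.const 3)) <|
    .seq (.natSet 5 (.add (.add (var 17) (var 18)) (var 24)) (.cell 1 (.add (var 23) (var 24))))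
      (incVar 24)) <|
  .call 1 (var 17) 1 (var 22) (var 31)

omit [Field F] in
theorem rowLabels_append (s : Memory F) (c d e : ℕ) :
    rowLabels s c (d + e) = rowLabels s c d ++ (List.range e).map fun j => s.nat 5 (c + d + j) := by
  unfold rowLabels
  rw [List.range_add, List.map_append, List.map_map]
  congr 2
  funext j
  simp [add_assoc]

omit [Field F] in
theorem rowLabels_congr {s s' : Memory F} {c c' d : ℕ}
    (h : ∀ j < d, s'.nat 5 (c' + j) = s.nat 5 (c + j)) : rowLabels s' c' d = rowLabels s c d :=
  List.map_congr_left fun j hj => h j (List.mem_range.1 hj)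

/-- The source row ends before the new row begins, so copying cannot overwrite its own input. -/
theorem buildProgram_spec {p d γ src hp h : ℕ} {s : Memory F} (h17 : s.nat 17 0 = p)
    (h18 : s.nat 18 0 = d) (h3 : s.nat 0 3 = γ) (h22 : s.nat 22 0 = src) (h23 : s.nat 23 0 = hp)
    (h31 : s.nat 31 0 = h) (hsrc : src + d ≤ p) :
    HaltsIn G buildProgram s (d * 3 + γ * 3 + 5) fun s' =>
      AgreeOff [5, 24] [] [1] s s' ∧
      rowLabels s' p (d + γ) = rowLabels s src d ++ (List.range γ).map (fun j => s.nat 1 (hp + j)) ∧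
      s'.wgt 1 p = G (s.wgt 1 src) h ∧
      (∀ q < p, s'.nat 5 q = s.nat 5 q) ∧ ∀ q, q ≠ p → s'.wgt 1 q = s.wgt 1 q := by
  refine HaltsIn.mono (B₁ := (d * (2 + 1) + 1 + ((γ * (2 + 1) + 1 + 1) + 1)) + 1) ?_ (by omega)
    fun _ h => h
  refine .seq_one <| .natSet <| .seq ?_
  refine HaltsIn.whileLt d (fun k s' => AgreeOff [5, 24] [] [1] s s' ∧ k ≤ d ∧ s'.nat 24 0 = k ∧
    (∀ j < k, s'.nat 5 (p + j) = s.nat 5 (src + j)) ∧ (∀ q < p, s'.nat 5 q = s.nat 5 q) ∧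
    s'.wgt = s.wgt) ?_ ?_ ?_
  · exact ⟨(AgreeOff.refl s).setNat, Nat.zero_le _, by simp [setCell_apply, Expr.val],
      fun x hx => absurd hx (by omega), fun q _ => rfl, rfl⟩
  · rintro k s' ⟨hag, hk, hk', h1, h2, hw⟩ hlt
    simp only [Expr.val, hk', hag.n 18, h18] at hlt
    refine ⟨hlt, .seq_one <| .natSet <| .natSet ⟨hag.setNat.setNat, hlt, ?_, ?_, ?_, hw⟩⟩
    · simp [Expr.val, setCell_apply, hk']
    · intro j hj
      simp only [Expr.val, setCell_apply, hk', hag.n 17, h17, hag.n 22, h22, true_and,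
        Nat.add_left_cancel_iff, show (5 : ℕ) ≠ 24 by decide, false_and, if_false]
      split_ifs with hjk
      · rw [h2 _ (by omega), hjk]
      · exact h1 j (by omega)
    · intro q hq
      have : q ≠ p + k := by omega
      simp [Expr.val, setCell_apply, hk', hag.n 17, h17, this, h2 q hq]
  rintro k s₁ ⟨hag, hk, hk', h1, h2, hw⟩ hlt
  simp only [Expr.val, hk', hag.n 18, h18] at hlt
  obtain rfl : k = d := by omega
  refine .seq_one <| .natSet <| .seq (B₁ := γ * (2 + 1) + 1) (B₂ := 1) ?_
  refine HaltsIn.whileLt γ (fun m s' => AgreeOff [5, 24] [] [1] s s' ∧ m ≤ γ ∧ s'.nat 24 0 = m ∧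
    (∀ j < k, s'.nat 5 (p + j) = s.nat 5 (src + j)) ∧
    (∀ j < m, s'.nat 5 (p + k + j) = s.nat 1 (hp + j)) ∧ (∀ q < p, s'.nat 5 q = s.nat 5 q) ∧
    s'.wgt = s.wgt) ?_ ?_ ?_
  · exact ⟨hag.setNat, Nat.zero_le _, by simp [setCell_apply, Expr.val], h1,
      fun x hx => absurd hx (by omega), h2, hw⟩
  · rintro m s' ⟨hag, hm, hm', h1, h4, h2, hw⟩ hlt
    simp only [Expr.val, hm', hag.n 0, h3] at hlt
    refine ⟨hlt, .seq_one <| .natSet <| .natSet ⟨hag.setNat.setNat, hlt, ?_, ?_, ?_, ?_, hw⟩⟩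
    · simp [Expr.val, setCell_apply, hm']
    · intro j hj
      have : p + j ≠ p + k + m := by omega
      simpa [Expr.val, setCell_apply, hm', hag.n 17, h17, hag.n 18, h18, this] using h1 j hj
    · intro j hj
      simp only [Expr.val, setCell_apply, hm', hag.n 17, h17, hag.n 18, h18, hag.n 23, h23,
        hag.n 1, true_and, Nat.add_left_cancel_iff, show (5 : ℕ) ≠ 24 by decide, false_and, if_false]
      split_ifs with hjm
      · rw [hjm]
      · exact h4 j (by omega)
    · intro q hq
      have : q ≠ p + k + m := by omega
      simp [Expr.val, setCell_apply, hm', hag.n 17, h17, hag.n 18, h18, this, h2 q hq]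
  rintro m s' ⟨hag, hm, hm', h1, h4, h2, hw⟩ hlt
  simp only [Expr.val, hm', hag.n 0, h3] at hlt
  obtain rfl : m = γ := by omega
  refine .call ⟨hag.setWgt, ?_, ?_, h2, ?_⟩
  · rw [rowLabels_append]
    congr 1
    · exact rowLabels_congr h1
    · exact List.map_congr_left fun j hj => h4 j (List.mem_range.1 hj)
  · simp [Expr.val, setCell_apply, hag.n 17, h17, hag.n 22, h22, hag.n 31, h31, hw]
  · intro q hq
    simp [Expr.val, setCell_apply, hag.n 17, h17, hq, hw]

/-- The index `a` has larger weight than `b`, or the same weight and comes first. -/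
def Better (W : ℕ → ℝ) (a b : ℕ) : Prop := W b < W a ∨ (W b = W a ∧ a < b)

/-- Breaking ties by address gives a strict order that is total on distinct rows, so one of two
competing rows is always the better one. -/
theorem Better.trans (W : ℕ → ℝ) (a b c : ℕ) (h1 : Better W a b) (h2 : Better W b c) :
    Better W a c := by
  rcases h1 with h1 | ⟨h1, h1'⟩ <;> rcases h2 with h2 | ⟨h2, h2'⟩
  · exact Or.inl (h2.trans h1)
  · exact Or.inl (h2 ▸ h1)
  · exact Or.inl (h1 ▸ h2)
  · exact Or.inr ⟨h2.trans h1, h1'.trans h2'⟩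

theorem Better.irrefl (W : ℕ → ℝ) (a : ℕ) : ¬ Better W a a := by simp [Better]

/-- Rows are blocks of length `K` that start at multiples of `K`, so distinct rows never overlap. -/
theorem row_disjoint {K c q x : ℕ} (hc : K ∣ c) (hq : K ∣ q) (h : q ≠ c) (hx : x < K) :
    q + x < c ∨ c + K ≤ q + x := by
  obtain ⟨a, rfl⟩ := hc
  obtain ⟨b, rfl⟩ := hq
  rcases lt_trichotomy b a with hlt | rfl | hlt
  · left
    have := Nat.mul_le_mul_left K (Nat.succ_le_of_lt hlt)
    rw [Nat.mul_succ] at this; omega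
  · exact absurd rfl h
  · right
    have := Nat.mul_le_mul_left K (Nat.succ_le_of_lt hlt)
    rw [Nat.mul_succ] at this; omega

/-- Subtract a multiple of the row at the address in the variable `27` from the row at the address
in the variable `25`, so that the coordinate in the variable `26` becomes zero. -/
def reduceProgram : Program :=
  .seq (.fldOp .div 2 (.const 0) 1 (.add (var 25) (var 26)) 1 (.add (var 27) (var 26))) <|
  .seq (setVar 28 (.const 0)) <|
  .whileLt (var 28) (var 10) <|
    .seq (.fldOp .mul 2 (.const 1) 2 (.const 0) 1 (.add (var 27) (var 28))) <|
    .seq (.fldOp .sub 1 (.add (var 25) (var 28)) 1 (.add (var 25) (var 28)) 2 (.const 1)) <|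
    incVar 28

/-- The scalar is computed before the loop, since the loop overwrites the numerator. The other row
is disjoint from the one being changed and keeps its values. -/
theorem reduceProgram_spec {K c q T : ℕ} {s : Memory F} (h10 : s.nat 10 0 = K)
    (h25 : s.nat 25 0 = c) (h27 : s.nat 27 0 = q) (h26 : s.nat 26 0 = T) (hT : T < K)
    (hc : K ∣ c) (hq : K ∣ q) (hcq : q ≠ c) :
    HaltsIn G reduceProgram s (K * 4 + 3) fun s' =>
      AgreeOff [28] [1, 2] [] s s' ∧
      storedVec K s' c = storedVec K s c -
        (storedVec K s c T / storedVec K s q T) • storedVec K s q ∧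
      ∀ y, (y < c ∨ c + K ≤ y) → s'.fld 1 y = s.fld 1 y := by
  refine .seq_one <| .fldOp <| .seq_one <| .natSet ?_
  simp only [Expr.val, h25, h26, h27, FieldOp.val]
  set a := s.fld 1 (c + T) / s.fld 1 (q + T) with ha
  refine HaltsIn.whileLt K (fun k s' => AgreeOff [28] [1, 2] [] s s' ∧ k ≤ K ∧ s'.nat 28 0 = k ∧
    s'.fld 2 0 = a ∧ (∀ x < k, s'.fld 1 (c + x) = s.fld 1 (c + x) - a * s.fld 1 (q + x)) ∧
    (∀ x < K, k ≤ x → s'.fld 1 (c + x) = s.fld 1 (c + x)) ∧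
    ∀ y, (y < c ∨ c + K ≤ y) → s'.fld 1 y = s.fld 1 y) ?_ ?_ ?_
  · exact ⟨(AgreeOff.refl s).setFld.setNat, Nat.zero_le _, by simp [setCell_apply],
      by simp [setCell_apply], fun x hx => absurd hx (by omega), fun x _ _ => rfl, fun y _ => rfl⟩
  · rintro k s' ⟨hag, hk, hk', h1, h2, h3, h4⟩ hlt
    simp only [Expr.val, hk', hag.n 10, h10] at hlt
    have hqk := h4 (q + k) (row_disjoint hc hq hcq hlt)
    refine ⟨hlt, .seq_one <| .fldOp <| .seq_one <| .fldOp <| .natSet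
      ⟨hag.setFld.setFld.setNat, hlt, ?_, ?_, ?_, ?_, ?_⟩⟩
    · simp [Expr.val, setCell_apply, hk']
    · simp [Expr.val, setCell_apply, h1]
    · intro x hx
      by_cases hxk : x = k
      · subst hxk
        simp [Expr.val, setCell_apply, hk', hag.n 25, h25, hag.n 27, h27, h1, FieldOp.val, hqk,
          h3 x hlt le_rfl]
      · simp [Expr.val, setCell_apply, hk', hag.n 25, h25, hxk, h2 x (by omega)]
    · intro x hx hkx
      have hxk : x ≠ k := by omega
      simp [Expr.val, setCell_apply, hk', hag.n 25, h25, hxk, h3 x hx (by omega)]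
    · intro y hy
      have : y ≠ c + k := by omega
      simp [Expr.val, setCell_apply, hk', hag.n 25, h25, this, h4 y hy]
  · rintro k s' ⟨hag, hk, hk', h1, h2, h3, h4⟩ hlt
    simp only [Expr.val, hk', hag.n 10, h10] at hlt
    obtain rfl : k = K := by omega
    refine ⟨hag, ?_, h4⟩
    funext x
    simp only [storedVec, hT, if_true, Pi.sub_apply, Pi.smul_apply, smul_eq_mul]
    split_ifs with hx
    · rw [h2 x hx]
    · simp

/-- Exchange the carried row with the one that has the current pivot. -/
def swapProgram : Program :=
  .seq (.natSet 7 (var 26) (var 25)) <|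
  .seq (setVar 25 (var 27)) (setVar 27 (.cell 7 (var 26)))

/-- Exchange the carried row with the one that has the current pivot if it is better. -/
def compareProgram : Program :=
  .seq (setVar 27 (.cell 7 (var 26))) <|
  .ifLe 1 (var 25) 1 (var 27)
    (.ifLe 1 (var 27) 1 (var 25) (.ifLt (var 25) (var 27) swapProgram .skip) .skip)
    swapProgram

variable {K : ℕ} {D : Submodule F (ℕ → F)} {orig : ℕ → ℕ → F} {C : Set ℕ}

/-- Afterwards the better row owns the pivot and the worse one is carried, which is what the
reduction requires. Equal weights need the second test and the comparison of addresses. -/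
theorem compareProgram_spec {c T : ℕ} {s : Memory F}
    (h25 : s.nat 25 0 = c) (h26 : s.nat 26 0 = T) (hT : T < K) (hs : s.nat 7 T ≠ 0)
    (h : IsCarrying K (Better (s.wgt 1)) D orig (storedVec K s) C (s.nat 7) c T)
    (h0 : storedVec K s c T ≠ 0) :
    HaltsIn G compareProgram s 7 fun s' =>
      AgreeOff [7, 25, 27] [] [] s s' ∧ ∃ c', s'.nat 25 0 = c' ∧ s'.nat 27 0 = s'.nat 7 T ∧
      s'.nat 7 T ≠ 0 ∧ Better (s.wgt 1) (s'.nat 7 T) c' ∧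
      IsCarrying K (Better (s.wgt 1)) D orig (storedVec K s) C (s'.nat 7) c' T := by
  have hne : s.nat 7 T ≠ c := fun e => h.notMem ⟨h.ne_zero, T, hT, e⟩
  have hswap : Better (s.wgt 1) c (s.nat 7 T) → ∀ B,
      HaltsIn G swapProgram ⟨setCell s.nat 27 0 (s.nat 7 T), s.fld, s.wgt⟩ (B + 3) fun s' =>
      AgreeOff [7, 25, 27] [] [] s s' ∧ ∃ c', s'.nat 25 0 = c' ∧ s'.nat 27 0 = s'.nat 7 T ∧
      s'.nat 7 T ≠ 0 ∧ Better (s.wgt 1) (s'.nat 7 T) c' ∧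
      IsCarrying K (Better (s.wgt 1)) D orig (storedVec K s) C (s'.nat 7) c' T := by
    intro hb B
    refine .seq_one <| .natSet <| .seq_one <| .natSet <| .natSet
      ⟨(AgreeOff.refl s).setNat.setNat.setNat.setNat, s.nat 7 T, ?_⟩
    have := h.swap hT h0 hs
    simp [Expr.val, setCell_apply, setCell_of_ne, setCell_self, h25, h26, h.ne_zero, hb, this]
  have hkeep : Better (s.wgt 1) (s.nat 7 T) c → ∀ B,
      HaltsIn G .skip ⟨setCell s.nat 27 0 (s.nat 7 T), s.fld, s.wgt⟩ (B + 1) fun s' =>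
      AgreeOff [7, 25, 27] [] [] s s' ∧ ∃ c', s'.nat 25 0 = c' ∧ s'.nat 27 0 = s'.nat 7 T ∧
      s'.nat 7 T ≠ 0 ∧ Better (s.wgt 1) (s'.nat 7 T) c' ∧
      IsCarrying K (Better (s.wgt 1)) D orig (storedVec K s) C (s'.nat 7) c' T := by
    intro hb B
    refine .skip ⟨(AgreeOff.refl s).setNat, c, ?_⟩
    simp [setCell_apply, setCell_of_ne, h25, hs, hb, h]
  refine .seq_one <| .natSet ?_
  simp only [Expr.val, h26]
  refine .ifLe ?_ ?_ <;> intro h1 <;> simp [Expr.val, setCell_apply, h25] at h1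
  · refine .ifLe ?_ ?_ <;> intro h2 <;> simp [Expr.val, setCell_apply, h25] at h2
    · refine .ifLt ?_ ?_ <;> intro h3 <;> simp [Expr.val, setCell_apply, h25] at h3
      · exact hswap (Or.inr ⟨le_antisymm h2 h1, h3⟩) 0
      · exact hkeep (Or.inr ⟨le_antisymm h1 h2, by omega⟩) 2
    · exact hkeep (Or.inl h2) 3
  · exact hswap (Or.inl h1) 2

/-- Insert the row at the address in the variable `17` into the table of pivots. -/
def insertProgram : Program :=
  .seq (setVar 25 (var 17)) <|
  .seq (setVar 26 (.const 0)) <|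
  .whileLt (var 26) (var 10) <|
    .seq
      (.ifZero 1 (.add (var 25) (var 26)) .skip <|
        .ifLt (.cell 7 (var 26)) (.const 1)
          (.seq (.natSet 7 (var 26) (var 25)) (setVar 26 (var 10)))
          (.seq compareProgram reduceProgram))
      (incVar 26)

/-- The loop counter is the bound below which the carried row vanishes. Finding a free pivot sets
the counter to `K`; the increment that follows makes it exceed `K`, which distinguishes this exit
from running through all masks. -/
theorem insertProgram_spec {p : ℕ} {s : Memory F} (h10 : s.nat 10 0 = K) (h17 : s.nat 17 0 = p)
    (hC : ∀ c ∈ C, K ∣ c)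
    (h : IsCarrying K (Better (s.wgt 1)) D orig (storedVec K s) C (s.nat 7) p 0) :
    HaltsIn G insertProgram s (K * (K * 4 + 14) + 3) fun s' =>
      AgreeOff [7, 25, 26, 27, 28] [1, 2] [] s s' ∧
      IsPivotTable K (Better (s.wgt 1)) D orig (storedVec K s') C (s'.nat 7) := by
  refine .seq_one <| .natSet <| .seq_one <| .natSet ?_
  refine HaltsIn.whileLt K (fun k s' => AgreeOff [7, 25, 26, 27, 28] [1, 2] [] s s' ∧
    ((s'.nat 26 0 = k ∧ k ≤ K ∧ ∃ c, s'.nat 25 0 = c ∧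
      IsCarrying K (Better (s.wgt 1)) D orig (storedVec K s') C (s'.nat 7) c k) ∨
    (K < s'.nat 26 0 ∧
      IsPivotTable K (Better (s.wgt 1)) D orig (storedVec K s') C (s'.nat 7)))) ?_ ?_ ?_
  · refine ⟨(AgreeOff.refl s).setNat.setNat, Or.inl ⟨by simp [setCell_apply, Expr.val],
      Nat.zero_le _, p, by simp [setCell_apply, Expr.val, h17], ?_⟩⟩
    simp only [setCell_of_ne _ (show (7 : ℕ) ≠ 26 by decide),
      setCell_of_ne _ (show (7 : ℕ) ≠ 25 by decide)]
    exact h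
  · rintro k s' ⟨hag, ⟨hk, hkK, c, h25, hc⟩ | ⟨hk, -⟩⟩ hlt
    · simp only [Expr.val, hk, hag.n 10, h10] at hlt
      refine ⟨hlt, .seq (B₁ := K * 4 + 12) (B₂ := 1) ?_⟩
      have hst : storedVec K s' c k = s'.fld 1 (c + k) := by simp [storedVec, hlt]
      refine .ifZero ?_ ?_
      · intro h0
        simp only [Expr.val, h25, hk] at h0
        refine .skip <| .natSet ⟨hag.setNat, Or.inl ⟨by simp [setCell_apply, Expr.val, hk], hlt, c,
          by simp [setCell_apply, h25], ?_⟩⟩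
        simp only [setCell_of_ne _ (show (7 : ℕ) ≠ 26 by decide)]
        exact hc.skip (hst.trans h0)
      · intro h0
        simp only [Expr.val, h25, hk] at h0
        rw [← hst] at h0
        refine .ifLt ?_ ?_
        · intro h1
          simp only [Expr.val, hk] at h1
          have := hc.place hlt h0 (by omega)
          refine .seq_one <| .natSet <| .natSet <| .natSet
            ⟨hag.setNat.setNat.setNat, Or.inr ⟨?_, ?_⟩⟩
          · simp [setCell_apply, Expr.val, hag.n 10, h10]
          · simp only [setCell_of_ne _ (show (7 : ℕ) ≠ 26 by decide), setCell_self, Expr.val, hk, h25]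
            exact this
        · intro h1
          simp only [Expr.val, hk] at h1
          have hw : s'.wgt 1 = s.wgt 1 := hag.w 1
          -- The budget splits into 7 steps for the comparison and `K * 4 + 3` for the reduction.
          rw [show K * 4 + 10 = 7 + (K * 4 + 3) by omega]
          refine .seq <| (compareProgram_spec (D := D) (orig := orig) (C := C) (K := K) h25 hk hlt
            (by omega) (hw ▸ hc) h0).mono le_rfl ?_
          rintro s₂ ⟨hag2, c', h25', h27, hs2, hb, hc'⟩
          rw [hw] at hb hc'
          have hag2' := hag.trans hag2
          have hcC : c' ∈ C := hc'.basis.sub (Or.inl rfl)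
          have hqC : s₂.nat 7 k ∈ C := hc'.basis.sub (Or.inr ⟨hs2, k, hlt, rfl⟩)
          have hne : s₂.nat 7 k ≠ c' := fun e => hc'.notMem ⟨hc'.ne_zero, k, hlt, e⟩
          have hcur : storedVec K s₂ = storedVec K s' := by
            funext q; unfold storedVec; rw [hag2.f 1]
          refine (reduceProgram_spec (K := K) (T := k) ((hag2'.n 10).symm ▸ h10) h25' h27
            (by rw [hag2.n 26, hk]) hlt (hC _ hcC) (hC _ hqC) hne).mono le_rfl ?_
          rintro s₃ ⟨hag3, hv, hrest⟩
          have hred := hc'.reduce (Better.trans _) hlt hs2 hb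
          refine .natSet ⟨(hag2'.trans hag3).setNat, Or.inl ⟨?_, hlt, c', ?_, ?_⟩⟩
          · simp [setCell_apply, Expr.val, hag3.n 26, hag2.n 26, hk]
          · simp [setCell_apply, hag3.n 25, h25']
          · have h7 : s₃.nat 7 = s₂.nat 7 := hag3.n 7
            simp only [setCell_of_ne _ (show (7 : ℕ) ≠ 26 by decide), h7]
            refine hred.congr fun q hq => ?_
            by_cases e : q = c'
            · subst e
              rw [Function.update_self, ← hcur, ← hv]; rfl
            · rw [Function.update_of_ne e, ← hcur]
              have hqC : q ∈ C := hred.basis.sub hq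
              funext x
              show (if x < K then s₃.fld 1 (q + x) else 0) = storedVec K s₂ q x
              unfold storedVec
              split_ifs with hx
              · exact hrest _ (row_disjoint (hC _ hcC) (hC _ hqC) e hx)
              · rfl
    · simp only [Expr.val, hag.n 10, h10] at hlt
      omega
  · rintro k s' ⟨hag, ⟨hk, hkK, c, h25, hc⟩ | ⟨hk, hc⟩⟩ hlt
    · simp only [Expr.val, hk, hag.n 10, h10] at hlt
      obtain rfl : k = K := by omega
      -- The counter reached `K` without a placement, so the carried row has become zero and is
      -- redundant.
      refine ⟨hag, hc.finish (Better.trans _) (Better.irrefl _) ?_⟩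
      funext x
      by_cases hx : x < k
      · exact hc.low x hx
      · simp [storedVec, hx]
    · exact ⟨hag, hc⟩

end CandidatePrograms

end RepFamilies

namespace RepFamilies

section LevelPrograms

/-! ### Programs for the levels -/

variable {F : Type u} [Field F] {G : ℝ → ℕ → ℝ}

/-- The labels of the `h`-th member of the family. -/
def familyLabels (s : Memory F) (γ h : ℕ) : List ℕ := (List.range γ).map fun j => s.nat 1 (h * γ + j)

/-- Process one candidate. -/
def candidateProgram : Program :=
  .seq buildProgram <| .seq productProgram <| .seq insertProgram <|
  .seq (setVar 17 (.add (var 17) (var 10))) (setVar 23 (.add (var 23) (.cell 0 (.const 3))))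

/-- At the start of a level, `k` rows of length `d` are listed in the array `6`. -/
structure IsListing (r d γ k t : ℕ) (s : Memory F) : Prop where
  tables : HasTables r s
  gamma : s.nat 0 3 = γ
  card : s.nat 0 5 = t
  length : s.nat 18 0 = d
  count : s.nat 32 0 = k
  pos : 0 < s.nat 17 0
  dvd : 2 ^ r ∣ s.nat 17 0
  rows : ∀ j < k, 2 ^ r ∣ s.nat 6 j ∧ s.nat 6 j < s.nat 17 0

/-- The row `c` of `s` is the union of the row `j` of `s₀` and of the `h`-th member of the family. -/
structure IsCandidate (G : ℝ → ℕ → ℝ) (d γ : ℕ) (s₀ s : Memory F) (c j h : ℕ) : Prop where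
  labels : rowLabels s c (d + γ) = rowLabels s₀ (s₀.nat 6 j) d ++ familyLabels s₀ γ h
  weight : s.wgt 1 c = G (s₀.wgt 1 (s₀.nat 6 j)) h

/-- The candidates in `C` have been processed; they comprise those described by `proc`. -/
structure IsStage (G : ℝ → ℕ → ℝ) (r d γ k t : ℕ) (s₀ s : Memory F) (C : Set ℕ)
    (proc : ℕ → ℕ → Prop) : Prop where
  agree : AgreeOff [5, 7, 12, 13, 14, 15, 16, 17, 19, 20, 21, 22, 23, 24, 25, 26, 27, 28, 30, 31]
    [1, 2] [1] s₀ s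
  le : s₀.nat 17 0 ≤ s.nat 17 0
  dvd : 2 ^ r ∣ s.nat 17 0
  labels : ∀ q < s₀.nat 17 0, s.nat 5 q = s₀.nat 5 q
  weights : ∀ q < s₀.nat 17 0, s.wgt 1 q = s₀.wgt 1 q
  mem : ∀ c ∈ C, 2 ^ r ∣ c ∧ c < s.nat 17 0 ∧ ∃ j < k, ∃ h < t, IsCandidate G d γ s₀ s c j h
  all : ∀ j h, proc j h → ∃ c ∈ C, IsCandidate G d γ s₀ s c j h
  table : IsPivotTable (2 ^ r) (Better (s.wgt 1)) (degreeSubmodule F r (d + γ))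
    (fun c => storedProduct r s₀ (rowLabels s c (d + γ))) (storedVec (2 ^ r) s) C (s.nat 7)

theorem add_le_of_dvd_of_lt {K a b : ℕ} (ha : K ∣ a) (hb : K ∣ b) (h : a < b) : a + K ≤ b := by
  have := Nat.le_of_dvd (by omega) (Nat.dvd_sub hb ha)
  omega

/-- With `d + γ ≤ r < 2 ^ r`, all costs of building, multiplying and inserting are bounded by cubic
polynomials in `2 ^ r`. -/
theorem candidate_bound {r d γ : ℕ} (h : d + γ ≤ r) :
    d * 3 + γ * 3 + 5 + (2 ^ r * 3 + 1 + 1 + 1 + 1 + ((d + γ) * (r * 3 + 2 ^ r * (r * 6 + 7) + 8) + 1) +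
      (2 ^ r * (2 ^ r * 4 + 14) + 3 + 2)) ≤ 64 * (2 ^ r) ^ 3 := by
  have hr : r < 2 ^ r := Nat.lt_two_pow_self
  generalize 2 ^ r = K at *
  have h1 : (d + γ) * (r * 3 + K * (r * 6 + 7) + 8) ≤ K * (K * 3 + K * (K * 6 + 7) + 8) := by
    have := hr.le
    have : d + γ ≤ K := by omega
    gcongr
  have hK : K ≤ K ^ 2 := Nat.le_self_pow (by norm_num) K
  have hK2 : K ^ 2 ≤ K ^ 3 := Nat.pow_le_pow_right (by omega) (by norm_num)
  have e1 : K * (K * 3 + K * (K * 6 + 7) + 8) = 6 * K ^ 3 + 10 * K ^ 2 + 8 * K := by ring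
  have e2 : K * (K * 4 + 14) = 4 * K ^ 2 + 14 * K := by ring
  omega

/-- The new row lies behind all earlier ones and leaves them intact. The original vectors are
expressed through the row labels because elimination overwrites the stored coordinates but never the
labels. -/
theorem candidateProgram_spec {r d γ k t j h : ℕ} {s₀ s : Memory F} {C : Set ℕ}
    {proc : ℕ → ℕ → Prop} (h₀ : IsListing r d γ k t s₀) (h37 : s₀.nat 37 0 = d + γ)
    (hr : d + γ ≤ r) (hs : IsStage G r d γ k t s₀ s C proc) (hj : j < k) (hh : h < t)
    (h22 : s.nat 22 0 = s₀.nat 6 j) (h23 : s.nat 23 0 = h * γ) (h31 : s.nat 31 0 = h) :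
    HaltsIn G candidateProgram s (64 * (2 ^ r) ^ 3) fun s' =>
      AgreeOff [5, 7, 12, 13, 14, 15, 16, 17, 19, 20, 21, 23, 24, 25, 26, 27, 28] [1, 2] [1] s s' ∧
      s'.nat 23 0 = (h + 1) * γ ∧
      ∃ C', IsStage G r d γ k t s₀ s' C' fun j' h' => proc j' h' ∨ (j' = j ∧ h' = h) := by
  refine HaltsIn.mono ?_ (candidate_bound hr) fun _ h => h
  have hrK : r < 2 ^ r := Nat.lt_two_pow_self
  obtain ⟨p, hp⟩ : ∃ p, s.nat 17 0 = p := ⟨_, rfl⟩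
  have hrow := h₀.rows j hj
  have hrow' := add_le_of_dvd_of_lt hrow.1 h₀.dvd hrow.2
  have hle := hs.le
  have hdvd := hs.dvd
  rw [hp] at hle hdvd
  -- In the table of pivots, address 0 marks a free entry, so no candidate may be stored there.
  have hp0 : p ≠ 0 := by have := h₀.pos; omega
  have hts := h₀.tables.of_agreeOff hs.agree
  have hCp : ∀ c ∈ C, c + 2 ^ r ≤ p := fun c hc => by
    have := hs.mem c hc
    rw [hp] at this
    exact add_le_of_dvd_of_lt this.1 hdvd this.2.1
  have hpC : p ∉ C := fun hc => by have := hCp p hc; omega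
  refine .seq <| (buildProgram_spec (p := p) (d := d) (γ := γ) hp
    (by rw [hs.agree.n 18, h₀.length]) (by rw [hs.agree.n 0, h₀.gamma]) h22 h23 h31
    (by omega)).mono le_rfl ?_
  rintro s₁ ⟨ha1, hl1, hw1, hn1, hW1⟩
  have hts1 := hts.of_agreeOff ha1
  refine .seq <| (productProgram_spec (p := p) (d := d + γ) hts1 (by rw [ha1.n 17, hp])
    (by rw [ha1.n 37, hs.agree.n 37, h37])).mono le_rfl ?_
  rintro s₂ ⟨ha2, hv2, hf2⟩
  have ha12 : AgreeOff [5, 12, 13, 14, 15, 16, 19, 20, 21, 24] [1, 2] [1] s s₂ :=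
    ((AgreeOff.refl s).trans ha1).trans ha2
  have h52 : s₂.nat 5 = s₁.nat 5 := ha2.n 5
  have hw2 : s₂.wgt 1 = s₁.wgt 1 := ha2.w 1
  have hrl : ∀ c, rowLabels s₂ c (d + γ) = rowLabels s₁ c (d + γ) := fun c => by
    unfold rowLabels; rw [h52]
  have hrlC : ∀ c ∈ C, rowLabels s₂ c (d + γ) = rowLabels s c (d + γ) := fun c hc => by
    rw [hrl]
    exact rowLabels_congr fun i hi => hn1 _ (by have := hCp c hc; omega)
  have hwC : ∀ c ∈ C, s₂.wgt 1 c = s.wgt 1 c := fun c hc => by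
    rw [hw2]; exact hW1 c fun e => hpC (e ▸ hc)
  have hfld0 : s₁.fld 0 = s₀.fld 0 := by rw [ha1.f 0, hs.agree.f 0]
  have hnew : rowLabels s₂ p (d + γ) = rowLabels s₀ (s₀.nat 6 j) d ++ familyLabels s₀ γ h := by
    rw [hrl, hl1]
    congr 1
    · exact rowLabels_congr fun i hi => hs.labels _ (by omega)
    · unfold familyLabels; rw [hs.agree.n 1]
  have hneww : s₂.wgt 1 p = G (s₀.wgt 1 (s₀.nat 6 j)) h := by
    rw [hw2, hw1, hs.weights _ hrow.2]
  have htab := hs.table.congr (better' := Better (s₂.wgt 1))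
    (orig' := fun c => storedProduct r s₀ (rowLabels s₂ c (d + γ)))
    (cur' := storedVec (2 ^ r) s₂)
    (fun a ha b hb => by unfold Better; rw [hwC a ha, hwC b hb])
    (fun c hc => by simp only [hrlC c hc])
    (fun q hq => by
      have hqp := hCp q (hs.table.basis.sub hq)
      funext x
      unfold storedVec
      split_ifs with hx
      · rw [hf2 _ (Or.inl (by omega)), ha1.f 1]
      · rfl)
  have hcarry := htab.carry hp0 hpC (by
      show _ = storedProduct r s₀ (rowLabels s₂ p (d + γ))
      rw [hv2, hrl, storedProduct_congr hfld0]) (by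
      have := storedProduct_mem r s₀ (rowLabels s₂ p (d + γ))
      simpa [rowLabels] using this)
  have h7 : s₂.nat 7 = s.nat 7 := ha12.n 7
  rw [← h7] at hcarry
  refine .seq <| (insertProgram_spec (K := 2 ^ r) (by rw [ha12.n 10, hts.size])
    (by rw [ha12.n 17, hp]) ?_ hcarry).mono le_rfl ?_
  · rintro c (rfl | hc)
    · exact hdvd
    · exact (hs.mem c hc).1
  rintro s₃ ⟨ha3, htab3⟩
  have ha13 : AgreeOff [5, 7, 12, 13, 14, 15, 16, 17, 19, 20, 21, 23, 24, 25, 26, 27, 28] [1, 2] [1]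
      s s₃ := ((AgreeOff.refl s).trans ha12).trans ha3
  have h17 : s₃.nat 17 0 = p := by rw [ha3.n 17, ha12.n 17, hp]
  have hag := ha13.setNat (a := 17) (i := 0) (x := p + 2 ^ r) |>.setNat (a := 23) (i := 0)
    (x := h * γ + γ)
  have h23' : s₃.nat 23 0 = h * γ := by rw [ha3.n 23, ha12.n 23, h23]
  have h10 : s₃.nat 10 0 = 2 ^ r := by rw [ha3.n 10, ha12.n 10, hts.size]
  have h03 : s₃.nat 0 3 = γ := by rw [ha3.n 0, ha12.n 0, hs.agree.n 0, h₀.gamma]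
  refine .seq_one <| .natSet <| .natSet ?_
  simp only [Expr.val, h17, h10, setCell_apply, h23', h03, and_self, if_true,
    show (23 : ℕ) ≠ 17 by decide, show (0 : ℕ) ≠ 17 by decide, false_and, if_false]
  refine ⟨hag, by simp [Nat.succ_mul], insert p C, ?_⟩
  have hcand : ∀ c j' h', IsCandidate G d γ s₀ s₂ c j' h' → IsCandidate G d γ s₀
      ⟨setCell (setCell s₃.nat 17 0 (p + 2 ^ r)) 23 0 (h * γ + γ), s₃.fld, s₃.wgt⟩ c j' h' := by
    rintro c j' h' ⟨h1, h2⟩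
    refine ⟨?_, ?_⟩
    · rw [← h1]
      exact rowLabels_congr fun i _ => by simp [setCell_apply, ha3.n 5]
    · rw [← h2]; show s₃.wgt 1 c = _; rw [ha3.w 1]
  have hcandC : ∀ c ∈ C, ∀ j' h', IsCandidate G d γ s₀ s c j' h' → IsCandidate G d γ s₀ s₂ c j' h' :=
    fun c hc j' h' h => ⟨by rw [hrlC c hc]; exact h.labels, by rw [hwC c hc]; exact h.weight⟩
  refine ⟨hs.agree.trans hag, ?_, ?_, ?_, ?_, ?_, ?_, ?_⟩
  · simp [setCell_apply]; omega
  · simpa [setCell_apply] using hdvd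
  · intro q hq
    simp only [setCell_of_ne _ (show (5 : ℕ) ≠ 23 by decide),
      setCell_of_ne _ (show (5 : ℕ) ≠ 17 by decide)]
    rw [ha3.n 5, h52, hn1 q (by omega), hs.labels q hq]
  · intro q hq
    show s₃.wgt 1 q = _
    rw [ha3.w 1, hw2, hW1 q (by omega), hs.weights q hq]
  · rintro c (rfl | hc)
    · exact ⟨hdvd, by simp [setCell_apply], j, hj, h, hh, hcand _ _ _ ⟨hnew, hneww⟩⟩
    · obtain ⟨h1, h2, j', hj', h', hh', h3⟩ := hs.mem c hc
      rw [hp] at h2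
      exact ⟨h1, by simp [setCell_apply]; omega, j', hj', h', hh', hcand _ _ _ (hcandC c hc _ _ h3)⟩
  · rintro j' h' (hproc | ⟨rfl, rfl⟩)
    · obtain ⟨c, hc, h3⟩ := hs.all j' h' hproc
      exact ⟨c, Or.inr hc, hcand _ _ _ (hcandC c hc _ _ h3)⟩
    · exact ⟨p, Or.inl rfl, hcand _ _ _ ⟨hnew, hneww⟩⟩
  · simp only [setCell_of_ne _ (show (7 : ℕ) ≠ 23 by decide),
      setCell_of_ne _ (show (7 : ℕ) ≠ 17 by decide)]
    refine htab3.congr (fun a _ b _ => by rw [ha3.w 1]) (fun c _ => ?_) (fun _ _ => rfl)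
    congr 1
    exact rowLabels_congr fun i _ => by simp [setCell_apply, ha3.n 5]

/-- Process all candidates of a level. -/
def candidatesProgram : Program :=
  .seq (setVar 30 (.const 0)) <|
  .whileLt (var 30) (var 32) <|
    .seq (setVar 22 (.cell 6 (var 30))) <|
    .seq (setVar 23 (.const 0)) <|
    .seq (setVar 31 (.const 0)) <|
    .seq (.whileLt (var 31) (.cell 0 (.const 5)) (.seq candidateProgram (incVar 31)))
      (incVar 30)

theorem IsStage.setNat {r d γ k t : ℕ} {s₀ s : Memory F} {C : Set ℕ}
    {proc : ℕ → ℕ → Prop} (h : IsStage G r d γ k t s₀ s C proc) {a x : ℕ}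
    (ha : a ∈ [22, 23, 30, 31]) :
    IsStage G r d γ k t s₀ ⟨setCell s.nat a 0 x, s.fld, s.wgt⟩ C proc := by
  have h5 : 5 ≠ a := by rintro rfl; simp at ha
  have h7 : 7 ≠ a := by rintro rfl; simp at ha
  have h17 : 17 ≠ a := by rintro rfl; simp at ha
  have hl : ∀ c, rowLabels (⟨setCell s.nat a 0 x, s.fld, s.wgt⟩ : Memory F) c (d + γ) =
      rowLabels s c (d + γ) := fun c => rowLabels_congr fun i _ => by simp [setCell_of_ne _ h5]
  have hc : ∀ c j h, IsCandidate G d γ s₀ s c j h →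
      IsCandidate G d γ s₀ ⟨setCell s.nat a 0 x, s.fld, s.wgt⟩ c j h :=
    fun c j h hh => ⟨(hl c).trans hh.labels, hh.weight⟩
  refine ⟨h.agree.setNat ((by decide : [22, 23, 30, 31] ⊆ [5, 7, 12, 13, 14, 15, 16, 17, 19, 20, 21, 22, 23,
    24, 25, 26, 27, 28, 30, 31]) ha), ?_, ?_, ?_, h.weights, ?_, ?_, ?_⟩
  · simpa [setCell_of_ne _ h17] using h.le
  · simpa [setCell_of_ne _ h17] using h.dvd
  · simpa [setCell_of_ne _ h5] using h.labels
  · intro c hcC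
    obtain ⟨h1, h2, j, hj, i, hi, h3⟩ := h.mem c hcC
    exact ⟨h1, by simpa [setCell_of_ne _ h17] using h2, j, hj, i, hi, hc _ _ _ h3⟩
  · intro j i hp
    obtain ⟨c, hcC, h3⟩ := h.all j i hp
    exact ⟨c, hcC, hc _ _ _ h3⟩
  · simp only [setCell_of_ne _ h7]
    exact h.table.congr (fun _ _ _ _ => Iff.rfl) (fun c _ => by rw [hl]) fun _ _ => rfl

theorem candidatesProgram_spec {r d γ k t : ℕ} {s₀ : Memory F} (h₀ : IsListing r d γ k t s₀)
    (h37 : s₀.nat 37 0 = d + γ) (hr : d + γ ≤ r) (h7 : ∀ T < 2 ^ r, s₀.nat 7 T = 0) :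
    HaltsIn G candidatesProgram s₀ (k * (t * (64 * (2 ^ r) ^ 3 + 2) + 6) + 2) fun s =>
      ∃ C, IsStage G r d γ k t s₀ s C fun j h => j < k ∧ h < t := by
  refine .seq_one <| .natSet ?_
  refine HaltsIn.whileLt k (fun j s => s.nat 30 0 = j ∧ j ≤ k ∧
    ∃ C, IsStage G r d γ k t s₀ s C fun j' h' => j' < j ∧ h' < t) ?_ ?_ ?_
  · refine ⟨by simp [setCell_apply, Expr.val], Nat.zero_le _, ∅, IsStage.setNat ?_ (by decide)⟩
    have hlive : live (2 ^ r) (s₀.nat 7) = ∅ := by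
      ext q
      simp only [live, Set.mem_ofPred_eq, Set.mem_empty_iff_false, iff_false]
      rintro ⟨h1, T, hT, rfl⟩
      exact h1 (h7 T hT)
    refine ⟨AgreeOff.refl _, le_rfl, h₀.dvd, fun _ _ => rfl, fun _ _ => rfl, by simp, by simp,
      ?_, ?_, ?_⟩
    · rw [hlive]; exact IsWeightedBasis.empty
    · intro T hT hne; exact absurd (h7 T hT) hne
    · rw [hlive]; simp
  · rintro j s ⟨h30, hj, C, hs⟩ hlt
    simp only [Expr.val, h30, hs.agree.n 32, h₀.count] at hlt
    refine ⟨hlt, HaltsIn.mono (B₁ := (t * (64 * (2 ^ r) ^ 3 + 2) + 1 + 1) + 1 + 1 + 1) ?_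
      (by omega) fun _ h => h⟩
    refine .seq_one <| .natSet <| .seq_one <| .natSet <| .seq_one <| .natSet <|
      .seq (B₁ := t * (64 * (2 ^ r) ^ 3 + 2) + 1) (B₂ := 1) ?_
    -- The processed pairs are those that precede `(j, h)` lexicographically.
    refine HaltsIn.whileLt t (fun h s => s.nat 30 0 = j ∧ s.nat 31 0 = h ∧ s.nat 23 0 = h * γ ∧
      s.nat 22 0 = s₀.nat 6 j ∧ h ≤ t ∧
      ∃ C, IsStage G r d γ k t s₀ s C fun j' h' => (j' < j ∧ h' < t) ∨ (j' = j ∧ h' < h)) ?_ ?_ ?_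
    · refine ⟨?_, ?_, ?_, ?_, Nat.zero_le _, C, ?_⟩
      · simp [setCell_apply, h30]
      · simp [setCell_apply, Expr.val]
      · simp [setCell_apply, Expr.val]
      · simp [setCell_apply, Expr.val, h30, hs.agree.n 6]
      · simp only [not_lt_zero, and_false, or_false]
        exact ((hs.setNat (a := 22) (by decide)).setNat (a := 23) (by decide)).setNat
          (a := 31) (by decide)
    · rintro h s' ⟨h30, h31, h23, h22, hh, C, hs⟩ hlt'
      simp only [Expr.val, h31, hs.agree.n 0, h₀.card] at hlt'
      refine ⟨hlt', .seq <| (candidateProgram_spec h₀ h37 hr hs hlt hlt' h22 h23 h31).mono le_rfl ?_⟩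
      rintro s'' ⟨hag, h23', C', hs'⟩
      refine .natSet ⟨?_, ?_, ?_, ?_, hlt', C', ?_⟩
      · simp [setCell_apply, hag.n 30, h30]
      · simp [setCell_apply, Expr.val, hag.n 31, h31]
      · simp [setCell_apply, h23']
      · simp [setCell_apply, hag.n 22, h22]
      · have := hs'.setNat (a := 31) (x := h + 1) (by decide)
        simp only [Expr.val, hag.n 31, h31]
        refine { this with all := fun j' h' hjh => this.all j' h' ?_ }
        rcases hjh with h1 | ⟨h1, h2⟩
        · exact Or.inl (Or.inl h1)
        · rcases Nat.lt_succ_iff_lt_or_eq.1 h2 with h2 | h2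
          · exact Or.inl (Or.inr ⟨h1, h2⟩)
          · exact Or.inr ⟨h1, h2⟩
    · rintro h s' ⟨h30, h31, h23, h22, hh, C, hs⟩ hlt'
      simp only [Expr.val, h31, hs.agree.n 0, h₀.card] at hlt'
      obtain rfl : h = t := by omega
      refine .natSet ⟨by simp [setCell_apply, Expr.val, h30], hlt, C, ?_⟩
      have := hs.setNat (a := 30) (x := j + 1) (by decide)
      simp only [Expr.val, h30]
      refine { this with all := fun j' h' hjh => this.all j' h' ?_ }
      rcases Nat.lt_succ_iff_lt_or_eq.1 hjh.1 with h2 | h2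
      · exact Or.inl ⟨h2, hjh.2⟩
      · exact Or.inr ⟨h2, hjh.2⟩
  · rintro j s ⟨h30, hj, C, hs⟩ hlt
    simp only [Expr.val, h30, hs.agree.n 32, h₀.count] at hlt
    obtain rfl : j = k := by omega
    exact ⟨C, hs⟩

/-! ### From the table of pivots to the next level -/

/-- List the rows that have a pivot. -/
def collectProgram : Program :=
  .seq (setVar 32 (.const 0)) <|
  .seq (setVar 33 (.const 0)) <|
  .whileLt (var 33) (var 10) <|
    .seq (.ifLt (.cell 7 (var 33)) (.const 1) .skip <|
      .seq (.natSet 6 (var 32) (.cell 7 (var 33))) (incVar 32))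
    (incVar 33)

/-- Scanning the masks upward lists the pivots in increasing order; this order yields both the
independence and the count of the rows. -/
theorem collectProgram_spec {K : ℕ} {s : Memory F} (h10 : s.nat 10 0 = K) :
    HaltsIn G collectProgram s (K * 5 + 3) fun s' =>
      AgreeOff [6, 32, 33] [] [] s s' ∧ ∃ (k : ℕ) (τ : ℕ → ℕ), s'.nat 32 0 = k ∧
        (∀ i j, i < j → j < k → τ i < τ j) ∧ (∀ j < k, s'.nat 6 j = s.nat 7 (τ j)) ∧
        ∀ T, (∃ j < k, τ j = T) ↔ T < K ∧ s.nat 7 T ≠ 0 := by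
  refine .seq_one <| .natSet <| .seq_one <| .natSet ?_
  refine HaltsIn.whileLt K (fun m s' => AgreeOff [6, 32, 33] [] [] s s' ∧ s'.nat 33 0 = m ∧ m ≤ K ∧
    ∃ (k : ℕ) (τ : ℕ → ℕ), s'.nat 32 0 = k ∧
      (∀ i j, i < j → j < k → τ i < τ j) ∧ (∀ j < k, s'.nat 6 j = s.nat 7 (τ j)) ∧
      ∀ T, (∃ j < k, τ j = T) ↔ T < m ∧ s.nat 7 T ≠ 0) ?_ ?_ ?_
  · refine ⟨(AgreeOff.refl s).setNat.setNat, by simp [setCell_apply, Expr.val], Nat.zero_le _,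
      0, id, by simp [setCell_apply, Expr.val], by simp, by simp, by simp⟩
  · rintro m s' ⟨hag, h33, hm, k, τ, h32, h1, h2, h3⟩ hlt
    simp only [Expr.val, h33, hag.n 10, h10] at hlt
    refine ⟨hlt, .seq (B₁ := 3) (B₂ := 1) <| .ifLt ?_ ?_⟩
    · intro h
      simp only [Expr.val, h33, hag.n 7] at h
      refine .skip <| .natSet ⟨hag.setNat, by simp [setCell_apply, Expr.val, h33], hlt, k, τ,
        by simp [setCell_apply, h32], h1, by simpa [setCell_apply] using h2, fun T => ?_⟩
      rw [h3]
      constructor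
      · rintro ⟨h4, h5⟩; exact ⟨by omega, h5⟩
      · rintro ⟨h4, h5⟩
        refine ⟨?_, h5⟩
        by_contra h6
        obtain rfl : T = m := by omega
        omega
    · intro h
      simp only [Expr.val, h33, hag.n 7] at h
      refine .seq_one <| .natSet <| .natSet <| .natSet ⟨hag.setNat.setNat.setNat,
        by simp [setCell_apply, Expr.val, h33], hlt, k + 1, Function.update τ k m, ?_, ?_, ?_, ?_⟩
      · simp [setCell_apply, Expr.val, h32]
      · intro i j hij hj
        rw [Function.update_of_ne (by omega)]
        by_cases hjk : j = k
        · subst hjk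
          rw [Function.update_self]
          exact ((h3 _).1 ⟨i, hij, rfl⟩).1
        · rw [Function.update_of_ne hjk]; exact h1 i j hij (by omega)
      · intro j hj
        by_cases hjk : j = k
        · subst hjk
          simp [setCell_apply, Expr.val, h32, h33, hag.n 7]
        · rw [Function.update_of_ne hjk]
          simpa [setCell_apply, Expr.val, h32, hjk] using h2 j (by omega)
      · intro T
        constructor
        · rintro ⟨j, hj, rfl⟩
          by_cases hjk : j = k
          · subst hjk; rw [Function.update_self]; exact ⟨by omega, by omega⟩
          · rw [Function.update_of_ne hjk]
            have := (h3 _).1 ⟨j, by omega, rfl⟩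
            exact ⟨by omega, this.2⟩
        · rintro ⟨h4, h5⟩
          rcases Nat.lt_succ_iff_lt_or_eq.1 h4 with h4 | rfl
          · obtain ⟨j, hj, rfl⟩ := (h3 T).2 ⟨h4, h5⟩
            exact ⟨j, by omega, Function.update_of_ne (by omega) _ _⟩
          · exact ⟨k, by omega, Function.update_self ..⟩
  · rintro m s' ⟨hag, h33, hm, k, τ, h32, h1, h2, h3⟩ hlt
    simp only [Expr.val, h33, hag.n 10, h10] at hlt
    obtain rfl : m = K := by omega
    exact ⟨hag, k, τ, h32, h1, h2, h3⟩

/-- One level of the algorithm. -/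
def levelProgram : Program :=
  .seq (setVar 33 (.const 0)) <|
  .seq (.whileLt (var 33) (var 10) (.seq (.natSet 7 (var 33) (.const 0)) (incVar 33))) <|
  .seq (setVar 37 (.add (var 18) (.cell 0 (.const 3)))) <|
  .seq candidatesProgram <|
  .seq collectProgram <|
  setVar 18 (var 37)

/-- The conclusion speaks only of labels, weights and exterior products of the columns, so it has
the form needed for `IsLevel.succ` and the eliminated coordinates can be forgotten. -/
theorem levelProgram_spec {r d γ k t : ℕ} {s : Memory F} (h : IsListing r d γ k t s)
    (hr : d + γ ≤ r) :
    HaltsIn G levelProgram s (k * (t * (64 * (2 ^ r) ^ 3 + 2) + 6) + 2 ^ r * 8 + 10) fun s' =>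
      AgreeOff [5, 6, 7, 12, 13, 14, 15, 16, 17, 18, 19, 20, 21, 22, 23, 24, 25, 26, 27, 28, 30, 31,
        32, 33, 37] [1, 2] [1] s s' ∧
      ∃ k', IsListing r (d + γ) γ k' t s' ∧ k' ≤ r.choose (d + γ) ∧
        (∀ j' < k', ∃ j < k, ∃ h < t, IsCandidate G d γ s s' (s'.nat 6 j') j h) ∧
        (LinearIndependent F fun j' : Fin k' =>
          storedProduct r s (rowLabels s' (s'.nat 6 j') (d + γ))) ∧
        ∀ j < k, ∀ h < t,
          storedProduct r s (rowLabels s (s.nat 6 j) d ++ familyLabels s γ h) ∈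
            Submodule.span F ((fun j' : Fin k' =>
              storedProduct r s (rowLabels s' (s'.nat 6 j') (d + γ))) ''
              {j' | G (s.wgt 1 (s.nat 6 j)) h ≤ s'.wgt 1 (s'.nat 6 j')}) := by
  refine HaltsIn.mono (B₁ := 2 ^ r * (2 + 1) + 1 + ((k * (t * (64 * (2 ^ r) ^ 3 + 2) + 6) + 2) +
    ((2 ^ r * 5 + 3) + 1) + 1) + 1) ?_ (by omega) fun _ h => h
  refine .seq_one <| .natSet <| .seq ?_
  refine HaltsIn.whileLt (2 ^ r) (fun m s' => AgreeOff [7, 33] [] [] s s' ∧ s'.nat 33 0 = m ∧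
    m ≤ 2 ^ r ∧ ∀ T < m, s'.nat 7 T = 0) ?_ ?_ ?_
  · exact ⟨(AgreeOff.refl s).setNat, by simp [setCell_apply, Expr.val], Nat.zero_le _, by simp⟩
  · rintro m s' ⟨hag, h33, hm, h7⟩ hlt
    simp only [Expr.val, h33, hag.n 10, h.tables.size] at hlt
    refine ⟨hlt, .seq_one <| .natSet <| .natSet ⟨hag.setNat.setNat,
      by simp [setCell_apply, Expr.val, h33], hlt, fun T hT => ?_⟩⟩
    simp only [Expr.val, h33, setCell_apply, true_and, show (7 : ℕ) ≠ 33 by decide, false_and,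
      if_false]
    split_ifs with hTm
    · rfl
    · exact h7 T (by omega)
  rintro m s₁ ⟨ha1, h33, hm, h7⟩ hlt
  simp only [Expr.val, h33, ha1.n 10, h.tables.size] at hlt
  obtain rfl : m = 2 ^ r := by omega
  refine .seq_one <| .natSet ?_
  simp only [Expr.val, ha1.n 18, h.length, ha1.n 0, h.gamma]
  obtain ⟨s₂, hs2⟩ : ∃ s₂ : Memory F, s₂ = ⟨setCell s₁.nat 37 0 (d + γ), s₁.fld, s₁.wgt⟩ := ⟨_, rfl⟩
  have ha2 : AgreeOff [7, 33, 37] [] [] s s₂ := by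
    rw [hs2]; exact ((AgreeOff.refl s).trans ha1).setNat
  have h37 : s₂.nat 37 0 = d + γ := by rw [hs2]; simp [setCell_apply]
  have h72 : ∀ T < 2 ^ r, s₂.nat 7 T = 0 := by rw [hs2]; simpa [setCell_apply] using h7
  rw [← hs2]
  have hl2 : IsListing r d γ k t s₂ :=
    ⟨h.tables.of_agreeOff ha2, by rw [ha2.n 0, h.gamma], by rw [ha2.n 0, h.card],
      by rw [ha2.n 18, h.length], by rw [ha2.n 32, h.count], by rw [ha2.n 17]; exact h.pos,
      by rw [ha2.n 17]; exact h.dvd, by rw [ha2.n 17, ha2.n 6]; exact h.rows⟩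
  refine .seq <| (candidatesProgram_spec hl2 h37 hr h72).mono le_rfl ?_
  rintro s₃ ⟨C, hs3⟩
  have ha3 := hs3.agree
  refine .seq <| (collectProgram_spec (K := 2 ^ r) (by rw [ha3.n 10, hl2.tables.size])).mono le_rfl ?_
  rintro s₄ ⟨ha4, k', τ, h32, hτ, h6, hT⟩
  have ha24 : AgreeOff [5, 6, 7, 12, 13, 14, 15, 16, 17, 18, 19, 20, 21, 22, 23, 24, 25, 26, 27, 28,
      30, 31, 32, 33, 37] [1, 2] [1] s s₄ := (((AgreeOff.refl s).trans ha2).trans ha3).trans ha4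
  have hcand : ∀ c j h, IsCandidate G d γ s₂ s₃ c j h → ∀ x, IsCandidate G d γ s
      ⟨setCell s₄.nat 18 0 x, s₄.fld, s₄.wgt⟩ c j h := by
    rintro c j h ⟨h1, h2⟩ x
    constructor
    · rw [rowLabels_congr (s := s₃) (c := c)
        fun i _ => by simp [setCell_apply, ha4.n 5], h1]
      unfold rowLabels familyLabels
      rw [ha2.n 5, ha2.n 6, ha2.n 1]
    · show s₄.wgt 1 c = _
      rw [ha4.w 1, h2, ha2.w 1, ha2.n 6]
  have hmemC : ∀ j < k', s₄.nat 6 j ∈ C := by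
    intro j hj
    rw [h6 j hj]
    have := (hT (τ j)).1 ⟨j, hj, rfl⟩
    exact hs3.table.basis.sub ⟨this.2, τ j, this.1, rfl⟩
  have hmono : StrictMono fun j : Fin k' => τ j := fun i j hij => hτ _ _ hij j.2
  have hsp : ∀ l, storedProduct r s l = storedProduct r s₂ l := fun l =>
    storedProduct_congr (ha2.f 0).symm l
  have hvec : ∀ x, ∀ c, storedProduct r s (rowLabels
      (⟨setCell s₄.nat 18 0 x, s₄.fld, s₄.wgt⟩ : Memory F) c (d + γ)) =
      storedProduct r s₂ (rowLabels s₃ c (d + γ)) := by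
    intro x c
    rw [hsp]
    congr 1
    exact rowLabels_congr fun i _ => by simp [setCell_apply, ha4.n 5]
  refine .natSet ?_
  simp only [Expr.val, hvec]
  simp only [setCell_of_ne _ (show (6 : ℕ) ≠ 18 by decide)]
  refine ⟨ha24.setNat, k', ⟨h.tables.of_agreeOff (ha24.setNat), ?_, ?_, ?_, ?_, ?_, ?_, ?_⟩,
    ?_, ?_, ?_, ?_⟩
  · simp [setCell_apply, ha24.n 0, h.gamma]
  · simp [setCell_apply, ha24.n 0, h.card]
  · simp [setCell_apply, ha4.n 37, ha3.n 37, h37]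
  · simp [setCell_apply, h32]
  · have := hs3.le
    have := hl2.pos
    simp [setCell_apply, ha4.n 17]; omega
  · simpa [setCell_apply, ha4.n 17] using hs3.dvd
  · intro j hj
    have := hs3.mem _ (hmemC j hj)
    simp only [setCell_of_ne _ (show (6 : ℕ) ≠ 18 by decide),
      setCell_of_ne _ (show (17 : ℕ) ≠ 18 by decide), ha4.n 17]
    exact ⟨this.1, this.2.1⟩
  · exact hs3.table.card_le hmono fun j => (hT _).1 ⟨j, j.2, rfl⟩
  · intro j hj
    obtain ⟨-, -, i, hi, h, hh, hc⟩ := hs3.mem _ (hmemC j hj)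
    exact ⟨i, hi, h, hh, hcand _ _ _ hc _⟩
  · have := hs3.table.linearIndependent hmono fun T => by
      rw [← hT]
      exact ⟨fun ⟨j, hj⟩ => ⟨j, j.2, hj⟩, fun ⟨j, hj, hj'⟩ => ⟨⟨j, hj⟩, hj'⟩⟩
    convert this using 4 with j
    exact h6 j j.2
  · intro j hj i hi
    obtain ⟨c, hc, hcc⟩ := hs3.all j i ⟨hj, hi⟩
    have hrep := hs3.table.basis.rep c hc
    have e1 : storedProduct r s (rowLabels s (s.nat 6 j) d ++ familyLabels s γ i) =
        storedProduct r s₂ (rowLabels s₃ c (d + γ)) := by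
      rw [hsp, hcc.labels]
      unfold rowLabels familyLabels
      rw [ha2.n 5, ha2.n 6, ha2.n 1]
    rw [e1]
    refine Submodule.span_mono ?_ hrep
    rintro _ ⟨q, ⟨⟨hq, T, hTK, rfl⟩, hb⟩, rfl⟩
    obtain ⟨j', hj', rfl⟩ := (hT T).2 ⟨hTK, hq⟩
    refine ⟨⟨j', hj'⟩, ?_, by simp only [h6 j' hj']⟩
    show G (s.wgt 1 (s.nat 6 j)) i ≤ s₄.wgt 1 (s₄.nat 6 j')
    rw [h6 j' hj', ← ha2.w 1, ← ha2.n 6, ← hcc.weight, ha4.w 1]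
    -- A spanning row is the candidate itself, or has larger weight, or wins a tie; in each case its
    -- weight is at least as large.
    rcases hb with hb | hb | ⟨hb, -⟩
    · rw [hb]
    · exact hb.le
    · exact hb.le

end LevelPrograms

end RepFamilies

namespace RepFamilies

section MainProgram

/-! ### The algorithm -/

variable {F : Type u} [Field F] {G : ℝ → ℕ → ℝ}

/-- Write the listed rows to the output. -/
def outputProgram : Program :=
  .seq (.natSet 2 (.const 0) (var 32)) <|
  .seq (setVar 35 (.const 0)) <|
  .seq (setVar 36 (.const 0)) <|
  .whileLt (var 36) (var 32) <|
    .seq (setVar 38 (.const 0)) <|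
    .seq
      (.whileLt (var 38) (var 18) <|
        .seq (.natSet 3 (var 35) (.cell 5 (.add (.cell 6 (var 36)) (var 38)))) <|
        .seq (incVar 35) (incVar 38))
      (incVar 36)

/-- Quotient and remainder by `d` recover the row and the position from the index of an output cell,
so one running counter replaces the product `j * d`. -/
theorem outputProgram_spec {k d : ℕ} {s : Memory F} (hk : s.nat 32 0 = k) (hd : s.nat 18 0 = d) :
    HaltsIn G outputProgram s (k * (d * 4 + 4) + 4) fun s' =>
      s'.nat 2 0 = k ∧ ∀ j < k, ∀ i < d, s'.nat 3 (j * d + i) = s.nat 5 (s.nat 6 j + i) := by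
  have hdm : ∀ j i, i < d → (j * d + i) / d = j ∧ (j * d + i) % d = i := by
    intro j i hi
    have hd0 : 0 < d := by omega
    constructor
    · rw [mul_comm, Nat.mul_add_div hd0, Nat.div_eq_of_lt hi, add_zero]
    · rw [mul_comm, Nat.mul_add_mod, Nat.mod_eq_of_lt hi]
  refine .seq_one <| .natSet <| .seq_one <| .natSet <| .seq_one <| .natSet ?_
  refine HaltsIn.whileLt k (fun j s' => AgreeOff [2, 3, 35, 36, 38] [] [] s s' ∧ s'.nat 2 0 = k ∧
    j ≤ k ∧ s'.nat 36 0 = j ∧ s'.nat 35 0 = j * d ∧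
    ∀ y < j * d, s'.nat 3 y = s.nat 5 (s.nat 6 (y / d) + y % d)) ?_ ?_ ?_
  · refine ⟨(AgreeOff.refl s).setNat.setNat.setNat, ?_⟩
    simp [setCell_apply, Expr.val, hk]
  · rintro j s' ⟨hag, h2, hjk, h36, h35, h3⟩ hlt
    simp only [Expr.val, h36, hag.n 32, hk] at hlt
    refine ⟨hlt, .seq_one <| .natSet <| .seq (B₁ := d * (3 + 1) + 1) (B₂ := 1) ?_⟩
    refine HaltsIn.whileLt d (fun i s' => AgreeOff [2, 3, 35, 36, 38] [] [] s s' ∧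
      s'.nat 2 0 = k ∧ i ≤ d ∧ s'.nat 36 0 = j ∧ s'.nat 38 0 = i ∧ s'.nat 35 0 = j * d + i ∧
      ∀ y < j * d + i, s'.nat 3 y = s.nat 5 (s.nat 6 (y / d) + y % d)) ?_ ?_ ?_
    · refine ⟨hag.setNat, ?_⟩
      simpa [setCell_apply, Expr.val, h2, h36, h35] using h3
    · rintro i s' ⟨hag, h2, hi, h36, h38, h35, h3⟩ hlt'
      simp only [Expr.val, h38, hag.n 18, hd] at hlt'
      refine ⟨hlt', .seq_one <| .natSet <| .seq_one <| .natSet <| .natSet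
        ⟨hag.setNat.setNat.setNat, ?_, hlt', ?_, ?_, ?_, ?_⟩⟩
      · simp [setCell_apply, h2]
      · simp [setCell_apply, h36]
      · simp [setCell_apply, Expr.val, h38]
      · simp [setCell_apply, Expr.val, h35, add_assoc]
      · intro y hy
        simp only [Expr.val, setCell_apply, h35, h36, h38, hag.n 5, hag.n 6, true_and, false_and,
          if_false, show (3 : ℕ) ≠ 38 by decide, show (3 : ℕ) ≠ 35 by decide]
        split_ifs with hyj
        · rw [hyj, (hdm j i hlt').1, (hdm j i hlt').2]
        · exact h3 y (by omega)
    · rintro i s' ⟨hag, h2, hi, h36, h38, h35, h3⟩ hlt'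
      simp only [Expr.val, h38, hag.n 18, hd] at hlt'
      obtain rfl : i = d := by omega
      refine .natSet ⟨hag.setNat, ?_, hlt, ?_, ?_, ?_⟩
      · simp [setCell_apply, h2]
      · simp [setCell_apply, Expr.val, h36]
      · simp [setCell_apply, h35, Nat.succ_mul]
      · simpa [setCell_apply, Nat.succ_mul] using h3
  · rintro j s' ⟨hag, h2, hjk, h36, h35, h3⟩ hlt
    simp only [Expr.val, h36, hag.n 32, hk] at hlt
    obtain rfl : j = k := by omega
    refine ⟨h2, fun m hm i hi => ?_⟩
    have hlt : m * d + i < j * d := by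
      have := Nat.mul_le_mul_right d (Nat.succ_le_of_lt hm)
      rw [Nat.succ_mul] at this; omega
    rw [h3 _ hlt, (hdm m i hi).1, (hdm m i hi).2]

/-- The algorithm for a nonempty family. -/
def familyProgram : Program :=
  .seq powProgram <|
  .seq (setVar 17 (var 10)) <|
  .seq (.wgtCopy 1 (.const 0) 0 (.const 0)) <|
  .seq (.natSet 6 (.const 0) (.const 0)) <|
  .seq (setVar 32 (.const 1)) <|
  .seq (setVar 18 (.const 0)) <|
  .seq (setVar 34 (.const 0)) <|
  .seq (.whileLt (var 34) (.cell 0 (.const 1)) (.seq levelProgram (incVar 34))) outputProgram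

/-- The algorithm. -/
def mainProgram : Program :=
  .ifLt (.const 0) (.cell 0 (.const 5)) familyProgram <|
    .ifLt (.const 0) (.cell 0 (.const 1)) (.natSet 2 (.const 0) (.const 0))
      (.natSet 2 (.const 0) (.const 1))

variable {U : Type v} {n r t : ℕ} {label : U ≃ Fin n}

theorem storedProduct_map_label {A : Matrix (Fin r) U F} {s : Memory F}
    (hA : ∀ (i : Fin r) (x : U), s.fld 0 ((label x : ℕ) * r + i) = A i x) (l : List U) :
    storedProduct r s (l.map fun x => (label x : ℕ)) = columnProduct A l := by
  unfold storedProduct columnProduct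
  rw [List.map_map]
  congr 1
  refine List.map_congr_left fun x _ => ?_
  funext i
  exact hA i x

omit [Field F] in
theorem map_ofFn_label {γ h : ℕ} {s : Memory F} {x : Fin γ → U}
    (hx : ∀ j : Fin γ, s.nat 1 (h * γ + j) = (label (x j) : ℕ)) :
    (List.ofFn x).map (fun u => (label u : ℕ)) = familyLabels s γ h := by
  apply List.ext_getElem
  · simp [familyLabels]
  · intro i h1 h2
    simp only [List.length_map, List.length_ofFn] at h1
    simp [familyLabels, hx ⟨i, h1⟩]

/-- The dominant cost is `α * K * t` candidates of `64 * K ^ 3` steps each, with `α ≤ K`. -/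
theorem familyProgram_bound {r t K α k d : ℕ} (hr : r ≤ K) (hα : α ≤ K) (hk : k ≤ K) (hd : d ≤ K)
    (hK : 1 ≤ K) :
    r * 3 + 4 + (α * ((K * (t * (64 * K ^ 3 + 2) + 6) + K * 8 + 10) + 1 + 1) + 1 +
      (k * (d * 4 + 4) + 4) + 6) ≤ 128 * K ^ 5 * (t + 1) := by
  have h1 : α * ((K * (t * (64 * K ^ 3 + 2) + 6) + K * 8 + 10) + 1 + 1) ≤
      K * ((K * (t * (64 * K ^ 3 + 2) + 6) + K * 8 + 10) + 1 + 1) := Nat.mul_le_mul_right _ hα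
  have h2 : k * (d * 4 + 4) ≤ K * (K * 4 + 4) := by gcongr
  have e1 : K * ((K * (t * (64 * K ^ 3 + 2) + 6) + K * 8 + 10) + 1 + 1) =
      64 * (K ^ 5 * t) + 2 * (K ^ 2 * t) + 14 * K ^ 2 + 12 * K := by ring
  have e2 : K * (K * 4 + 4) = 4 * K ^ 2 + 4 * K := by ring
  have e3 : 128 * K ^ 5 * (t + 1) = 128 * (K ^ 5 * t) + 128 * K ^ 5 := by ring
  have h3 : K ^ 2 ≤ K ^ 5 := Nat.pow_le_pow_right hK (by norm_num)
  have h4 : K ≤ K ^ 5 := Nat.le_self_pow (by norm_num) K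
  have h5 : K ^ 2 * t ≤ K ^ 5 * t := Nat.mul_le_mul_right _ h3
  omega

/-- The loop invariant is that the listed rows form a level whose lower bounds are the stored
weights. -/
theorem familyProgram_spec {α β γ : ℕ} (hr : r = (α + β) * γ) (hr0 : 1 ≤ r) {M : Matroid U}
    (hM : M.eRank = (r : ℕ∞)) {A : Matrix (Fin r) U F} (hA : IsRepresentation A M)
    {H : Fin t → Set U} (hH : IsUniformFamily γ (Set.range H)) {w : Set U → ℝ}
    {g : ℝ → Set U → ℝ} (hw : IsInductiveUnionMaximizing (Set.range H) w g)
    (hG : ∀ (x : ℝ) (h : Fin t), G x h = g x (H h)) {s : Memory F}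
    (hs : IsInput label α β γ A H (w ∅) s) :
    HaltsIn G familyProgram s (128 * (2 ^ r) ^ 5 * (t + 1)) fun s' =>
      ∃ (k : ℕ) (x : Fin k → List U) (ω : Fin k → ℝ), IsLevel A M (Set.range H) w γ α x ω ∧
        IsOutput label (α * γ) (fun j => {u | u ∈ x j}) s' := by
  have hU : Finite U := Finite.of_equiv _ label.symm
  have hγ : 0 < γ := Nat.pos_of_ne_zero fun h => by subst h; omega
  have hrK : r < 2 ^ r := Nat.lt_two_pow_self
  have hαγ : α * γ ≤ r := by rw [hr]; exact Nat.mul_le_mul_right _ (Nat.le_add_right _ _)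
  have hα : α ≤ r := (Nat.le_mul_of_pos_right α hγ).trans hαγ
  have hch : ∀ d, r.choose d ≤ 2 ^ r := fun d => Nat.choose_le_two_pow r d
  choose y hy hyl using hs.family
  have he : ∀ h, {u | u ∈ List.ofFn (y h)} = H h := fun h => by
    rw [← hy h]; ext u; simp [List.mem_ofFn]
  have hmap : ∀ h : Fin t, (List.ofFn (y h)).map (fun u => (label u : ℕ)) =
      familyLabels s γ h := fun h => map_ofFn_label (hyl h)
  refine HaltsIn.mono (B₁ := r * 3 + 4 + (α * ((2 ^ r * (t * (64 * (2 ^ r) ^ 3 + 2) + 6) +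
    2 ^ r * 8 + 10) + 1 + 1) + 1 + (2 ^ r * ((α * γ) * 4 + 4) + 4) + 6))
    (Q := fun s' => ∃ (k : ℕ) (x : Fin k → List U) (ω : Fin k → ℝ),
      IsLevel A M (Set.range H) w γ α x ω ∧ IsOutput label (α * γ) (fun j => {u | u ∈ x j}) s')
    ?_ (familyProgram_bound hrK.le (hα.trans hrK.le) le_rfl (hαγ.trans hrK.le) (by omega))
    fun _ h => h
  refine .seq <| (powProgram_spec hs.rank).mono le_rfl ?_
  rintro s₁ ⟨ha1, ht1⟩
  refine .seq_one <| .natSet <| .seq_one <| .wgtCopy <| .seq_one <| .natSet <| .seq_one <|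
    .natSet <| .seq_one <| .natSet <| .seq_one <| .natSet <| .seq ?_
  have hag := (AgreeOff.refl (NA := [4, 5, 6, 7, 10, 11, 12, 13, 14, 15, 16, 17, 18, 19, 20, 21, 22,
    23, 24, 25, 26, 27, 28, 30, 31, 32, 33, 34, 37]) (FA := [1, 2]) (WA := [1]) s).trans ha1
  refine HaltsIn.whileLt α (fun i s' => AgreeOff [4, 5, 6, 7, 10, 11, 12, 13, 14, 15, 16, 17, 18, 19,
      20, 21, 22, 23, 24, 25, 26, 27, 28, 30, 31, 32, 33, 34, 37] [1, 2] [1] s s' ∧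
    i ≤ α ∧ s'.nat 34 0 = i ∧ ∃ k, IsListing r (i * γ) γ k t s' ∧ ∃ x : Fin k → List U,
      (IsLevel A M (Set.range H) w γ i x fun j => s'.wgt 1 (s'.nat 6 j)) ∧
      ∀ j, (x j).map (fun u => (label u : ℕ)) = rowLabels s' (s'.nat 6 j) (i * γ)) ?_ ?_ ?_
  -- The initial level is the empty list with weight `w ∅`, stored at address 0. It is never
  -- inserted into a table of pivots, so this does not clash with the marker for a free entry; new
  -- rows start at `2 ^ r`.
  · refine ⟨hag.setNat.setWgt.setNat.setNat.setNat.setNat, Nat.zero_le _,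
      by simp [setCell_apply, Expr.val], 1, ⟨⟨?_, ?_, ?_⟩, ?_, ?_, ?_, ?_, ?_, ?_, ?_⟩,
      fun _ => [], ?_, ?_⟩
    · simp [setCell_apply, ht1.rank]
    · simp [setCell_apply, ht1.size]
    · simpa [setCell_apply] using ht1.pow
    · simp [setCell_apply, ha1.n 0, hs.gamma]
    · simp [setCell_apply, ha1.n 0, hs.card]
    · simp [setCell_apply, Expr.val]
    · simp [setCell_apply, Expr.val]
    · simp [setCell_apply, Expr.val, ht1.size]
    · simp [setCell_apply, Expr.val, ht1.size]
    · intro j hj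
      obtain rfl : j = 0 := by omega
      simp [setCell_apply, Expr.val, ht1.size]
    · convert IsLevel.zero A M (Set.range H) w γ using 2 with j
      obtain rfl : j = 0 := Subsingleton.elim _ _
      simp [setCell_apply, Expr.val, ha1.w 0, hs.weight]
    · intro j; simp [rowLabels]
  · rintro i s' ⟨hag, hi, h34, k, hl, x, hx, hxl⟩ hlt
    simp only [Expr.val, h34, hag.n 0, hs.alpha] at hlt
    have hid : i * γ + γ ≤ r := by
      rw [← Nat.succ_mul]; exact (Nat.mul_le_mul_right _ hlt).trans hαγ
    have hk : k ≤ 2 ^ r := hx.card.trans (hch _)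
    refine ⟨hlt, .seq (B₁ := 2 ^ r * (t * (64 * (2 ^ r) ^ 3 + 2) + 6) + 2 ^ r * 8 + 10) (B₂ := 1) <|
      (levelProgram_spec hl hid).mono (by gcongr) ?_⟩
    rintro s'' ⟨hag', k', hl', hcard, hsub, hind, hspan⟩
    have hA' : ∀ (i : Fin r) (x : U), s'.fld 0 ((label x : ℕ) * r + i) = A i x := by
      rw [hag.f 0]; exact hs.matrix
    have hfam : ∀ h, familyLabels s' γ h = familyLabels s γ h := fun h => by
      unfold familyLabels; rw [hag.n 1]
    have hcol : ∀ j (h : Fin t), storedProduct r s' (rowLabels s' (s'.nat 6 (j : Fin k)) (i * γ) ++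
        familyLabels s' γ h) = columnProduct A (x j ++ List.ofFn (y h)) := fun j h => by
      rw [← storedProduct_map_label hA', List.map_append, hxl, hmap, hfam]
    have hsub' : ∀ j' : Fin k', ∃ (j : Fin k) (h : Fin t),
        IsCandidate G (i * γ) γ s' s'' (s''.nat 6 j') j h := fun j' => by
      obtain ⟨j, hj, h, hh, hc⟩ := hsub j' j'.2
      exact ⟨⟨j, hj⟩, ⟨h, hh⟩, hc⟩
    choose a b hab using hsub'
    have hvec : ∀ j', storedProduct r s' (rowLabels s'' (s''.nat 6 (j' : Fin k')) (i * γ + γ)) =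
        columnProduct A (x (a j') ++ List.ofFn (y (b j'))) := fun j' => by
      rw [(hab j').labels, hcol]
    simp only [hvec] at hind hspan
    refine .natSet ⟨(hag.trans hag').setNat, hlt, by simp [setCell_apply, Expr.val, hag'.n 34, h34],
      k', ?_, fun j' => x (a j') ++ List.ofFn (y (b j')), ?_, ?_⟩
    · rw [Nat.succ_mul]
      refine ⟨⟨?_, ?_, ?_⟩, ?_, ?_, ?_, ?_, ?_, ?_, ?_⟩
      · simpa [setCell_apply] using hl'.tables.rank
      · simpa [setCell_apply] using hl'.tables.size
      · simpa [setCell_apply] using hl'.tables.pow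
      · simpa [setCell_apply] using hl'.gamma
      · simpa [setCell_apply] using hl'.card
      · simpa [setCell_apply] using hl'.length
      · simpa [setCell_apply] using hl'.count
      · simpa [setCell_apply] using hl'.pos
      · simpa [setCell_apply] using hl'.dvd
      · simpa [setCell_apply] using hl'.rows
    · refine hx.succ hM hA hγ hH hw he (fun h => by simp) (fun j' => ⟨a j', b j', rfl, ?_⟩) hind
        (by rw [Nat.succ_mul]; exact hcard) fun j h => ?_
      · simp only [setCell_of_ne _ (show (6 : ℕ) ≠ 34 by decide)]
        rw [(hab j').weight, hG]
      · have := hspan j j.2 h h.2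
        rw [hcol, hG] at this
        simpa only [setCell_of_ne _ (show (6 : ℕ) ≠ 34 by decide)] using this
    · intro j'
      rw [List.map_append, hxl, hmap, ← hfam, ← (hab j').labels, Nat.succ_mul]
      simp only [setCell_of_ne _ (show (6 : ℕ) ≠ 34 by decide)]
      exact rowLabels_congr fun i _ => by simp [setCell_apply]
  · rintro i s' ⟨hag, hi, h34, k, hl, x, hx, hxl⟩ hlt
    simp only [Expr.val, h34, hag.n 0, hs.alpha] at hlt
    obtain rfl : i = α := by omega
    have hk : k ≤ 2 ^ r := hx.card.trans (hch _)
    refine (outputProgram_spec hl.count hl.length).mono (by gcongr) ?_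
    rintro s'' ⟨h2, h3⟩
    refine ⟨k, x, _, hx, h2, fun j => ⟨fun m => (x j).get (m.cast (hx.length j).symm), ?_, ?_⟩⟩
    · ext u
      simp only [Set.mem_range, Set.mem_ofPred_eq, List.mem_iff_get]
      constructor
      · rintro ⟨m, hm⟩; exact ⟨_, hm⟩
      · rintro ⟨m, hm⟩; exact ⟨m.cast (hx.length j), by simpa using hm⟩
    · intro m
      rw [h3 j j.2 m m.2]
      have e := congrArg (fun l => l[(m : ℕ)]?) (hxl j)
      have hm : (m : ℕ) < (x j).length := by rw [hx.length]; exact m.2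
      simp [rowLabels, hm] at e
      simpa using e.symm

end MainProgram

end RepFamilies

/-! ### The theorem for arbitrary families -/

theorem mainTheorem5 :
    ∃ (P : RepFamilies.Program) (c : ℕ),
      ∀ (F : Type u) [Field F] (U : Type v) (n : ℕ) (label : U ≃ Fin n)
        (α β γ r t : ℕ) (_hr : r = (α + β) * γ) (_hr_pos : 1 ≤ r)
        (M : Matroid U) (_hrank : M.eRank = (r : ℕ∞))
        (A : Matrix (Fin r) U F) (_hA : RepFamilies.IsRepresentation A M)
        (H : Fin t → Set U) (_hH_inj : Function.Injective H)
        (_hH : RepFamilies.IsUniformFamily γ (Set.range H))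
        (w : Set U → ℝ) (g : ℝ → Set U → ℝ)
        (_hw : RepFamilies.IsInductiveUnionMaximizing (Set.range H) w g)
        (G : ℝ → ℕ → ℝ) (_hG : ∀ (x : ℝ) (h : Fin t), G x h = g x (H h))
        (s : RepFamilies.Memory F) (_hs : RepFamilies.IsInput label α β γ A H (w ∅) s),
      ∃ (s' : RepFamilies.Memory F) (steps ops k : ℕ) (R : Fin k → Set U),
        RepFamilies.Runs G P s s' steps ops ∧
        ops ≤ 2 ^ (c * r) * t ∧
        steps ≤ 2 ^ (c * r) * (t + 1) ∧
        RepFamilies.IsOutput label (α * γ) R s' ∧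
        Function.Injective R ∧
        k ≤ r.choose (α * γ) ∧
        RepFamilies.IsMaxRepresentative M (β * γ)
          (RepFamilies.independentUnions M α (Set.range H)) w (Set.range R) := by
  -- With `K = 2 ^ r ≥ 2`, the running time plus the first test is at most `K ^ 13 * (t + 1)`; one
  -- more factor `K` absorbs `t + 1 ≤ 2 * t` in the count of operations.
  refine ⟨RepFamilies.mainProgram, 14, ?_⟩
  intro F _ U n label α β γ r t hr hr0 M hM A hA H _ hH w g hw G hG s hs
  have hK : 2 ≤ 2 ^ r := by simpa using Nat.pow_le_pow_right (n := 2) (by norm_num) hr0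
  have hc : 2 ^ (14 * r) = (2 ^ r) ^ 14 := by rw [mul_comm, pow_mul]
  have hpos : 0 < 2 ^ (14 * r) := by positivity
  -- For an empty family no field operation or oracle call is allowed, so the answer is written at
  -- once, by two tests and one assignment.
  rcases Nat.eq_zero_or_pos t with rfl | ht
  · have h5 : ¬ (RepFamilies.Expr.const 0).val s < (RepFamilies.Expr.cell 0 (.const 5)).val s := by
      simp [RepFamilies.Expr.val, hs.card]
    have hsteps : 1 + 1 + 1 ≤ 2 ^ (14 * r) * (0 + 1) := by
      have := Nat.pow_le_pow_left hK 14
      rw [hc]; omega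
    rcases Nat.eq_zero_or_pos α with rfl | hα
    -- For `α = 0` the family to be represented consists of the empty set alone.
    · have hl := RepFamilies.IsLevel.zero A M (Set.range H) w γ
      refine ⟨_, _, _, 1, fun _ => {u | u ∈ []}, .ifLt_false h5 (.ifLt_false ?_ (.natSet ..)),
        le_rfl, hsteps, ⟨?_, fun h => ⟨fun j => absurd j.2 (by simp), ?_, ?_⟩⟩, hl.injective,
        hl.card, hl.isMaxRepresentative⟩
      · simp [RepFamilies.Expr.val, hs.alpha]
      · simp [RepFamilies.Expr.val, RepFamilies.setCell_apply]
      · ext u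
        simp only [Set.mem_range, List.not_mem_nil, Set.mem_ofPred_eq, iff_false]
        rintro ⟨j, -⟩
        exact absurd j.2 (by simp)
      · intro j; exact absurd j.2 (by simp)
    -- For `α > 0` there is nothing to represent, since a union would need a member of the empty
    -- family.
    · refine ⟨_, _, _, 0, fun _ => ∅, .ifLt_false h5 (.ifLt_true ?_ (.natSet ..)),
        le_rfl, hsteps, ⟨?_, fun h => h.elim0⟩, fun h => h.elim0, Nat.zero_le _, ?_, ?_⟩
      · simpa [RepFamilies.Expr.val, hs.alpha] using hα
      · simp [RepFamilies.Expr.val, RepFamilies.setCell_apply]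
      · rintro _ ⟨j, -⟩; exact j.elim0
      · rintro Y - X ⟨-, K, hKm, -⟩
        obtain ⟨j, -⟩ := hKm ⟨0, hα⟩
        exact j.elim0
  · obtain ⟨s', T, N, hrun, hT, k, x, ω, hl, ho⟩ :=
      RepFamilies.familyProgram_spec hr hr0 hM hA hH hw hG hs
    have h0 : (RepFamilies.Expr.const 0).val s < (RepFamilies.Expr.cell 0 (.const 5)).val s := by
      simpa [RepFamilies.Expr.val, hs.card] using ht
    have hN := hrun.ops_le
    have hb : 128 * (2 ^ r) ^ 5 + 1 ≤ (2 ^ r) ^ 13 := by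
      have h1 : 2 ^ 8 ≤ (2 ^ r) ^ 8 := Nat.pow_le_pow_left hK 8
      have h2 : 1 ≤ (2 ^ r) ^ 5 := Nat.one_le_pow _ _ (by omega)
      calc 128 * (2 ^ r) ^ 5 + 1 ≤ 2 ^ 8 * (2 ^ r) ^ 5 := by omega
        _ ≤ (2 ^ r) ^ 8 * (2 ^ r) ^ 5 := Nat.mul_le_mul_right _ h1
        _ = (2 ^ r) ^ 13 := by rw [← pow_add]
    have hT' : T + 1 ≤ (2 ^ r) ^ 13 * (t + 1) := by
      refine le_trans ?_ (Nat.mul_le_mul_right _ hb)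
      rw [Nat.add_mul]; omega
    have h14 : 2 ^ (14 * r) = (2 ^ r) ^ 13 * 2 ^ r := by rw [hc, pow_succ]
    refine ⟨s', _, _, k, _, .ifLt_true h0 hrun, ?_, ?_, ho, hl.injective, hl.card,
      hl.isMaxRepresentative⟩
    · refine (hN.trans (Nat.le_succ T)).trans (hT'.trans ?_)
      rw [h14, mul_assoc]
      refine Nat.mul_le_mul_left _ ?_
      calc t + 1 ≤ 2 * t := by omega
        _ ≤ 2 ^ r * t := Nat.mul_le_mul_right _ hK
    · refine hT'.trans (Nat.mul_le_mul_right _ ?_)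
      rw [h14]
      exact Nat.le_mul_of_pos_right _ (by omega)
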